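/- Let $p\ge 0$ and let $M(p,1)=\mathbb R^{p+1}$ have coordinates $x_0,\dots,x_p$ and metric $K=\mathrm{diag}(-1,1,\dots,1)=(g_{\mu\nu})$. Let $e(p,1)$ be the Lie algebra of block matrices $\begin{pmatrix}X&\alpha\\0&0\end{pmatrix}$ with $XK+KX^T=0$, $\alpha\in\mathbb R^{p+1}$, and let $E(p,1)$ be the group of matrices $\begin{pmatrix}G&a\\0&1\end{pmatrix}$ with $GKG^T=K$ (so $G$ runs over all of $O(p,1)$), acting on $e(p,1)$ by conjugation. Let $P_\mu$ be the translations and $L_{\mu\nu}$ the (pseudo)rotations, normalized by $[P_\alpha,L_{\mu\nu}]=g_{\alpha\mu}P_\nu-g_{\alpha\nu}P_\mu$. A MASA of $e(p,1)$ is an Abelian subalgebra equal to its centralizer. It is orthogonally decomposable if its linear parts $X$ preserve some decomposition of $M(p,1)$ into two nonzero complementary orthogonal subspaces, and orthogonally indecomposable otherwise. Braces denote the subalgebra generated by the listed elements. **1.** For every $p$, orthogonally indecomposable MASAs of $e(p,1)$ exist. The following subalgebras are orthogonally indecomposable MASAs, and every orthogonally indecomposable MASA is $E(p,1)$-conjugate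 to one of them: * $p=0$: $\{P_0\}$; * $p=1$: $\{L_{01}\}$; * $p=2$: $\{P_0-P_1,\ L_{02}-L_{12}+\kappa(P_0+P_1)\}$, $\kappa\in\{0,1,-1\}$; * $p\ge 3$: $\{P_0-P_1,\ L_{0j}-L_{1j}+a_jP_j\ (j=2,\dots,p)\}$, where either $a_2=1\ge|a_3|\ge\dots\ge|a_p|\ge0$ and $\sum_j a_j=0$, or $a_2=\dots=a_p=0$. Those with different $\kappa$, or with different sets $\{a_2,\dots,a_p\}$ (counted with multiplicity), are inequivalent under the connected component of the identity of $E(p,1)$. For $p=2$, $\kappa=1$ and $\kappa=-1$ are equivalent under the entire group $E(p,1)$. **2.** For $p=k+2l+m$ ($k,l,m\ge0$) consider the orthogonal decomposition $M(p,1)=M(k,1)\oplus l\,M(2,0)\oplus m\,M(1,0)$, where $M(k,1)$ has the coordinates $x_0,\dots,x_k$, the $i$-th plane $M(2,0)$ has the coordinates $x_{k+2i-1},x_{k+2i}$, and the lines $M(1,0)$ have the remaining coordinates. Let $S$ be the subalgebra generated by an algebra of the list in 1 (with $k$ in place of $p$) on $M(k,1)$, the rotation of each $M(2,0)$, and the translation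 along each $M(1,0)$. A subalgebra of $e(p,1)$ is a MASA if and only if it is $E(p,1)$-conjugate to such an $S$. **3.** Two such subalgebras $S,S'$ are equivalent under $E(p,1)$ if and only if they have the same $k,l,m$ and their constants agree up to a common sign: $\kappa'=\pm\kappa$ if $k=2$, and $\{a'_2,\dots,a'_k\}=\pm\{a_2,\dots,a_k\}$ as sets with multiplicity if $k\ge3$. If $S,S'$ are equivalent under the connected component of the identity of $E(p,1)$, then they have the same $k,l,m$ and the same constants ($\kappa'=\kappa$, respectively $\{a'_j\}=\{a_j\}$ with multiplicity), except that for $k=2$ and $l+m>0$ only $\kappa'=\pm\kappa$ follows. -/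

import Mathlib

open Matrix

attribute [local instance] LieRing.ofAssociativeRing

noncomputable section

namespace MinkMASA

/-- Index set of the block matrices: coordinates `x_0, ..., x_p` (with `x_0` the time coordinate)
and one further row and column for the translations. -/
abbrev Idx (p : ℕ) : Type := Fin (p + 1) ⊕ Unit

/-- The square matrices in which the Poincaré algebra and group are realized. -/
abbrev Mat (p : ℕ) : Type := Matrix (Idx p) (Idx p) ℝ

/-- Diagonal entries of the metric: `g_00 = -1`, and `g_jj = 1` for `j ≥ 1`. -/
def gDiag (j : ℕ) : ℝ := if j = 0 then -1 else 1

/-- The metric matrix `K = diag(-1, 1, ..., 1)` of `M(p,1)`. -/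
def metric (p : ℕ) : Matrix (Fin (p + 1)) (Fin (p + 1)) ℝ := Matrix.diagonal fun i => gDiag i

/-- The Lie algebra `e(p,1)`: block matrices `[[X, α], [0, 0]]` with `X K + K Xᵀ = 0`, with the
commutator as bracket. -/
def eAlg (p : ℕ) : LieSubalgebra ℝ (Mat p) where
  carrier := {Y | ∃ (X : Matrix (Fin (p + 1)) (Fin (p + 1)) ℝ) (α : Matrix (Fin (p + 1)) Unit ℝ),
    X * metric p + metric p * Xᵀ = 0 ∧ Y = Matrix.fromBlocks X α 0 0}
  add_mem' := by
    rintro _ _ ⟨X, α, hX, rfl⟩ ⟨X', α', hX', rfl⟩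
    refine ⟨X + X', α + α', ?_, by simp [Matrix.fromBlocks_add]⟩
    rw [Matrix.transpose_add, Matrix.add_mul, Matrix.mul_add]
    calc _ = (X * metric p + metric p * Xᵀ) + (X' * metric p + metric p * X'ᵀ) := by abel
      _ = 0 := by rw [hX, hX', add_zero]
  zero_mem' := ⟨0, 0, by simp, by simp⟩
  smul_mem' := by
    rintro c _ ⟨X, α, hX, rfl⟩
    refine ⟨c • X, c • α, ?_, by simp [Matrix.fromBlocks_smul]⟩
    rw [Matrix.transpose_smul, Matrix.smul_mul, Matrix.mul_smul, ← smul_add, hX, smul_zero]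
  lie_mem' := by
    rintro _ _ ⟨X, α, hX, rfl⟩ ⟨X', α', hX', rfl⟩
    refine ⟨X * X' - X' * X, X * α' - X' * α, ?_, ?_⟩
    · have h1 : metric p * Xᵀ = -(X * metric p) := eq_neg_of_add_eq_zero_right hX
      have h2 : metric p * X'ᵀ = -(X' * metric p) := eq_neg_of_add_eq_zero_right hX'
      rw [Matrix.transpose_sub, Matrix.transpose_mul, Matrix.transpose_mul, Matrix.mul_sub,
        ← Matrix.mul_assoc, ← Matrix.mul_assoc, h1, h2, Matrix.neg_mul, Matrix.neg_mul,
        Matrix.mul_assoc, Matrix.mul_assoc X, h1, h2]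
      simp only [Matrix.mul_neg, Matrix.sub_mul, Matrix.mul_assoc]
      abel
    · rw [Ring.lie_def, Matrix.fromBlocks_multiply, Matrix.fromBlocks_multiply]
      ext (i | i) (j | j) <;> simp

/-- The group `E(p,1)` (with all four components of `O(p,1)`): block matrices `[[G, a], [0, 1]]`
with `G K Gᵀ = K`. -/
def eGroup (p : ℕ) : Set (Mat p) :=
  {H | ∃ (G : Matrix (Fin (p + 1)) (Fin (p + 1)) ℝ) (a : Matrix (Fin (p + 1)) Unit ℝ),
    G * metric p * Gᵀ = metric p ∧ H = Matrix.fromBlocks G a 0 1}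

/-- The connected component of the identity of `E(p,1)`. -/
def eGroup₀ (p : ℕ) : Set (Mat p) := connectedComponentIn (eGroup p) 1

/-- Two subalgebras are conjugate under (equivalent with respect to) a set `S` of invertible
matrices: `H L H⁻¹ = L'` for some `H ∈ S`. -/
def Conj {p : ℕ} (S : Set (Mat p)) (L L' : LieSubalgebra ℝ (Mat p)) : Prop :=
  ∃ H ∈ S, (fun Y : Mat p => H * Y * H⁻¹) '' (L : Set (Mat p)) = (L' : Set (Mat p))

/-- `L` is a maximal Abelian subalgebra (MASA) of `e(p,1)`: an Abelian subalgebra that is equal to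
its centralizer in `e(p,1)`. -/
def IsMASA (p : ℕ) (L : LieSubalgebra ℝ (Mat p)) : Prop :=
  L ≤ eAlg p ∧ (∀ Y ∈ L, ∀ Z ∈ L, ⁅Y, Z⁆ = 0) ∧
    ∀ Y ∈ eAlg p, (∀ Z ∈ L, ⁅Y, Z⁆ = 0) → Y ∈ L

/-- `L` preserves a decomposition of `M(p,1)` into two nonzero complementary subspaces that are
orthogonal for the metric (and hence nondegenerate).  The linear part `X` of `Y = [[X, α], [0, 0]]`
is the block `Y.toBlocks₁₁`. -/
def OrthDecomposable (p : ℕ) (L : LieSubalgebra ℝ (Mat p)) : Prop :=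
  ∃ W₁ W₂ : Submodule ℝ (Fin (p + 1) → ℝ), W₁ ≠ ⊥ ∧ W₂ ≠ ⊥ ∧ IsCompl W₁ W₂ ∧
    (∀ u ∈ W₁, ∀ v ∈ W₂, u ⬝ᵥ (metric p *ᵥ v) = 0) ∧
    ∀ Y ∈ L, (∀ u ∈ W₁, Y.toBlocks₁₁ *ᵥ u ∈ W₁) ∧ (∀ u ∈ W₂, Y.toBlocks₁₁ *ᵥ u ∈ W₂)

/-- The translation `P_j`, for `0 ≤ j ≤ p`. -/
def P (p j : ℕ) : Mat p :=
  Matrix.fromBlocks 0 (Matrix.of fun i _ => if (i : ℕ) = j then 1 else 0) 0 0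

/-- The (pseudo)rotation `L_{μν}`, for `0 ≤ μ, ν ≤ p`, `μ ≠ ν`: the matrix
`g_νν E_{μν} - g_μμ E_{νμ}`, so that `[P_α, L_{μν}] = g_{αμ} P_ν - g_{αν} P_μ`. -/
def L (p μ ν : ℕ) : Mat p :=
  Matrix.fromBlocks
    (Matrix.of fun i j => (if (i : ℕ) = μ ∧ (j : ℕ) = ν then gDiag ν else 0)
      - (if (i : ℕ) = ν ∧ (j : ℕ) = μ then gDiag μ else 0)) 0 0 0

/-- The list of candidates for the component in the Minkowski summand `M(k,1)`:
`k = 0`, `k = 1`, `k = 2` with `κ ∈ {0, 1, -1}`, and `k = n + 3` with real constants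
`a_2, ..., a_k`, where `a_j` is stored as `a (j - 2)`. -/
inductive Block : Type
  | time : Block
  | boost : Block
  | null (κ : SignType) : Block
  | multi (n : ℕ) (a : Fin (n + 2) → ℝ) : Block

namespace Block

/-- The number `k` of the space `M(k,1)` to which the block belongs. -/
def k : Block → ℕ
  | time => 0
  | boost => 1
  | null _ => 2
  | multi n _ => n + 3

/-- Either `a_2 = 1 ≥ |a_3| ≥ ... ≥ |a_k| ≥ 0` and `∑ a_j = 0`, or all `a_j` vanish. -/
def Normalized : Block → Prop
  | multi _ a => (a 0 = 1 ∧ (∀ i j, i ≤ j → |a j| ≤ |a i|) ∧ ∑ i, a i = 0) ∨ ∀ i, a i = 0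
  | _ => True

/-- The generators of the block, written in `e(p,1)` with `p ≥ k`, on the coordinates
`x_0, ..., x_k`. -/
def gens (p : ℕ) : Block → Set (Mat p)
  | time => {P p 0}
  | boost => {L p 0 1}
  | null κ => {P p 0 - P p 1, L p 0 2 - L p 1 2 + (κ : ℝ) • (P p 0 + P p 1)}
  | multi n a => {P p 0 - P p 1} ∪
      Set.range fun j : Fin (n + 2) => L p 0 (j + 2) - L p 1 (j + 2) + a j • P p (j + 2)

/-- Two blocks have the same type and the same constants: the same `κ`, or the same set
(with multiplicities) `{a_2, ..., a_k}`. -/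
inductive Same : Block → Block → Prop
  | time : Same time time
  | boost : Same boost boost
  | null (κ : SignType) : Same (null κ) (null κ)
  | multi (n : ℕ) (a : Fin (n + 2) → ℝ) (σ : Equiv.Perm (Fin (n + 2))) :
      Same (multi n a) (multi n (a ∘ σ))

/-- The block with all constants replaced by their negatives. -/
def neg : Block → Block
  | time => time
  | boost => boost
  | null κ => null (-κ)
  | multi n a => multi n (-a)

end Block

/-- The subalgebra of `e(p,1)` attached to the orthogonal decomposition
`M(p,1) = M(k,1) ⊕ l M(2,0) ⊕ m M(1,0)` with `p = k + 2l + m`: the block `B` on the coordinates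
`x_0, ..., x_k`, the rotation `L_{k+2i+1, k+2i+2}` in each of the `l` Euclidean planes, and the
translation along each of the `m` last coordinates. -/
def std (p : ℕ) (B : Block) (l m : ℕ) : LieSubalgebra ℝ (Mat p) :=
  LieSubalgebra.lieSpan ℝ (Mat p)
    (B.gens p
      ∪ (Set.range fun i : Fin l => L p (B.k + 2 * i + 1) (B.k + 2 * i + 2))
      ∪ (Set.range fun i : Fin m => P p (B.k + 2 * l + i + 1)))

end MinkMASA

end

open MinkMASA

/-! Write an element of e(p,1) as a pair (X, α). Two elements commute exactly when X and Y commute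
and Xβ = Yα; by skewness the second condition says ⟨β, Xv⟩ = ⟨α, Yv⟩ for all v. A MASA is thus a
commuting family of skew matrices carrying a cocycle of translations. It is brought to normal form
by choosing a frame for the matrices and an origin for the translations.

Linear parts. A joint complex eigenvector in an invariant subspace yields a real joint eigenvector
or a spacelike plane that is rotated nontrivially (`exists_eigenvector_or_plane`). Split off a
maximal orthonormal family of such planes and of fixed spacelike lines. The complement M is
invariant and contains a timelike vector, and by maximality every nonzero invariant subspace of M
contains a joint eigenvector that is not spacelike. Since orthogonal nonzero vectors that are not
spacelike are parallel (`exists_smul_of_nonpos`), three cases remain. A fixed timelike vector spans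
M. A null eigenvector with a nonzero eigenvalue makes M a boosted plane. Otherwise all X are
nilpotent on M; in a frame e, f, x_i with e, f null and e fixed, X is determined on M by the
transverse vector Xf, and every transverse vector occurs (`exists_nullData`).

Translations. On a rotated or boosted plane a single element acting nontrivially fixes the origin,
and the cocycle identity then removes the components of all others. In the null case with one
transverse direction a single constant survives, the value of ⟨α, e⟩, which rescaling e reduces to a
sign κ. With several transverse directions ⟨α, e⟩ = 0, and the transverse components of α form a
symmetric matrix applied to Xf. Rotating the x_i diagonalizes it, moving the origin subtracts a
scalar matrix, and rescaling e multiplies it: this gives the a_j. By maximality the MASA contains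
the generators so adapted, and it equals the algebra they generate because the standard algebras are
self-centralizing (`mem_std_of_comm`, `conj_of_gens`).

Invariants. The ranks of the spaces annihilated by all X, and by all products of two X, together
with p give l and m, except that time and boost blocks are told apart by a timelike fixed vector. A
conjugacy of null blocks sends e to ce and acts orthogonally on the transverse directions, so the
two diagonal matrices of constants are similar up to a scale and a shift. The normalization leaves
only a sign, which -1 in O(p,1) realizes. On the identity component c > 0 and the determinant is
positive, which excludes the sign change except for k = 2 with l + m > 0. Indecomposability of the
null blocks holds because every nonzero invariant subspace contains e. -/

namespace MinkMASA

/-! ### The Lorentz form -/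

/-- The ambient space `M(p,1)`. -/
abbrev V (p : ℕ) : Type := Fin (p + 1) → ℝ

/-- The Lorentz form of `M(p,1)`. -/
noncomputable def mf (p : ℕ) : V p →ₗ[ℝ] V p →ₗ[ℝ] ℝ := Matrix.toBilin' (metric p)

/-- The `j`-th coordinate vector of `M(p,1)`, indexed by naturals. -/
def ev (p j : ℕ) : V p := fun i => if (i : ℕ) = j then 1 else 0

theorem metric_mul_self (p : ℕ) : metric p * metric p = 1 := by
  rw [metric, Matrix.diagonal_mul_diagonal, ← Matrix.diagonal_one]
  congr 1
  ext i
  unfold gDiag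
  split_ifs <;> norm_num

theorem mf_eq (p : ℕ) (u v : V p) : mf p u v = u ⬝ᵥ metric p *ᵥ v :=
  Matrix.toBilin'_apply' _ _ _

theorem mf_eq_sum (p : ℕ) (u v : V p) : mf p u v = ∑ i : Fin (p + 1), gDiag i * (u i * v i) := by
  rw [mf_eq, metric, dotProduct]
  refine Finset.sum_congr rfl fun i _ => ?_
  rw [Matrix.mulVec_diagonal]
  ring

theorem mf_eq_sum_succ (p : ℕ) (u v : V p) :
    mf p u v = -(u 0 * v 0) + ∑ i : Fin p, u i.succ * v i.succ := by
  rw [mf_eq_sum, Fin.sum_univ_succ]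
  simp [gDiag]

theorem mf_comm (p : ℕ) (u v : V p) : mf p u v = mf p v u := by
  simp only [mf_eq_sum, mul_comm (u _)]

theorem mf_ev (p : ℕ) (v : V p) (i : Fin (p + 1)) : mf p v (ev p i) = gDiag i * v i := by
  rw [mf_eq_sum, Finset.sum_eq_single i]
  · simp [ev]
  · intro j _ hj
    simp [ev, Fin.val_inj, hj]
  · simp

theorem gDiag_ne_zero (i : ℕ) : gDiag i ≠ 0 := by
  unfold gDiag; split_ifs <;> norm_num

theorem gDiag_mul_self (i : ℕ) : gDiag i * gDiag i = 1 := by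
  unfold gDiag; split_ifs <;> norm_num

theorem gDiag_succ (i : ℕ) : gDiag (i + 1) = 1 := by simp [gDiag]

theorem mf_ev_ev (p i j : ℕ) (hi : i ≤ p) :
    mf p (ev p i) (ev p j) = if i = j then gDiag i else 0 := by
  rw [mf_comm]
  have h := mf_ev p (ev p j) ⟨i, by omega⟩
  simp only at h
  rw [h]
  simp [ev]

theorem eq_of_mf (p : ℕ) {u v : V p} (h : ∀ j ≤ p, mf p u (ev p j) = mf p v (ev p j)) :
    u = v := by
  ext i
  have := h i (by omega)
  rw [mf_ev, mf_ev] at this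
  exact mul_left_cancel₀ (gDiag_ne_zero i) this

theorem eq_zero_of_mf (p : ℕ) {u : V p} (h : ∀ j ≤ p, mf p u (ev p j) = 0) : u = 0 :=
  eq_of_mf p fun j hj => by simp [h j hj]

/-- Vectors orthogonal to a nonspacelike vector `e` are spacelike or multiples of `e`. -/
theorem exists_smul_of_nonpos {p : ℕ} {e u : V p} (he : e ≠ 0) (hee : mf p e e ≤ 0)
    (heu : mf p e u = 0) (huu : mf p u u ≤ 0) : ∃ c : ℝ, u = c • e := by
  have h0 : e 0 ≠ 0 := by
    intro h
    apply he
    rw [mf_eq_sum_succ, h] at hee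
    have hs : ∑ i : Fin p, e i.succ * e i.succ = 0 :=
      le_antisymm (by linarith) (Finset.sum_nonneg fun i _ => mul_self_nonneg _)
    rw [Finset.sum_eq_zero_iff_of_nonneg fun i _ => mul_self_nonneg _] at hs
    ext i
    refine Fin.cases h (fun i => ?_) i
    simpa using hs i (Finset.mem_univ i)
  -- Subtracting a multiple of e removes the time component without making the square of the vector
  -- positive, since e is not spacelike; a vector without time component and with nonpositive square
  -- vanishes.
  set w : V p := u - (u 0 / e 0) • e with hw
  have hw0 : w 0 = 0 := by simp [hw, h0]
  have hww : mf p w w ≤ 0 := by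
    have : mf p w w = mf p u u + (u 0 / e 0) ^ 2 * mf p e e := by
      simp only [hw, map_sub, map_smul, LinearMap.sub_apply, LinearMap.smul_apply, smul_eq_mul,
        mf_comm p u e, heu]
      ring
    rw [this]
    nlinarith [sq_nonneg (u 0 / e 0)]
  rw [mf_eq_sum_succ, hw0] at hww
  have hs : ∑ i : Fin p, w i.succ * w i.succ = 0 :=
    le_antisymm (by linarith) (Finset.sum_nonneg fun i _ => mul_self_nonneg _)
  rw [Finset.sum_eq_zero_iff_of_nonneg fun i _ => mul_self_nonneg _] at hs
  have hw' : w = 0 := by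
    ext i
    refine Fin.cases hw0 (fun i => ?_) i
    simpa using hs i (Finset.mem_univ i)
  exact ⟨u 0 / e 0, sub_eq_zero.mp hw'⟩

/-! ### Skew matrices, isometries, and wedge products -/

/-- Matrices that are skew for the Lorentz form. -/
def Skew {p : ℕ} (X : Matrix (Fin (p + 1)) (Fin (p + 1)) ℝ) : Prop :=
  ∀ u v, mf p (X *ᵥ u) v = -mf p u (X *ᵥ v)

/-- Matrices that preserve the Lorentz form. -/
def Isom {p : ℕ} (G : Matrix (Fin (p + 1)) (Fin (p + 1)) ℝ) : Prop :=
  ∀ u v, mf p (G *ᵥ u) (G *ᵥ v) = mf p u v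

theorem mf_mulVec_left (p : ℕ) (X : Matrix (Fin (p + 1)) (Fin (p + 1)) ℝ) (u v : V p) :
    mf p (X *ᵥ u) v = u ⬝ᵥ (Xᵀ * metric p) *ᵥ v := by
  rw [mf_eq, ← Matrix.vecMul_transpose, ← Matrix.dotProduct_mulVec, Matrix.mulVec_mulVec]

theorem ext_of_dotProduct {p : ℕ} {A B : Matrix (Fin (p + 1)) (Fin (p + 1)) ℝ}
    (h : ∀ u v : V p, u ⬝ᵥ A *ᵥ v = u ⬝ᵥ B *ᵥ v) : A = B := by
  ext i j
  simpa using h (Pi.single i 1) (Pi.single j 1)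

/-- The metric is its own inverse, so multiplying by it on both sides exchanges the condition on X
with the one on its transpose, which is skewness of the form. -/
theorem skew_iff {p : ℕ} (X : Matrix (Fin (p + 1)) (Fin (p + 1)) ℝ) :
    X * metric p + metric p * Xᵀ = 0 ↔ Skew X := by
  have h1 : Skew X ↔ Xᵀ * metric p = -(metric p * X) := by
    constructor
    · intro h
      refine ext_of_dotProduct fun u v => ?_
      rw [← mf_mulVec_left, h u v, mf_eq, Matrix.mulVec_mulVec, Matrix.neg_mulVec,
        dotProduct_neg]
    · intro h u v
      rw [mf_mulVec_left, h, Matrix.neg_mulVec, dotProduct_neg, mf_eq, Matrix.mulVec_mulVec]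
  rw [h1]
  constructor
  · intro h
    have := congrArg (fun Z => metric p * Z * metric p) h
    simp only [Matrix.mul_add, Matrix.add_mul, ← Matrix.mul_assoc, metric_mul_self,
      Matrix.one_mul] at this
    rw [Matrix.mul_assoc, metric_mul_self] at this
    simp only [Matrix.mul_one, Matrix.mul_zero, Matrix.zero_mul] at this
    exact eq_neg_of_add_eq_zero_right this
  · intro h
    have := congrArg (fun Z => metric p * Z * metric p) h
    simp only [Matrix.mul_neg, Matrix.neg_mul, ← Matrix.mul_assoc, metric_mul_self,
      Matrix.one_mul] at this
    rw [Matrix.mul_assoc, metric_mul_self, Matrix.mul_one] at this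
    rw [this, add_neg_cancel]

theorem isom_iff {p : ℕ} (G : Matrix (Fin (p + 1)) (Fin (p + 1)) ℝ) :
    G * metric p * Gᵀ = metric p ↔ Isom G := by
  have h1 : Isom G ↔ Gᵀ * metric p * G = metric p := by
    constructor
    · intro h
      refine ext_of_dotProduct fun u v => ?_
      rw [← mf_eq, ← h u v, mf_mulVec_left, Matrix.mulVec_mulVec]
    · intro h u v
      rw [mf_mulVec_left, Matrix.mulVec_mulVec, h, mf_eq]
  rw [h1]
  constructor
  · intro h
    have h2 : (metric p * Gᵀ * metric p) * G = 1 := by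
      refine mul_eq_one_comm.mp ?_
      rw [← Matrix.mul_assoc, ← Matrix.mul_assoc, h, metric_mul_self]
    have := congrArg (fun Z => metric p * Z) h2
    simpa only [← Matrix.mul_assoc, metric_mul_self, Matrix.one_mul, Matrix.mul_one] using this
  · intro h
    have h2 : G * (metric p * Gᵀ * metric p) = 1 := by
      refine mul_eq_one_comm.mp ?_
      rw [Matrix.mul_assoc, Matrix.mul_assoc, ← Matrix.mul_assoc Gᵀ, h, metric_mul_self]
    have := congrArg (fun Z => Z * metric p) h2
    simp only [Matrix.mul_assoc, metric_mul_self, Matrix.one_mul, Matrix.mul_one] at this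
    rw [Matrix.mul_assoc, this]

theorem Isom.exists_inverse {p : ℕ} {G : Matrix (Fin (p + 1)) (Fin (p + 1)) ℝ} (h : Isom G) :
    ∃ G', G * G' = 1 ∧ G' * G = 1 ∧ Isom G' := by
  have h1 := (isom_iff G).mpr h
  have h2 : G * (metric p * Gᵀ * metric p) = 1 := by
    rw [← Matrix.mul_assoc, ← Matrix.mul_assoc, h1, metric_mul_self]
  refine ⟨metric p * Gᵀ * metric p, h2, mul_eq_one_comm.mp h2, fun u v => ?_⟩
  rw [← h, Matrix.mulVec_mulVec, Matrix.mulVec_mulVec, h2, Matrix.one_mulVec, Matrix.one_mulVec]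

/-- The infinitesimal (pseudo)rotation attached to two vectors. -/
noncomputable def wedge {p : ℕ} (u v : V p) : Matrix (Fin (p + 1)) (Fin (p + 1)) ℝ :=
  Matrix.vecMulVec u (metric p *ᵥ v) - Matrix.vecMulVec v (metric p *ᵥ u)

theorem wedge_mulVec {p : ℕ} (u v x : V p) :
    wedge u v *ᵥ x = mf p v x • u - mf p u x • v := by
  rw [wedge, Matrix.sub_mulVec, Matrix.vecMulVec_mulVec, Matrix.vecMulVec_mulVec, mf_comm p v,
    mf_comm p u, mf_eq, mf_eq, dotProduct_comm x, dotProduct_comm x]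
  simp

theorem ext_mulVec {p : ℕ} {A B : Matrix (Fin (p + 1)) (Fin (p + 1)) ℝ}
    (h : ∀ v : V p, A *ᵥ v = B *ᵥ v) : A = B :=
  ext_of_dotProduct fun u v => by rw [h]

theorem ext_mulVec_ev {p : ℕ} {A B : Matrix (Fin (p + 1)) (Fin (p + 1)) ℝ}
    (h : ∀ j ≤ p, A *ᵥ ev p j = B *ᵥ ev p j) : A = B := by
  ext i j
  have := congrFun (h j (by omega)) i
  have h2 : ev p j = Pi.single j 1 := by
    ext i
    simp [ev, Pi.single_apply, Fin.val_inj]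
  rw [h2] at this
  simpa using this

theorem skew_wedge {p : ℕ} (u v : V p) : Skew (wedge u v) := by
  intro x y
  simp only [wedge_mulVec, map_sub, map_smul, LinearMap.sub_apply, LinearMap.smul_apply,
    smul_eq_mul, mf_comm p x]
  ring

/-- Bracketing with X is a derivation of wedge products. Commutation with a generator thereby
becomes a relation between vectors. -/
theorem Skew.comm_wedge {p : ℕ} {X : Matrix (Fin (p + 1)) (Fin (p + 1)) ℝ} (hX : Skew X)
    (u v : V p) : X * wedge u v - wedge u v * X = wedge (X *ᵥ u) v + wedge u (X *ᵥ v) := by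
  refine ext_mulVec fun x => ?_
  simp only [Matrix.sub_mulVec, Matrix.add_mulVec, ← Matrix.mulVec_mulVec, wedge_mulVec,
    Matrix.mulVec_sub, Matrix.mulVec_smul, hX u x, hX v x, neg_smul]
  abel

theorem Isom.conj_wedge {p : ℕ} {G G' : Matrix (Fin (p + 1)) (Fin (p + 1)) ℝ} (hG : Isom G)
    (h : G * G' = 1) (u v : V p) : G * wedge u v * G' = wedge (G *ᵥ u) (G *ᵥ v) := by
  refine ext_mulVec fun x => ?_
  have hx : x = G *ᵥ (G' *ᵥ x) := by rw [Matrix.mulVec_mulVec, h, Matrix.one_mulVec]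
  conv_rhs => rw [hx]
  simp only [← Matrix.mulVec_mulVec, wedge_mulVec, Matrix.mulVec_sub, Matrix.mulVec_smul, hG u,
    hG v]

theorem wedge_add_left {p : ℕ} (u u' v : V p) : wedge (u + u') v = wedge u v + wedge u' v := by
  refine ext_mulVec fun x => ?_
  simp only [wedge_mulVec, Matrix.add_mulVec, map_add, LinearMap.add_apply, add_smul, smul_add]
  abel

theorem wedge_smul_left {p : ℕ} (c : ℝ) (u v : V p) : wedge (c • u) v = c • wedge u v := by
  refine ext_mulVec fun x => ?_
  simp only [wedge_mulVec, Matrix.smul_mulVec, map_smul, LinearMap.smul_apply, smul_sub,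
    smul_eq_mul, mul_smul, smul_comm c]

theorem wedge_smul_right {p : ℕ} (c : ℝ) (u v : V p) : wedge u (c • v) = c • wedge u v := by
  refine ext_mulVec fun x => ?_
  simp only [wedge_mulVec, Matrix.smul_mulVec, map_smul, LinearMap.smul_apply, smul_sub,
    smul_eq_mul, mul_smul, smul_comm c]

theorem wedge_self {p : ℕ} (u : V p) : wedge u u = 0 := sub_self _

/-! ### Elements of `e(p,1)` and of `E(p,1)` -/

/-- The infinitesimal affine map with linear part `X` and translation part `α`. -/
def aff {p : ℕ} (X : Matrix (Fin (p + 1)) (Fin (p + 1)) ℝ) (α : V p) : Mat p :=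
  Matrix.fromBlocks X (Matrix.of fun i _ => α i) 0 0

/-- The affine map with linear part `G` and translation part `a`. -/
def grp {p : ℕ} (G : Matrix (Fin (p + 1)) (Fin (p + 1)) ℝ) (a : V p) : Mat p :=
  Matrix.fromBlocks G (Matrix.of fun i _ => a i) 0 1

variable {p : ℕ} {X X' : Matrix (Fin (p + 1)) (Fin (p + 1)) ℝ} {α α' : V p}

theorem aff_inj : aff X α = aff X' α' ↔ X = X' ∧ α = α' := by
  rw [aff, aff, Matrix.fromBlocks_inj]
  constructor
  · rintro ⟨h, h', -⟩
    exact ⟨h, funext fun i => congrFun (congrFun h' i) ()⟩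
  · rintro ⟨rfl, rfl⟩
    simp

theorem toBlocks_aff : (aff X α).toBlocks₁₁ = X := Matrix.toBlocks_fromBlocks₁₁ _ _ _ _

theorem aff_add : aff X α + aff X' α' = aff (X + X') (α + α') := by
  rw [aff, aff, aff, Matrix.fromBlocks_add]
  congr 1 <;> simp

theorem aff_smul (c : ℝ) : c • aff X α = aff (c • X) (c • α) := by
  rw [aff, aff, Matrix.fromBlocks_smul]
  congr 1 <;> simp

theorem aff_zero : aff (0 : Matrix (Fin (p + 1)) (Fin (p + 1)) ℝ) 0 = 0 := by
  ext (i | i) (j | j) <;> rfl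

theorem aff_sub : aff X α - aff X' α' = aff (X - X') (α - α') := by
  rw [sub_eq_add_neg, ← neg_one_smul ℝ, aff_smul, aff_add, neg_one_smul, neg_one_smul,
    ← sub_eq_add_neg, ← sub_eq_add_neg]

theorem aff_sum {ι : Type*} (s : Finset ι) (f : ι → Matrix (Fin (p + 1)) (Fin (p + 1)) ℝ)
    (g : ι → V p) : ∑ i ∈ s, aff (f i) (g i) = aff (∑ i ∈ s, f i) (∑ i ∈ s, g i) := by
  classical
  induction s using Finset.induction_on with
  | empty => simp [aff_zero]
  | insert a s ha ih => simp [Finset.sum_insert ha, ih, aff_add]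

theorem col_mulVec (X : Matrix (Fin (p + 1)) (Fin (p + 1)) ℝ) (α : V p) :
    X * (Matrix.of fun i (_ : Unit) => α i) = Matrix.of fun i _ => (X *ᵥ α) i := by
  ext i j
  rfl

theorem lie_aff : ⁅aff X α, aff X' α'⁆ = aff (X * X' - X' * X) (X *ᵥ α' - X' *ᵥ α) := by
  rw [Ring.lie_def, aff, aff, aff, Matrix.fromBlocks_multiply, Matrix.fromBlocks_multiply,
    col_mulVec, col_mulVec]
  ext (i | i) (j | j) <;> simp

theorem lie_aff_eq_zero :
    ⁅aff X α, aff X' α'⁆ = 0 ↔ X * X' = X' * X ∧ X *ᵥ α' = X' *ᵥ α := by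
  rw [lie_aff, ← aff_zero, aff_inj, sub_eq_zero, sub_eq_zero]

theorem mem_eAlg_iff {Y : Mat p} : Y ∈ eAlg p ↔ ∃ X α, Skew X ∧ Y = aff X α := by
  constructor
  · rintro ⟨X, α, hX, rfl⟩
    exact ⟨X, fun i => α i (), (skew_iff X).mp hX, rfl⟩
  · rintro ⟨X, α, hX, rfl⟩
    exact ⟨X, _, (skew_iff X).mpr hX, rfl⟩

theorem aff_mem_eAlg : aff X α ∈ eAlg p ↔ Skew X := by
  rw [mem_eAlg_iff]
  constructor
  · rintro ⟨X', α', hX', h⟩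
    rw [aff_inj] at h
    rwa [h.1]
  · exact fun h => ⟨X, α, h, rfl⟩

theorem mem_eGroup_iff {H : Mat p} : H ∈ eGroup p ↔ ∃ G a, Isom G ∧ H = grp G a := by
  constructor
  · rintro ⟨X, α, hX, rfl⟩
    exact ⟨X, fun i => α i (), (isom_iff X).mp hX, rfl⟩
  · rintro ⟨X, α, hX, rfl⟩
    exact ⟨X, _, (isom_iff X).mpr hX, rfl⟩

variable {G G' : Matrix (Fin (p + 1)) (Fin (p + 1)) ℝ} {a : V p}

theorem grp_mul (b : V p) : grp G a * grp G' b = grp (G * G') (G *ᵥ b + a) := by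
  rw [grp, grp, grp, Matrix.fromBlocks_multiply, col_mulVec]
  ext (i | i) (j | j) <;> simp

theorem grp_one : grp (1 : Matrix (Fin (p + 1)) (Fin (p + 1)) ℝ) 0 = 1 := by
  rw [grp, ← Matrix.fromBlocks_one]
  congr 1

theorem grp_inv (h : G * G' = 1) : (grp G a)⁻¹ = grp G' (-(G' *ᵥ a)) := by
  refine Matrix.inv_eq_right_inv ?_
  rw [grp_mul, h, Matrix.mulVec_neg, Matrix.mulVec_mulVec, h, Matrix.one_mulVec,
    neg_add_cancel, grp_one]

theorem grp_conj (h : G * G' = 1) :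
    grp G a * aff X α * (grp G a)⁻¹ = aff (G * X * G') (G *ᵥ α - (G * X * G') *ᵥ a) := by
  rw [grp_inv h, grp, grp, aff, aff, Matrix.fromBlocks_multiply, Matrix.fromBlocks_multiply,
    col_mulVec, col_mulVec]
  ext (i | i) (j | j) <;>
    simp [← Matrix.mulVec_mulVec, Matrix.mulVec_neg, neg_add_eq_sub]

theorem P_eq (p j : ℕ) : P p j = aff 0 (ev p j) := rfl

theorem L_eq {i j : ℕ} (hi : i ≤ p) (hj : j ≤ p) :
    L p i j = aff (wedge (ev p i) (ev p j)) 0 := by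
  rw [L, aff]
  congr 1
  refine ext_mulVec_ev fun c hc => ?_
  rw [wedge_mulVec, mf_ev_ev p _ _ hi, mf_ev_ev p _ _ hj]
  ext r
  obtain ⟨c, rfl⟩ : ∃ c' : Fin (p + 1), (c' : ℕ) = c := ⟨⟨c, by omega⟩, rfl⟩
  have h2 : ev p c = Pi.single c 1 := by
    ext i
    simp [ev, Pi.single_apply, Fin.val_inj]
  rw [h2]
  simp only [Matrix.mulVec_single_one, Matrix.col_apply, Matrix.of_apply, ev, Pi.sub_apply,
    Pi.smul_apply, smul_eq_mul, mul_ite, mul_one, mul_zero, ← ite_and, eq_comm (a := j),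
    eq_comm (a := i)]

end MinkMASA
namespace MinkMASA

/-! ### Coordinate vectors and the generators of the standard subalgebras -/

theorem mf_ev_ne (p : ℕ) {i j : ℕ} (h : i ≠ j) : mf p (ev p i) (ev p j) = 0 := by
  by_cases hi : i ≤ p
  · rw [mf_ev_ev p i j hi, if_neg h]
  · have : ev p i = 0 := by
      ext c
      have : (c : ℕ) ≠ i := by omega
      simp [ev, this]
    simp [this]

theorem mf_ev_self (p : ℕ) {i : ℕ} (h : i ≤ p) (h0 : i ≠ 0) : mf p (ev p i) (ev p i) = 1 := by
  rw [mf_ev_ev p i i h, if_pos rfl, gDiag, if_neg h0]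

theorem mf_ev_zero (p : ℕ) : mf p (ev p 0) (ev p 0) = -1 := by
  rw [mf_ev_ev p 0 0 (Nat.zero_le _), if_pos rfl, gDiag, if_pos rfl]

/-- The null vector `e_0 - e_1`. -/
def nullE (p : ℕ) : V p := ev p 0 - ev p 1

/-- The null vector `e_0 + e_1`. -/
def nullF (p : ℕ) : V p := ev p 0 + ev p 1

theorem mf_ne_ev (p : ℕ) {j : ℕ} (h : 2 ≤ j) : mf p (nullE p) (ev p j) = 0 := by
  simp [nullE, mf_ev_ne p (show 0 ≠ j by omega), mf_ev_ne p (show 1 ≠ j by omega)]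

theorem mf_nf_ev (p : ℕ) {j : ℕ} (h : 2 ≤ j) : mf p (nullF p) (ev p j) = 0 := by
  simp [nullF, mf_ev_ne p (show 0 ≠ j by omega), mf_ev_ne p (show 1 ≠ j by omega)]

theorem mf_ev_ne' (p : ℕ) {j : ℕ} (h : 2 ≤ j) : mf p (ev p j) (nullE p) = 0 := by
  rw [mf_comm, mf_ne_ev p h]

theorem mf_ev_nf (p : ℕ) {j : ℕ} (h : 2 ≤ j) : mf p (ev p j) (nullF p) = 0 := by
  rw [mf_comm, mf_nf_ev p h]

theorem mf_ne_ne {p : ℕ} (hp : 1 ≤ p) : mf p (nullE p) (nullE p) = 0 := by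
  simp [nullE, mf_ev_ne p (show 0 ≠ 1 by omega), mf_ev_ne p (show 1 ≠ 0 by omega), mf_ev_zero,
    mf_ev_self p hp]

theorem mf_ne_nf {p : ℕ} (hp : 1 ≤ p) : mf p (nullE p) (nullF p) = -2 := by
  simp [nullE, nullF, mf_ev_ne p (show 0 ≠ 1 by omega), mf_ev_ne p (show 1 ≠ 0 by omega), mf_ev_zero,
    mf_ev_self p hp]
  norm_num

theorem mf_nf_ne {p : ℕ} (hp : 1 ≤ p) : mf p (nullF p) (nullE p) = -2 := by
  rw [mf_comm, mf_ne_nf hp]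

theorem ev_zero_eq (p : ℕ) : ev p 0 = (1 / 2 : ℝ) • (nullE p + nullF p) := by
  ext i
  simp only [nullE, nullF, Pi.smul_apply, Pi.add_apply, Pi.sub_apply, smul_eq_mul]
  ring

theorem ev_one_eq (p : ℕ) : ev p 1 = (1 / 2 : ℝ) • (nullF p - nullE p) := by
  ext i
  simp only [nullE, nullF, Pi.smul_apply, Pi.add_apply, Pi.sub_apply, smul_eq_mul]
  ring

theorem ne_ne_zero {p : ℕ} (hp : 1 ≤ p) : nullE p ≠ 0 := by
  intro h
  have := mf_ne_nf hp
  simp [h] at this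

theorem index_cases {p k l m : ℕ} (hp : p = k + 2 * l + m) {j : ℕ} (hj : j ≤ p) :
    j ≤ k ∨ (∃ i : Fin l, j = k + 2 * i + 1) ∨ (∃ i : Fin l, j = k + 2 * i + 2) ∨
      ∃ i : Fin m, j = k + 2 * l + i + 1 := by
  by_cases h1 : j ≤ k
  · exact Or.inl h1
  by_cases h2 : j ≤ k + 2 * l
  · rcases Nat.even_or_odd' (j - k - 1) with ⟨c, hc | hc⟩
    · exact Or.inr (Or.inl ⟨⟨c, by omega⟩, by simp only; omega⟩)
    · exact Or.inr (Or.inr (Or.inl ⟨⟨c, by omega⟩, by simp only; omega⟩))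
  · exact Or.inr (Or.inr (Or.inr ⟨⟨j - k - 2 * l - 1, by omega⟩, by simp only; omega⟩))

/-- Generators attached to a null direction, with `d` transverse directions. -/
def nullGens (p d : ℕ) (τ : Fin d → V p) : Set (Mat p) :=
  {aff 0 (nullE p)} ∪ Set.range fun j : Fin d => aff (wedge (nullE p) (ev p (j + 2))) (τ j)

theorem aff_wedge_ne {p j : ℕ} (hp : 1 ≤ p) (hj : j ≤ p) (τ : V p) :
    L p 0 j - L p 1 j + aff 0 τ = aff (wedge (nullE p) (ev p j)) τ := by
  rw [L_eq (Nat.zero_le _) hj, L_eq hp hj, aff_sub, aff_add, sub_zero, zero_add, add_zero, nullE,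
    sub_eq_add_neg (ev p 0), wedge_add_left, ← neg_one_smul ℝ (ev p 1), wedge_smul_left,
    neg_one_smul, sub_eq_add_neg]

theorem time_gens (p : ℕ) : Block.time.gens p = {aff 0 (ev p 0)} := rfl

theorem boost_gens {p : ℕ} (hp : 1 ≤ p) :
    Block.boost.gens p = {aff (wedge (ev p 0) (ev p 1)) 0} := by
  rw [Block.gens, L_eq (Nat.zero_le _) hp]

theorem null_gens {p : ℕ} (hp : 2 ≤ p) (κ : SignType) :
    (Block.null κ).gens p = nullGens p 1 fun _ => (κ : ℝ) • nullF p := by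
  have h1 : P p 0 - P p 1 = aff 0 (nullE p) := by
    rw [P_eq, P_eq, aff_sub, sub_zero, nullE]
  have h2 : L p 0 2 - L p 1 2 + (κ : ℝ) • (P p 0 + P p 1) =
      aff (wedge (nullE p) (ev p 2)) ((κ : ℝ) • nullF p) := by
    rw [P_eq, P_eq, aff_add, aff_smul, add_zero, smul_zero, aff_wedge_ne (by omega) hp, nullF]
  rw [Block.gens, h1, h2, nullGens]
  ext x
  simp [Set.range_unique, or_comm]

theorem multi_gens {p n : ℕ} (hp : n + 3 ≤ p) (a : Fin (n + 2) → ℝ) :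
    (Block.multi n a).gens p = nullGens p (n + 2) fun j => a j • ev p (j + 2) := by
  have h1 : P p 0 - P p 1 = aff 0 (nullE p) := by
    rw [P_eq, P_eq, aff_sub, sub_zero, nullE]
  rw [Block.gens, h1, nullGens]
  congr 2
  ext1 j
  rw [P_eq, aff_smul, smul_zero, aff_wedge_ne (by omega) (by omega)]

/-- The generators of `std p B l m`. -/
def stdGens (p : ℕ) (B : Block) (l m : ℕ) : Set (Mat p) :=
  B.gens p ∪ (Set.range fun i : Fin l => aff (wedge (ev p (B.k + 2 * i + 1))
    (ev p (B.k + 2 * i + 2))) 0) ∪ Set.range fun i : Fin m => aff 0 (ev p (B.k + 2 * l + i + 1))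

theorem std_eq {p l m : ℕ} {B : Block} (hp : p = B.k + 2 * l + m) :
    std p B l m = LieSubalgebra.lieSpan ℝ (Mat p) (stdGens p B l m) := by
  have h : (fun i : Fin l => L p (B.k + 2 * i + 1) (B.k + 2 * i + 2)) = fun i : Fin l =>
      aff (wedge (ev p (B.k + 2 * i + 1)) (ev p (B.k + 2 * i + 2))) 0 :=
    funext fun i => L_eq (by omega) (by omega)
  rw [std, stdGens, h]
  rfl

/-- The subalgebra of matrices commuting with all elements of a set. -/
noncomputable def commutant {p : ℕ} (s : Set (Mat p)) : LieSubalgebra ℝ (Mat p) where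
  carrier := {Y | ∀ Z ∈ s, ⁅Y, Z⁆ = 0}
  add_mem' := fun {a b} ha hb Z hZ => by rw [add_lie, ha Z hZ, hb Z hZ, add_zero]
  zero_mem' := fun Z _ => zero_lie Z
  smul_mem' := fun c Y hY Z hZ => by rw [smul_lie, hY Z hZ, smul_zero]
  lie_mem' := fun {a b} ha hb Z hZ => by rw [lie_lie, hb Z hZ, ha Z hZ, lie_zero, lie_zero,
    sub_zero]

theorem lie_eq_zero_comm {p : ℕ} {Y Z : Mat p} : ⁅Y, Z⁆ = 0 ↔ ⁅Z, Y⁆ = 0 := by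
  rw [← lie_skew, neg_eq_zero]

/-- A commutant is a subalgebra, so commutation passes from the generators to the span one argument
at a time. -/
theorem lieSpan_abelian {p : ℕ} {s : Set (Mat p)} (h : ∀ Y ∈ s, ∀ Z ∈ s, ⁅Y, Z⁆ = 0) :
    ∀ Y ∈ LieSubalgebra.lieSpan ℝ (Mat p) s, ∀ Z ∈ LieSubalgebra.lieSpan ℝ (Mat p) s,
      ⁅Y, Z⁆ = 0 := by
  have h1 : LieSubalgebra.lieSpan ℝ (Mat p) s ≤ commutant s :=
    LieSubalgebra.lieSpan_le.mpr fun Y hY Z hZ => h Y hY Z hZ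
  have h2 : LieSubalgebra.lieSpan ℝ (Mat p) s ≤
      commutant (LieSubalgebra.lieSpan ℝ (Mat p) s : Set (Mat p)) :=
    LieSubalgebra.lieSpan_le.mpr fun Y hY Z hZ => lie_eq_zero_comm.mp (h1 hZ Y hY)
  exact fun Y hY Z hZ => h2 hY Z hZ

theorem forall_stdGens {p l m : ℕ} {B : Block} {Q : Mat p → Prop} :
    (∀ g ∈ stdGens p B l m, Q g) ↔ (∀ g ∈ B.gens p, Q g) ∧
      (∀ i : Fin l, Q (aff (wedge (ev p (B.k + 2 * i + 1)) (ev p (B.k + 2 * i + 2))) 0)) ∧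
      ∀ i : Fin m, Q (aff 0 (ev p (B.k + 2 * l + i + 1))) := by
  simp only [stdGens, Set.mem_union, or_imp, forall_and, Set.forall_mem_range, and_assoc]

theorem forall_nullGens {p d : ℕ} {τ : Fin d → V p} {Q : Mat p → Prop} :
    (∀ g ∈ nullGens p d τ, Q g) ↔ Q (aff 0 (nullE p)) ∧
      ∀ j : Fin d, Q (aff (wedge (nullE p) (ev p (j + 2))) (τ j)) := by
  simp only [nullGens, Set.mem_union, or_imp, forall_and, Set.forall_mem_range,
    Set.mem_singleton_iff, forall_eq]

/-- The block has a null direction and `d` transverse directions. -/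
structure NullType (p : ℕ) (B : Block) (d : ℕ) (τ : Fin d → V p) : Prop where
  k_eq : B.k = d + 1
  pos : 1 ≤ d
  gens_eq : B.gens p = nullGens p d τ
  comm : ∀ i j : Fin d, wedge (nullE p) (ev p (i + 2)) *ᵥ τ j = wedge (nullE p) (ev p (j + 2)) *ᵥ τ i
  orth : ∀ j (i : ℕ), d + 1 < i → mf p (τ j) (ev p i) = 0

theorem nullType_null {p : ℕ} (hp : 2 ≤ p) (κ : SignType) :
    NullType p (Block.null κ) 1 fun _ => (κ : ℝ) • nullF p where
  k_eq := rfl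
  pos := le_rfl
  gens_eq := null_gens hp κ
  comm i j := by rw [Subsingleton.elim i j]
  orth j i hi := by rw [map_smul, LinearMap.smul_apply, mf_nf_ev p (by omega), smul_zero]

theorem nullType_multi {p n : ℕ} (hp : n + 3 ≤ p) (a : Fin (n + 2) → ℝ) :
    NullType p (Block.multi n a) (n + 2) fun j => a j • ev p (j + 2) where
  k_eq := rfl
  pos := by omega
  gens_eq := multi_gens hp a
  comm i j := by
    by_cases h : i = j
    · rw [h]
    · have h' : (i : ℕ) + 2 ≠ j + 2 := by simpa [Fin.val_inj] using h
      simp [wedge_mulVec, mf_ne_ev, mf_ev_ne p h', mf_ev_ne p h'.symm]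
  orth j i hi := by rw [map_smul, LinearMap.smul_apply, mf_ev_ne p (by omega), smul_zero]

/-- Every block is of time type, of boost type, or of null type. -/
theorem Block.cases_type {p : ℕ} (B : Block) (hp : B.k ≤ p) :
    B = .time ∨ B = .boost ∨ ∃ d τ, NullType p B d τ := by
  rcases B with _ | _ | κ | ⟨n, a⟩
  · exact Or.inl rfl
  · exact Or.inr (Or.inl rfl)
  · exact Or.inr (Or.inr ⟨_, _, nullType_null hp κ⟩)
  · exact Or.inr (Or.inr ⟨_, _, nullType_multi hp a⟩)

/-! ### The standard subalgebras are Abelian -/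

theorem wedge_mul_eq_zero {p : ℕ} {u v u' v' : V p} (h1 : mf p u u' = 0) (h2 : mf p u v' = 0)
    (h3 : mf p v u' = 0) (h4 : mf p v v' = 0) : wedge u v * wedge u' v' = 0 := by
  refine ext_mulVec fun x => ?_
  simp [← Matrix.mulVec_mulVec, wedge_mulVec, h1, h2, h3, h4]

theorem wedge_mul_comm {p : ℕ} {u v u' v' : V p} (h1 : mf p u u' = 0) (h2 : mf p u v' = 0)
    (h3 : mf p v u' = 0) (h4 : mf p v v' = 0) :
    wedge u v * wedge u' v' = wedge u' v' * wedge u v := by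
  rw [wedge_mul_eq_zero h1 h2 h3 h4, wedge_mul_eq_zero] <;> rw [mf_comm] <;> assumption

theorem lie_translations {p : ℕ} (u v : V p) :
    ⁅aff (0 : Matrix (Fin (p + 1)) (Fin (p + 1)) ℝ) u, aff 0 v⁆ = 0 := by
  simp [lie_aff_eq_zero]

theorem lie_wedge_translation {p : ℕ} {u v w τ : V p} (h1 : mf p u w = 0) (h2 : mf p v w = 0) :
    ⁅aff (wedge u v) τ, aff 0 w⁆ = 0 := by
  simp [lie_aff_eq_zero, wedge_mulVec, h1, h2]

theorem nullGens_comm {p l m d : ℕ} {B : Block} {τ : Fin d → V p}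
    (hp : p = B.k + 2 * l + m) (h : NullType p B d τ) :
    ∀ g ∈ B.gens p, ∀ g' ∈ stdGens p B l m, ⁅g, g'⁆ = 0 := by
  have hk := h.k_eq
  have hd := h.pos
  rw [h.gens_eq, forall_nullGens]
  constructor
  · rw [forall_stdGens, h.gens_eq, forall_nullGens]
    refine ⟨⟨lie_translations _ _, fun j => ?_⟩, fun i => ?_, fun i => lie_translations _ _⟩
    · rw [lie_eq_zero_comm]
      exact lie_wedge_translation (mf_ne_ne (by omega)) (mf_ev_ne' p (by omega))
    · rw [lie_eq_zero_comm]
      exact lie_wedge_translation (mf_ev_ne' p (by omega)) (mf_ev_ne' p (by omega))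
  · intro j
    rw [forall_stdGens, h.gens_eq, forall_nullGens]
    refine ⟨⟨?_, fun i => ?_⟩, fun i => ?_, fun i => ?_⟩
    · exact lie_wedge_translation (mf_ne_ne (by omega)) (mf_ev_ne' p (by omega))
    · rw [lie_aff_eq_zero]
      refine ⟨?_, h.comm _ _⟩
      by_cases hij : j = i
      · rw [hij]
      · exact wedge_mul_comm (mf_ne_ne (by omega)) (mf_ne_ev p (by omega))
          (mf_ev_ne' p (by omega)) (mf_ev_ne p (by simpa [Fin.val_inj] using hij))
    · rw [lie_aff_eq_zero]
      refine ⟨wedge_mul_comm (mf_ne_ev p (by omega)) (mf_ne_ev p (by omega))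
        (mf_ev_ne p (by omega)) (mf_ev_ne p (by omega)), ?_⟩
      rw [Matrix.mulVec_zero, wedge_mulVec, mf_comm, h.orth _ _ (by omega), mf_comm,
        h.orth _ _ (by omega)]
      simp
    · exact lie_wedge_translation (mf_ne_ev p (by omega)) (mf_ev_ne p (by omega))

theorem blockGens_comm {p l m : ℕ} {B : Block} (hp : p = B.k + 2 * l + m) :
    ∀ g ∈ B.gens p, ∀ g' ∈ stdGens p B l m, ⁅g, g'⁆ = 0 := by
  rcases Block.cases_type (p := p) B (by omega) with rfl | rfl | ⟨d, τ, h⟩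
  · simp only [Block.k] at hp
    rw [time_gens]
    simp only [Set.mem_singleton_iff, forall_eq]
    rw [forall_stdGens, time_gens]
    simp only [Set.mem_singleton_iff, forall_eq, Block.k]
    refine ⟨lie_translations _ _, fun i => ?_, fun i => lie_translations _ _⟩
    rw [lie_eq_zero_comm]
    exact lie_wedge_translation (mf_ev_ne p (by omega)) (mf_ev_ne p (by omega))
  · simp only [Block.k] at hp
    rw [boost_gens (by omega)]
    simp only [Set.mem_singleton_iff, forall_eq]
    rw [forall_stdGens, boost_gens (by omega)]
    simp only [Set.mem_singleton_iff, forall_eq, Block.k]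
    refine ⟨lie_self _, fun i => ?_, fun i => ?_⟩
    · rw [lie_aff_eq_zero]
      exact ⟨wedge_mul_comm (mf_ev_ne p (by omega)) (mf_ev_ne p (by omega))
        (mf_ev_ne p (by omega)) (mf_ev_ne p (by omega)), by simp⟩
    · exact lie_wedge_translation (mf_ev_ne p (by omega)) (mf_ev_ne p (by omega))
  · exact nullGens_comm hp h

theorem stdGens_comm {p l m : ℕ} {B : Block} (hp : p = B.k + 2 * l + m) :
    ∀ g ∈ stdGens p B l m, ∀ g' ∈ stdGens p B l m, ⁅g, g'⁆ = 0 := by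
  have hB := blockGens_comm hp
  rw [forall_stdGens]
  refine ⟨hB, fun i => ?_, fun i => ?_⟩
  · rw [forall_stdGens]
    refine ⟨fun g hg => ?_, fun j => ?_, fun j => ?_⟩
    · rw [lie_eq_zero_comm]
      exact (forall_stdGens.mp (hB g hg)).2.1 i
    · by_cases hij : i = j
      · rw [hij, lie_self]
      · have : (i : ℕ) ≠ j := by simpa [Fin.val_inj] using hij
        rw [lie_aff_eq_zero]
        exact ⟨wedge_mul_comm (mf_ev_ne p (by omega)) (mf_ev_ne p (by omega))
          (mf_ev_ne p (by omega)) (mf_ev_ne p (by omega)), by simp⟩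
    · exact lie_wedge_translation (mf_ev_ne p (by omega)) (mf_ev_ne p (by omega))
  · rw [forall_stdGens]
    refine ⟨fun g hg => ?_, fun j => ?_, fun j => lie_translations _ _⟩
    · rw [lie_eq_zero_comm]
      exact (forall_stdGens.mp (hB g hg)).2.2 i
    · rw [lie_eq_zero_comm]
      exact lie_wedge_translation (mf_ev_ne p (by omega)) (mf_ev_ne p (by omega))

theorem std_abelian {p l m : ℕ} {B : Block} (hp : p = B.k + 2 * l + m) :
    ∀ Y ∈ std p B l m, ∀ Z ∈ std p B l m, ⁅Y, Z⁆ = 0 := by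
  rw [std_eq hp]
  exact lieSpan_abelian (stdGens_comm hp)

theorem mem_std_of_gens {p l m : ℕ} {B : Block} (hp : p = B.k + 2 * l + m) {g : Mat p}
    (hg : g ∈ stdGens p B l m) : g ∈ std p B l m := by
  rw [std_eq hp]
  exact LieSubalgebra.subset_lieSpan hg

theorem std_le {p l m : ℕ} {B : Block} (hp : p = B.k + 2 * l + m)
    {S : LieSubalgebra ℝ (Mat p)} (h : ∀ g ∈ stdGens p B l m, g ∈ S) : std p B l m ≤ S := by
  rw [std_eq hp]
  exact LieSubalgebra.lieSpan_le.mpr h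

theorem std_le_eAlg {p l m : ℕ} {B : Block} (hp : p = B.k + 2 * l + m) :
    std p B l m ≤ eAlg p := by
  have h0 : Skew (0 : Matrix (Fin (p + 1)) (Fin (p + 1)) ℝ) := fun u v => by simp
  refine std_le hp (forall_stdGens.mpr ⟨?_, fun i => aff_mem_eAlg.mpr (skew_wedge _ _),
    fun i => aff_mem_eAlg.mpr h0⟩)
  rcases Block.cases_type (p := p) B (by omega) with rfl | rfl | ⟨d, τ, h⟩
  · simp only [time_gens, Set.mem_singleton_iff, forall_eq]
    exact aff_mem_eAlg.mpr h0
  · simp only [Block.k] at hp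
    simp only [boost_gens (show 1 ≤ p by omega), Set.mem_singleton_iff, forall_eq]
    exact aff_mem_eAlg.mpr (skew_wedge _ _)
  · rw [h.gens_eq, forall_nullGens]
    exact ⟨aff_mem_eAlg.mpr h0, fun j => aff_mem_eAlg.mpr (skew_wedge _ _)⟩

end MinkMASA
namespace MinkMASA

/-! ### The standard subalgebras are maximal Abelian -/

section Centralizer

variable {p k l m : ℕ} {X XB : Matrix (Fin (p + 1)) (Fin (p + 1)) ℝ} {α αB : V p}

theorem Skew.mf_self (hX : Skew X) (u : V p) : mf p (X *ᵥ u) u = 0 := by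
  have h := hX u u
  rw [mf_comm p u] at h
  linarith

/-- The derivation rule gives Xu ∧ w + u ∧ Xw = 0; evaluating at w and at u isolates Xu and Xw. -/
theorem Skew.plane_of_comm (hX : Skew X) {u w : V p} (h : X * wedge u w = wedge u w * X)
    (huu : mf p u u = 1) (hww : mf p w w = 1) (huw : mf p u w = 0) :
    X *ᵥ u = mf p (X *ᵥ u) w • w ∧ X *ᵥ w = -mf p (X *ᵥ u) w • u := by
  have h0 := hX.comm_wedge u w
  rw [h, sub_self] at h0
  have hwu : mf p w u = 0 := by rw [mf_comm, huw]
  have h1 := congrArg (fun Z => Z *ᵥ w) h0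
  have h2 := congrArg (fun Z => Z *ᵥ u) h0
  simp only [Matrix.zero_mulVec, Matrix.add_mulVec, wedge_mulVec, huu, hww, huw, hwu, one_smul,
    zero_smul, hX.mf_self, sub_zero, add_zero] at h1 h2
  constructor
  · exact sub_eq_zero.mp h1.symm
  · have h3 := hX w u
    rw [mf_comm p w] at h3
    rw [h3, zero_add] at h2
    exact (sub_eq_zero.mp h2.symm).symm

/-- The linear part `X` rotates the planes and annihilates the lines of the orthogonal
decomposition `M(p,1) = M(k,1) ⊕ l M(2,0) ⊕ m M(1,0)`. -/
structure Splits (k l m : ℕ) (X : Matrix (Fin (p + 1)) (Fin (p + 1)) ℝ) : Prop where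
  planes : ∀ i : Fin l, ∃ θ : ℝ, X *ᵥ ev p (k + 2 * i + 1) = θ • ev p (k + 2 * i + 2) ∧
    X *ᵥ ev p (k + 2 * i + 2) = -θ • ev p (k + 2 * i + 1)
  lines : ∀ i : Fin m, X *ᵥ ev p (k + 2 * l + i + 1) = 0

theorem splits_of_comm {B : Block} (hp : p = B.k + 2 * l + m) (hX : Skew X)
    (h : ∀ g ∈ stdGens p B l m, ⁅aff X α, g⁆ = 0) : Splits B.k l m X := by
  rw [forall_stdGens] at h
  refine ⟨fun i => ?_, fun i => ?_⟩
  · exact ⟨_, hX.plane_of_comm (lie_aff_eq_zero.mp (h.2.1 i)).1 (mf_ev_self p (by omega) (by omega))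
      (mf_ev_self p (by omega) (by omega)) (mf_ev_ne p (by omega))⟩
  · simpa using (lie_aff_eq_zero.mp (h.2.2 i)).2

theorem translation_of_comm {B : Block} (hp : p = B.k + 2 * l + m)
    (h : ∀ g ∈ stdGens p B l m, ⁅aff X α, g⁆ = 0) (i : Fin l) :
    mf p α (ev p (B.k + 2 * i + 1)) = 0 ∧ mf p α (ev p (B.k + 2 * i + 2)) = 0 := by
  have h1 := (lie_aff_eq_zero.mp ((forall_stdGens.mp h).2.1 i)).2
  rw [Matrix.mulVec_zero, wedge_mulVec] at h1
  have hu := congrArg (fun v => mf p v (ev p (B.k + 2 * i + 1))) h1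
  have hw := congrArg (fun v => mf p v (ev p (B.k + 2 * i + 2))) h1
  simp only [map_zero, LinearMap.zero_apply, map_sub, map_smul, LinearMap.sub_apply,
    LinearMap.smul_apply, smul_eq_mul,
    mf_ev_self p (show B.k + 2 * (i : ℕ) + 1 ≤ p by omega) (by omega),
    mf_ev_self p (show B.k + 2 * (i : ℕ) + 2 ≤ p by omega) (by omega),
    mf_ev_ne p (show B.k + 2 * (i : ℕ) + 1 ≠ B.k + 2 * (i : ℕ) + 2 by omega),
    mf_ev_ne p (show B.k + 2 * (i : ℕ) + 2 ≠ B.k + 2 * (i : ℕ) + 1 by omega)] at hu hw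
  rw [mf_comm p α, mf_comm p α]
  constructor <;> linarith

theorem Splits.mf_eq_zero (hp : p = k + 2 * l + m) (h : Splits k l m X) (hX : Skew X) {i j : ℕ}
    (hi : i ≤ k) (hj : k < j) (hjp : j ≤ p) : mf p (X *ᵥ ev p i) (ev p j) = 0 := by
  rw [hX]
  rcases index_cases hp hjp with h1 | ⟨c, rfl⟩ | ⟨c, rfl⟩ | ⟨c, rfl⟩
  · omega
  · obtain ⟨θ, h1, -⟩ := h.planes c
    rw [h1, map_smul, mf_ev_ne p (by omega), smul_zero, neg_zero]
  · obtain ⟨θ, -, h1⟩ := h.planes c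
    rw [h1, map_smul, mf_ev_ne p (by omega), smul_zero, neg_zero]
  · rw [h.lines, map_zero, neg_zero]

/-- Membership in a subalgebra containing the rotations and translations of the complement of
`M(k,1)` can be decided on `M(k,1)`. -/
theorem mem_of_mem_block (hp : p = k + 2 * l + m) {S : LieSubalgebra ℝ (Mat p)}
    (hplane : ∀ i : Fin l, aff (wedge (ev p (k + 2 * i + 1)) (ev p (k + 2 * i + 2))) 0 ∈ S)
    (hline : ∀ i : Fin m, aff 0 (ev p (k + 2 * l + i + 1)) ∈ S) (hB : aff XB αB ∈ S)
    (hX : Splits k l m X)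
    (hα : ∀ i : Fin l, mf p α (ev p (k + 2 * i + 1)) = 0 ∧ mf p α (ev p (k + 2 * i + 2)) = 0)
    (hXB : ∀ j, k < j → XB *ᵥ ev p j = 0) (hXX : ∀ j ≤ k, X *ᵥ ev p j = XB *ᵥ ev p j)
    (hαB : ∀ j, k < j → mf p αB (ev p j) = 0)
    (hαα : ∀ j ≤ k, mf p α (ev p j) = mf p αB (ev p j)) : aff X α ∈ S := by
  choose θ hθ using hX.planes
  have hY : aff XB αB + ∑ i : Fin l, θ i • aff (wedge (ev p (k + 2 * i + 2))
      (ev p (k + 2 * i + 1))) 0 + ∑ i : Fin m, mf p α (ev p (k + 2 * l + i + 1)) •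
        aff 0 (ev p (k + 2 * l + i + 1)) ∈ S := by
    refine add_mem (add_mem hB (sum_mem fun i _ => SMulMemClass.smul_mem _ ?_))
      (sum_mem fun i _ => SMulMemClass.smul_mem _ (hline i))
    -- The reversed wedge sends the first vector of the plane to the second, which is the sign
    -- convention for θ in `Splits`.
    have := neg_mem (hplane i)
    rw [← neg_one_smul ℝ, aff_smul, smul_zero] at this
    convert this using 2
    rw [neg_one_smul, wedge, wedge, neg_sub]
  convert hY using 1
  simp only [aff_smul, aff_sum, aff_add, aff_inj, smul_zero, Finset.sum_const_zero, add_zero]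
  constructor
  · refine ext_mulVec_ev fun j hj => ?_
    rw [Matrix.add_mulVec, Matrix.sum_mulVec]
    simp only [Matrix.smul_mulVec, wedge_mulVec]
    rcases index_cases hp hj with h1 | ⟨c, rfl⟩ | ⟨c, rfl⟩ | ⟨c, rfl⟩
    · rw [hXX j h1, Finset.sum_eq_zero, add_zero]
      intro i _
      rw [mf_ev_ne p (by omega), mf_ev_ne p (by omega)]
      simp
    · rw [hXB _ (by omega), (hθ c).1, Finset.sum_eq_single c]
      · rw [mf_ev_self p (by omega) (by omega), mf_ev_ne p (by omega)]
        simp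
      · intro i _ hi
        have : (i : ℕ) ≠ c := by simpa [Fin.val_inj] using hi
        rw [mf_ev_ne p (by omega), mf_ev_ne p (by omega)]
        simp
      · simp
    · rw [hXB _ (by omega), (hθ c).2, Finset.sum_eq_single c]
      · rw [mf_ev_self p (by omega) (by omega), mf_ev_ne p (by omega)]
        simp
      · intro i _ hi
        have : (i : ℕ) ≠ c := by simpa [Fin.val_inj] using hi
        rw [mf_ev_ne p (by omega), mf_ev_ne p (by omega)]
        simp
      · simp
    · rw [hXB _ (by omega), hX.lines, Finset.sum_eq_zero, add_zero]
      intro i _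
      rw [mf_ev_ne p (by omega), mf_ev_ne p (by omega)]
      simp
  · refine eq_of_mf p fun j hj => ?_
    simp only [map_add, map_sum, map_smul, LinearMap.add_apply, LinearMap.sum_apply,
      LinearMap.smul_apply, smul_eq_mul]
    have hz : j ≤ k + 2 * l → ∑ i : Fin m, mf p α (ev p (k + 2 * l + i + 1)) *
        mf p (ev p (k + 2 * l + i + 1)) (ev p j) = 0 := fun hj' =>
      Finset.sum_eq_zero fun i _ => by rw [mf_ev_ne p (by omega), mul_zero]
    rcases index_cases hp hj with h1 | ⟨c, rfl⟩ | ⟨c, rfl⟩ | ⟨c, rfl⟩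
    · rw [hαα j h1, hz (by omega), add_zero]
    · rw [hαB _ (by omega), (hα c).1, hz (by omega), add_zero]
    · rw [hαB _ (by omega), (hα c).2, hz (by omega), add_zero]
    · rw [hαB _ (by omega), Finset.sum_eq_single c]
      · rw [mf_ev_self p (by omega) (by omega)]
        simp
      · intro i _ hi
        have : (i : ℕ) ≠ c := by simpa [Fin.val_inj] using hi
        rw [mf_ev_ne p (by omega), mul_zero]
      · simp

theorem time_comm (h : ⁅aff X α, aff 0 (ev p 0)⁆ = 0) : X *ᵥ ev p 0 = 0 := by
  simpa using (lie_aff_eq_zero.mp h).2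

theorem boost_comm (hp : 1 ≤ p) (hX : Skew X)
    (h : ⁅aff X α, aff (wedge (ev p 0) (ev p 1)) 0⁆ = 0) :
    (∃ c : ℝ, X *ᵥ ev p 0 = c • ev p 1 ∧ X *ᵥ ev p 1 = c • ev p 0) ∧ mf p α (ev p 0) = 0 ∧
      mf p α (ev p 1) = 0 := by
  obtain ⟨h1, h2⟩ := lie_aff_eq_zero.mp h
  have h0 := hX.comm_wedge (ev p 0) (ev p 1)
  rw [h1, sub_self] at h0
  have h3 := congrArg (fun Z => Z *ᵥ ev p 1) h0
  have h4 := congrArg (fun Z => Z *ᵥ ev p 0) h0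
  have e01 := mf_ev_ne p (show 0 ≠ 1 by omega)
  have e10 := mf_ev_ne p (show 1 ≠ 0 by omega)
  have e11 := mf_ev_self p hp one_ne_zero
  have e00 := mf_ev_zero p
  simp only [Matrix.zero_mulVec, Matrix.add_mulVec, wedge_mulVec, e01, e00, e11, e10, one_smul,
    zero_smul, hX.mf_self, sub_zero, add_zero] at h3 h4
  have h5 := hX (ev p 1) (ev p 0)
  rw [mf_comm p (ev p 1)] at h5
  refine ⟨⟨mf p (X *ᵥ ev p 0) (ev p 1), sub_eq_zero.mp h3.symm, ?_⟩, ?_⟩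
  · rw [h5] at h4
    simp only [neg_smul, one_smul, sub_neg_eq_add] at h4
    exact eq_of_sub_eq_zero (by rw [h4]; abel)
  · rw [Matrix.mulVec_zero, wedge_mulVec] at h2
    have hu := congrArg (fun v => mf p v (ev p 0)) h2
    have hw := congrArg (fun v => mf p v (ev p 1)) h2
    simp only [map_zero, LinearMap.zero_apply, map_sub, map_smul, LinearMap.sub_apply,
      LinearMap.smul_apply, smul_eq_mul, e01, e10, e11, e00] at hu hw
    rw [mf_comm p α, mf_comm p α]
    constructor <;> linarith

/-- Since Xe = 0, commuting with e ∧ e_j leaves e ∧ Xe_j = 0, so Xe_j is parallel to e. Evaluation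
at f, with ⟨e, f⟩ = -2, gives the factor -1/2. The last relation is the cocycle condition against
the generators. -/
theorem null_comm {d : ℕ} {τ : Fin d → V p} (hp : d + 1 ≤ p) (hd : 1 ≤ d) (hX : Skew X)
    (h : ∀ g ∈ nullGens p d τ, ⁅aff X α, g⁆ = 0) : X *ᵥ nullE p = 0 ∧
      ∃ c : Fin d → ℝ, (∀ j : Fin d, X *ᵥ ev p (j + 2) = c j • nullE p) ∧
        ∀ j : Fin d, X *ᵥ τ j = mf p α (ev p (j + 2)) • nullE p - mf p α (nullE p) • ev p (j + 2) := by
  rw [forall_nullGens] at h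
  have he : X *ᵥ nullE p = 0 := by simpa using (lie_aff_eq_zero.mp h.1).2
  refine ⟨he, fun j => -(1 / 2) * mf p (X *ᵥ ev p (j + 2)) (nullF p), fun j => ?_, fun j => ?_⟩
  · have h0 := hX.comm_wedge (nullE p) (ev p (j + 2))
    rw [(lie_aff_eq_zero.mp (h.2 j)).1, sub_self, he] at h0
    have h3 := congrArg (fun Z => Z *ᵥ nullF p) h0
    simp only [Matrix.zero_mulVec, Matrix.add_mulVec, wedge_mulVec, map_zero,
      LinearMap.zero_apply, mf_ne_nf (show 1 ≤ p by omega), smul_zero, zero_smul, sub_zero,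
      zero_add] at h3
    have h4 : (2 : ℝ) • X *ᵥ ev p (j + 2) =
        -mf p (X *ᵥ ev p (j + 2)) (nullF p) • nullE p := by
      rw [neg_smul, eq_neg_iff_add_eq_zero, h3]
      simp only [neg_smul, sub_neg_eq_add, add_comm]
    rw [← inv_smul_smul₀ (two_ne_zero (α := ℝ)) (X *ᵥ ev p (j + 2)), h4, smul_smul]
    congr 1
    ring
  · rw [(lie_aff_eq_zero.mp (h.2 j)).2, wedge_mulVec, mf_comm, mf_comm p (nullE p)]

/-- By skewness ⟨Xf, e_j⟩ = -⟨f, c_j e⟩ = 2c_j, and all other components of Xf vanish. -/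
theorem Splits.null_mulVec {d : ℕ} {c : Fin d → ℝ} (hp : p = d + 1 + 2 * l + m)
    (hd : 1 ≤ d) (hS : Splits (d + 1) l m X) (hX : Skew X) (he : X *ᵥ nullE p = 0)
    (hc : ∀ j : Fin d, X *ᵥ ev p (j + 2) = c j • nullE p) :
    X *ᵥ nullF p = ∑ j : Fin d, (2 * c j) • ev p (j + 2) := by
  have hp1 : 1 ≤ p := by omega
  have h1 : X *ᵥ ev p 0 = X *ᵥ ev p 1 := by
    rw [nullE, Matrix.mulVec_sub] at he
    exact sub_eq_zero.mp he
  have hz : mf p (X *ᵥ nullF p) (nullE p) = 0 := by rw [hX, he, map_zero, neg_zero]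
  have hz' := hX.mf_self (nullF p)
  refine eq_of_mf p fun j hj => ?_
  rw [map_sum, LinearMap.sum_apply]
  simp only [map_smul, LinearMap.smul_apply, smul_eq_mul]
  by_cases hj2 : 2 ≤ j ∧ j ≤ d + 1
  · obtain ⟨c', rfl⟩ : ∃ c' : Fin d, j = c' + 2 := ⟨⟨j - 2, by omega⟩, by simp only; omega⟩
    rw [hX, hc, map_smul, mf_nf_ne hp1, Finset.sum_eq_single c']
    · rw [mf_ev_self p (by omega) (by omega), smul_eq_mul]
      ring
    · intro i _ hi
      have : (i : ℕ) ≠ c' := by simpa [Fin.val_inj] using hi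
      rw [mf_ev_ne p (by omega), mul_zero]
    · simp
  · rw [Finset.sum_eq_zero fun i _ => by rw [mf_ev_ne p (by omega), mul_zero]]
    by_cases hjk : j ≤ d + 1
    · obtain rfl | rfl : j = 0 ∨ j = 1 := by omega
      · rw [ev_zero_eq, map_smul, map_add, hz, hz']
        simp
      · rw [ev_one_eq, map_smul, map_sub, hz, hz']
        simp
    · rw [nullF, Matrix.mulVec_add, map_add, LinearMap.add_apply,
        hS.mf_eq_zero hp hX (by omega) (by omega) hj, hS.mf_eq_zero hp hX (by omega) (by omega) hj,
        add_zero]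

/-- The part of the centralizer computation common to both null types. The linear part is forced to
be ∑ c_j e ∧ e_j on the block, and `hτ` isolates what depends on the block: the e- and transverse
pairings of α agree with those of ∑ c_j τ_j. The pairing with f is free and is matched by
translating along e. -/
theorem null_block_mem {d : ℕ} {B : Block} {τ : Fin d → V p} (hp : p = B.k + 2 * l + m)
    (hB : NullType p B d τ) (hX : Skew X) (h : ∀ g ∈ stdGens p B l m, ⁅aff X α, g⁆ = 0)
    (hτ : ∀ c : Fin d → ℝ, (∀ j : Fin d, X *ᵥ ev p (j + 2) = c j • nullE p) →
      X *ᵥ nullF p = ∑ j, (2 * c j) • ev p (j + 2) →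
      mf p α (nullE p) = ∑ i, c i * mf p (τ i) (nullE p) ∧
        ∀ j : Fin d, mf p α (ev p (j + 2)) = ∑ i, c i * mf p (τ i) (ev p (j + 2))) :
    aff X α ∈ std p B l m := by
  have hk := hB.k_eq
  have hd := hB.pos
  have hp1 : 1 ≤ p := by omega
  have hS := splits_of_comm hp hX h
  have hg := forall_stdGens.mp h
  rw [hB.gens_eq] at hg
  obtain ⟨he, c, hc, -⟩ := null_comm (by omega) hd hX hg.1
  have hS' := hS
  rw [hk] at hS'
  have hf := hS'.null_mulVec (by omega) hd hX he hc
  obtain ⟨hαe, hαj⟩ := hτ c hc hf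
  have hmem := forall_stdGens.mp (fun g hg => mem_std_of_gens hp (g := g) hg)
  rw [hB.gens_eq, forall_nullGens] at hmem
  -- The coefficient of the translation along e, determined by the pairing with f through ⟨e, f⟩ =
  -- -2.
  set x : ℝ := -(1 / 2) * (mf p α (nullF p) - ∑ i, c i * mf p (τ i) (nullF p)) with hx
  have hBm : aff (∑ j, c j • wedge (nullE p) (ev p (j + 2))) (x • nullE p + ∑ j, c j • τ j) ∈
      std p B l m := by
    have := add_mem (SMulMemClass.smul_mem x hmem.1.1)
      (sum_mem fun j (_ : j ∈ Finset.univ) => SMulMemClass.smul_mem (c j) (hmem.1.2 j))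
    simpa only [aff_smul, aff_sum, aff_add, smul_zero, zero_add] using this
  have hsum : ∀ v, (∑ j, c j • wedge (nullE p) (ev p (j + 2))) *ᵥ v =
      ∑ j, c j • (mf p (ev p (j + 2)) v • nullE p - mf p (nullE p) v • ev p (j + 2)) := by
    intro v
    rw [Matrix.sum_mulVec]
    simp only [Matrix.smul_mulVec, wedge_mulVec]
  have hXe : X *ᵥ nullE p = (∑ j, c j • wedge (nullE p) (ev p (j + 2))) *ᵥ nullE p := by
    rw [he, hsum, Finset.sum_eq_zero]
    intro j _
    rw [mf_ne_ne hp1, mf_ev_ne' p (by omega)]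
    simp
  have hXf : X *ᵥ nullF p = (∑ j, c j • wedge (nullE p) (ev p (j + 2))) *ᵥ nullF p := by
    rw [hf, hsum]
    refine Finset.sum_congr rfl fun j _ => ?_
    rw [mf_ne_nf hp1, mf_ev_nf p (by omega), zero_smul, zero_sub, ← neg_smul, smul_smul]
    congr 1
    ring
  have hαe' : mf p α (nullE p) = mf p (x • nullE p + ∑ j, c j • τ j) (nullE p) := by
    simp [hαe, mf_ne_ne hp1]
  have hαf' : mf p α (nullF p) = mf p (x • nullE p + ∑ j, c j • τ j) (nullF p) := by
    simp only [map_add, map_smul, LinearMap.add_apply, LinearMap.smul_apply, mf_ne_nf hp1,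
      map_sum, LinearMap.sum_apply, smul_eq_mul, hx]
    ring
  refine mem_of_mem_block hp hmem.2.1 hmem.2.2 hBm hS (translation_of_comm hp h) ?_ ?_ ?_ ?_
  · intro j hj
    rw [hsum, Finset.sum_eq_zero]
    intro i _
    rw [mf_ne_ev p (by omega), mf_ev_ne p (by omega)]
    simp
  · intro j hj
    by_cases hj2 : 2 ≤ j
    · obtain ⟨c', rfl⟩ : ∃ c' : Fin d, j = c' + 2 := ⟨⟨j - 2, by omega⟩, by simp only; omega⟩
      rw [hc, hsum, Finset.sum_eq_single c']
      · rw [mf_ev_self p (by omega) (by omega), mf_ne_ev p (by omega)]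
        simp
      · intro i _ hi
        have : (i : ℕ) ≠ c' := by simpa [Fin.val_inj] using hi
        rw [mf_ev_ne p (by omega), mf_ne_ev p (by omega)]
        simp
      · simp
    · obtain rfl | rfl : j = 0 ∨ j = 1 := by omega
      · rw [ev_zero_eq, Matrix.mulVec_smul, Matrix.mulVec_smul, Matrix.mulVec_add,
          Matrix.mulVec_add, hXe, hXf]
      · rw [ev_one_eq, Matrix.mulVec_smul, Matrix.mulVec_smul, Matrix.mulVec_sub,
          Matrix.mulVec_sub, hXe, hXf]
  · intro j hj
    rw [map_add, LinearMap.add_apply, map_smul, LinearMap.smul_apply, mf_ne_ev p (by omega),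
      map_sum, LinearMap.sum_apply, Finset.sum_eq_zero]
    · simp
    · intro i _
      rw [map_smul, LinearMap.smul_apply, hB.orth _ _ (by omega), smul_zero]
  · intro j hj
    by_cases hj2 : 2 ≤ j
    · obtain ⟨c', rfl⟩ : ∃ c' : Fin d, j = c' + 2 := ⟨⟨j - 2, by omega⟩, by simp only; omega⟩
      rw [hαj]
      simp [mf_ne_ev]
    · obtain rfl | rfl : j = 0 ∨ j = 1 := by omega
      · rw [ev_zero_eq, map_smul, map_smul, map_add, map_add, hαe', hαf']
      · rw [ev_one_eq, map_smul, map_smul, map_sub, map_sub, hαe', hαf']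

end Centralizer

/-- The standard algebras contain their centralizers in e(p,1). Commutation with the generators
determines the linear part on each summand, and the cocycle condition then determines the
translation part up to translations already present. For null types the two relations needed come
from pairing the cocycle condition with a transverse vector and with f. -/
theorem mem_std_of_comm {p l m : ℕ} {B : Block} (hp : p = B.k + 2 * l + m) {Y : Mat p}
    (hY : Y ∈ eAlg p) (h : ∀ g ∈ stdGens p B l m, ⁅Y, g⁆ = 0) : Y ∈ std p B l m := by
  obtain ⟨X, α, hX, rfl⟩ := mem_eAlg_iff.mp hY
  have hS := splits_of_comm hp hX h
  have hα := translation_of_comm hp h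
  have hmem := forall_stdGens.mp (fun g hg => mem_std_of_gens hp (g := g) hg)
  have hg := forall_stdGens.mp h
  rcases B with _ | _ | κ | ⟨n, a⟩
  · simp only [time_gens, Set.mem_singleton_iff, forall_eq] at hmem hg
    have h0 := time_comm hg.1
    simp only [Block.k] at *
    have hcm := SMulMemClass.smul_mem (-mf p α (ev p 0)) hmem.1
    rw [aff_smul] at hcm
    refine mem_of_mem_block hp hmem.2.1 hmem.2.2 hcm hS hα ?_ ?_ ?_ ?_
    · simp
    · intro j hj
      obtain rfl : j = 0 := by omega
      simp [h0]
    · intro j hj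
      simp [mf_ev_ne p hj.ne]
    · intro j hj
      obtain rfl : j = 0 := by omega
      simp [mf_ev_zero]
  · simp only [Block.k] at hp
    simp only [boost_gens (show 1 ≤ p by omega), Set.mem_singleton_iff, forall_eq] at hmem hg
    obtain ⟨⟨c, hc0, hc1⟩, hα0, hα1⟩ := boost_comm (by omega) hX hg.1
    have hcm := SMulMemClass.smul_mem c hmem.1
    rw [aff_smul] at hcm
    simp only [Block.k] at *
    refine mem_of_mem_block hp hmem.2.1 hmem.2.2 hcm hS hα ?_ ?_ ?_ ?_
    · intro j hj
      simp [Matrix.smul_mulVec, wedge_mulVec, mf_ev_ne p (show 0 ≠ j by omega),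
        mf_ev_ne p (show 1 ≠ j by omega)]
    · intro j hj
      obtain rfl | rfl : j = 0 ∨ j = 1 := by omega
      · simp [hc0, Matrix.smul_mulVec, wedge_mulVec, mf_ev_zero, mf_ev_ne p one_ne_zero]
      · simp [hc1, Matrix.smul_mulVec, wedge_mulVec, mf_ev_self p (show 1 ≤ p by omega),
          mf_ev_ne p zero_ne_one]
    · simp
    · intro j hj
      obtain rfl | rfl : j = 0 ∨ j = 1 := by omega
      · simp [hα0]
      · simp [hα1]
  · have hp2 : 2 ≤ p := by simp only [Block.k] at hp; omega
    rw [null_gens hp2] at hg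
    obtain ⟨he, -, -, hτ⟩ := null_comm (by omega) le_rfl hX hg.1
    refine null_block_mem hp (nullType_null hp2 κ) hX h fun c hc hf => ?_
    have h1 := hτ 0
    rw [Matrix.mulVec_smul, hf] at h1
    simp only [Fin.sum_univ_one, Fin.val_zero, zero_add, smul_smul, Fin.isValue] at h1
    have h2 := congrArg (fun v => mf p v (ev p 2)) h1
    have h3 := congrArg (fun v => mf p v (nullF p)) h1
    simp only [map_sub, map_smul, LinearMap.sub_apply, LinearMap.smul_apply, smul_eq_mul,
      mf_ev_self p hp2, mf_ne_ev p le_rfl, mf_ne_nf (show 1 ≤ p by omega), mf_ev_nf p le_rfl,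
      ne_eq, OfNat.ofNat_ne_zero, not_false_eq_true] at h2 h3
    constructor
    · simp only [Fin.sum_univ_one, map_smul, LinearMap.smul_apply, smul_eq_mul, Fin.isValue,
        mf_nf_ne (show 1 ≤ p by omega)]
      linarith
    · intro j
      obtain rfl : j = 0 := Subsingleton.elim _ _
      simp only [Fin.sum_univ_one, map_smul, LinearMap.smul_apply, smul_eq_mul, Fin.isValue,
        Fin.val_zero, zero_add, mf_nf_ev p le_rfl]
      linarith
  · have hp2 : n + 3 ≤ p := by simp only [Block.k] at hp; omega
    rw [multi_gens hp2] at hg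
    obtain ⟨he, -, -, hτ⟩ := null_comm (by omega) (by omega) hX hg.1
    refine null_block_mem hp (nullType_multi hp2 a) hX h fun c hc hf => ?_
    simp only [Matrix.mulVec_smul, hc, smul_smul] at hτ
    have h2 := fun j : Fin (n + 2) => congrArg (fun v => mf p v (ev p (j + 2))) (hτ j)
    have h3 := fun j : Fin (n + 2) => congrArg (fun v => mf p v (nullF p)) (hτ j)
    simp only [map_sub, map_smul, LinearMap.sub_apply, LinearMap.smul_apply, smul_eq_mul,
      mf_ne_nf (show 1 ≤ p by omega)] at h2 h3
    constructor
    · have := h2 0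
      rw [mf_ne_ev p (by omega), mf_ev_self p (by omega) (by omega)] at this
      rw [Finset.sum_eq_zero]
      · linarith
      · intro i _
        rw [map_smul, LinearMap.smul_apply, mf_ev_ne' p (by omega), smul_zero, mul_zero]
    · intro j
      have := h3 j
      rw [mf_ev_nf p (by omega)] at this
      rw [Finset.sum_eq_single j]
      · rw [map_smul, LinearMap.smul_apply, mf_ev_self p (by omega) (by omega), smul_eq_mul]
        linarith
      · intro i _ hi
        have : (i : ℕ) ≠ j := by simpa [Fin.val_inj] using hi
        rw [map_smul, LinearMap.smul_apply, mf_ev_ne p (by omega), smul_zero, mul_zero]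
      · simp

theorem isMASA_std {p l m : ℕ} {B : Block} (hp : p = B.k + 2 * l + m) :
    IsMASA p (std p B l m) :=
  ⟨std_le_eAlg hp, std_abelian hp, fun _ hY h =>
    mem_std_of_comm hp hY fun g hg => h g (mem_std_of_gens hp hg)⟩

end MinkMASA
namespace MinkMASA

/-! ### Conjugation -/

section Conjugation

variable {p : ℕ} {G G' X : Matrix (Fin (p + 1)) (Fin (p + 1)) ℝ} {a : V p}

theorem Isom.skew_conj (hG : Isom G) (h : G * G' = 1) (hX : Skew X) : Skew (G * X * G') := by
  intro u v
  have hu : ∀ u, u = G *ᵥ (G' *ᵥ u) := fun u => by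
    rw [Matrix.mulVec_mulVec, h, Matrix.one_mulVec]
  conv_lhs => rw [hu v]
  conv_rhs => rw [hu u]
  simp only [← Matrix.mulVec_mulVec]
  rw [hG, hG, hX]

theorem conj_mem_eAlg {H Y : Mat p} (hH : H ∈ eGroup p) (hY : Y ∈ eAlg p) :
    H * Y * H⁻¹ ∈ eAlg p := by
  obtain ⟨G, a, hG, rfl⟩ := mem_eGroup_iff.mp hH
  obtain ⟨X, α, hX, rfl⟩ := mem_eAlg_iff.mp hY
  obtain ⟨G', h, -, -⟩ := hG.exists_inverse
  rw [grp_conj h]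
  exact aff_mem_eAlg.mpr (hG.skew_conj h hX)

theorem inv_mem_eGroup {H : Mat p} (hH : H ∈ eGroup p) : H⁻¹ ∈ eGroup p := by
  obtain ⟨G, a, hG, rfl⟩ := mem_eGroup_iff.mp hH
  obtain ⟨G', h, -, hG'⟩ := hG.exists_inverse
  rw [grp_inv h]
  exact mem_eGroup_iff.mpr ⟨_, _, hG', rfl⟩

theorem eGroup_mul_inv {H : Mat p} (hH : H ∈ eGroup p) : H * H⁻¹ = 1 := by
  obtain ⟨G, a, hG, rfl⟩ := mem_eGroup_iff.mp hH
  obtain ⟨G', h, -, hG'⟩ := hG.exists_inverse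
  rw [grp_inv h, grp_mul, h, Matrix.mulVec_neg, Matrix.mulVec_mulVec, h, Matrix.one_mulVec,
    neg_add_cancel, grp_one]

theorem conj_conj {H H' Y : Mat p} (h : H' * H = 1) : H' * (H * Y * H') * H = Y := by
  rw [← Matrix.mul_assoc, ← Matrix.mul_assoc, h, Matrix.one_mul, Matrix.mul_assoc, h,
    Matrix.mul_one]

theorem lie_conj {H H' Y Z : Mat p} (h : H' * H = 1) :
    ⁅H * Y * H', H * Z * H'⁆ = H * ⁅Y, Z⁆ * H' := by
  have : ∀ Y Z, H * Y * H' * (H * Z * H') = H * (Y * Z) * H' := fun Y Z => by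
    simp only [Matrix.mul_assoc]
    rw [← Matrix.mul_assoc H' H, h, Matrix.one_mul]
  rw [Ring.lie_def, Ring.lie_def, this, this, Matrix.mul_sub, Matrix.sub_mul]

/-- The preimage of a subalgebra under conjugation. -/
noncomputable def conjComap (A : LieSubalgebra ℝ (Mat p)) (H H' : Mat p) (h : H' * H = 1) :
    LieSubalgebra ℝ (Mat p) where
  carrier := {Y | H * Y * H' ∈ A}
  add_mem' := fun {Y Z} hY hZ => by
    simp only [Set.mem_ofPred_eq, Matrix.mul_add, Matrix.add_mul] at *
    exact add_mem hY hZ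
  zero_mem' := by simp
  smul_mem' := fun c Y hY => by
    simp only [Set.mem_ofPred_eq, Matrix.mul_smul, Matrix.smul_mul] at *
    exact SMulMemClass.smul_mem c hY
  lie_mem' := fun {Y Z} hY hZ => by
    simp only [Set.mem_ofPred_eq] at *
    rw [← lie_conj h]
    exact A.lie_mem hY hZ

theorem conj_iff {S : Set (Mat p)} {A A' : LieSubalgebra ℝ (Mat p)} (hS : S ⊆ eGroup p) :
    Conj S A A' ↔ ∃ H ∈ S, ∀ Y, Y ∈ A ↔ H * Y * H⁻¹ ∈ A' := by
  refine exists_congr fun H => and_congr_right fun hH => ?_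
  have h1 := eGroup_mul_inv (hS hH)
  have h2 := mul_eq_one_comm.mp h1
  constructor
  · intro h Y
    constructor
    · intro hY
      have : H * Y * H⁻¹ ∈ (A' : Set (Mat p)) := h ▸ ⟨Y, hY, rfl⟩
      exact this
    · intro hY
      have : H * Y * H⁻¹ ∈ (A' : Set (Mat p)) := hY
      rw [← h] at this
      obtain ⟨Z, hZ, hZY⟩ := this
      have := congrArg (fun Z => H⁻¹ * Z * H) hZY
      simp only [conj_conj h2] at this
      exact this ▸ hZ
  · intro h
    ext Y
    constructor
    · rintro ⟨Z, hZ, rfl⟩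
      exact (h Z).mp hZ
    · intro hY
      refine ⟨H⁻¹ * Y * H, (h _).mpr ?_, conj_conj h1⟩
      rw [conj_conj h1]
      exact hY

theorem Conj.symm {A A' : LieSubalgebra ℝ (Mat p)} (h : Conj (eGroup p) A A') :
    Conj (eGroup p) A' A := by
  rw [conj_iff subset_rfl] at h ⊢
  obtain ⟨H, hH, h⟩ := h
  have h1 := eGroup_mul_inv hH
  refine ⟨H⁻¹, inv_mem_eGroup hH, fun Y => ?_⟩
  rw [h, Matrix.inv_eq_right_inv (mul_eq_one_comm.mp h1), conj_conj h1]

theorem isMASA_of_conj {A A' : LieSubalgebra ℝ (Mat p)} (hA : IsMASA p A)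
    (h : Conj (eGroup p) A A') : IsMASA p A' := by
  obtain ⟨H, hH, h⟩ := (conj_iff subset_rfl).mp h.symm
  have h1 := eGroup_mul_inv hH
  have h2 := mul_eq_one_comm.mp h1
  have hinj : ∀ Y : Mat p, H * Y * H⁻¹ = 0 → Y = 0 := fun Y hY => by
    rw [← conj_conj (Y := Y) h2, hY, Matrix.mul_zero, Matrix.zero_mul]
  refine ⟨fun Y hY => ?_, fun Y hY Z hZ => hinj _ ?_, fun Y hY hc => ?_⟩
  · have := conj_mem_eAlg (inv_mem_eGroup hH) (hA.1 ((h Y).mp hY))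
    rwa [Matrix.inv_eq_right_inv h2, conj_conj h2] at this
  · rw [← lie_conj h2]
    exact hA.2.1 _ ((h Y).mp hY) _ ((h Z).mp hZ)
  · rw [h]
    refine hA.2.2 _ (conj_mem_eAlg hH hY) fun Z hZ => ?_
    rw [← conj_conj (Y := Z) h1, lie_conj h2, hc, Matrix.mul_zero, Matrix.zero_mul]
    rw [h, conj_conj h1]
    exact hZ

/-- An Abelian subalgebra that contains the conjugates of the generators of a standard subalgebra
is the conjugate of the standard subalgebra. -/
theorem conj_of_gens {l m : ℕ} {B : Block} (hp : p = B.k + 2 * l + m)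
    {A : LieSubalgebra ℝ (Mat p)} (hA : A ≤ eAlg p) (hA' : ∀ Y ∈ A, ∀ Z ∈ A, ⁅Y, Z⁆ = 0)
    {H : Mat p} (hH : H ∈ eGroup p) (h : ∀ g ∈ stdGens p B l m, H * g * H⁻¹ ∈ A) :
    Conj (eGroup p) (std p B l m) A := by
  have h1 := eGroup_mul_inv hH
  have h2 := mul_eq_one_comm.mp h1
  have hinj : ∀ Y : Mat p, H * Y * H⁻¹ = 0 → Y = 0 := fun Y hY => by
    rw [← conj_conj (Y := Y) h2, hY, Matrix.mul_zero, Matrix.zero_mul]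
  refine (conj_iff subset_rfl).mpr ⟨H, hH, fun Y => ⟨fun hY => ?_, fun hY => ?_⟩⟩
  · have : std p B l m ≤ conjComap A H H⁻¹ h2 := std_le hp h
    exact this hY
  -- The reverse inclusion uses the self-centralizing property of the standard side only, so `A` is
  -- not assumed maximal.
  · refine mem_std_of_comm hp ?_ fun g hg => hinj _ ?_
    · have := conj_mem_eAlg (inv_mem_eGroup hH) (hA hY)
      rwa [Matrix.inv_eq_right_inv h2, conj_conj h2] at this
    · rw [← lie_conj h2]
      exact hA' _ hY _ (h g hg)

theorem conj_translation (hG : Isom G) (v : V p) :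
    grp G a * aff 0 v * (grp G a)⁻¹ = aff 0 (G *ᵥ v) := by
  obtain ⟨G', h, -, -⟩ := hG.exists_inverse
  rw [grp_conj h]
  simp

theorem conj_aff_wedge (hG : Isom G) (u v τ : V p) :
    grp G a * aff (wedge u v) τ * (grp G a)⁻¹ =
      aff (wedge (G *ᵥ u) (G *ᵥ v)) (G *ᵥ τ - wedge (G *ᵥ u) (G *ᵥ v) *ᵥ a) := by
  obtain ⟨G', h, -, -⟩ := hG.exists_inverse
  rw [grp_conj h, hG.conj_wedge h]

end Conjugation

/-! ### Frames -/

section Frames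

variable {p : ℕ}

/-- The isometry attached to a family of vectors with the same Gram matrix as the coordinate
vectors. -/
theorem exists_isom (q : Fin (p + 1) → V p)
    (hq : ∀ i j, mf p (q i) (q j) = if i = j then gDiag i else 0) :
    ∃ G, Isom G ∧ ∀ i : Fin (p + 1), G *ᵥ ev p i = q i := by
  have hG : ∀ u : V p, (Matrix.of fun r c => q c r) *ᵥ u = ∑ i, u i • q i := by
    intro u
    ext r
    simp [Matrix.mulVec, dotProduct, mul_comm]
  refine ⟨Matrix.of fun r c => q c r, fun u v => ?_, fun i => ?_⟩
  · rw [hG, hG, mf_eq_sum p u v]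
    simp only [map_sum, map_smul, LinearMap.sum_apply, LinearMap.smul_apply, smul_eq_mul, hq,
      mul_ite, mul_zero, Finset.sum_ite_eq', Finset.mem_univ, if_true]
    exact Finset.sum_congr rfl fun i _ => by ring
  · rw [hG, Finset.sum_eq_single i]
    · simp [ev]
    · intro j _ hj
      simp [ev, Fin.val_inj, hj]
    · simp

/-- The dimension of a subspace with a family of vectors in duality with another family. -/
theorem finrank_eq_of_dual {ι : Type*} [Fintype ι] [DecidableEq ι] (F : Submodule ℝ (V p))
    (x y : ι → V p) (hx : ∀ i, x i ∈ F) (hxy : ∀ i j, mf p (x i) (y j) = if i = j then 1 else 0)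
    (hF : ∀ v ∈ F, (∀ i, mf p v (y i) = 0) → v = 0) : Module.finrank ℝ F = Fintype.card ι := by
  let φ : F →ₗ[ℝ] (ι → ℝ) := LinearMap.pi fun i => ((mf p).flip (y i)).comp F.subtype
  have hφ : ∀ v i, φ v i = mf p v (y i) := fun v i => rfl
  have hb : Function.Bijective φ := by
    constructor
    · rw [injective_iff_map_eq_zero]
      intro v hv
      ext1
      exact hF v v.2 fun i => by rw [← hφ, hv]; rfl
    · intro c
      refine ⟨⟨∑ i, c i • x i, sum_mem fun i _ => F.smul_mem _ (hx i)⟩, ?_⟩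
      ext j
      rw [hφ]
      simp [hxy]
  rw [(LinearEquiv.ofBijective φ hb).finrank_eq, Module.finrank_fintype_fun_eq_card]

theorem card_le_of_dual {ι : Type*} [Fintype ι] [DecidableEq ι] (x y : ι → V p)
    (hxy : ∀ i j, mf p (x i) (y j) = if i = j then 1 else 0) : Fintype.card ι ≤ p + 1 := by
  let φ : V p →ₗ[ℝ] (ι → ℝ) := LinearMap.pi fun i => (mf p).flip (y i)
  have hφ : ∀ v i, φ v i = mf p v (y i) := fun v i => rfl
  have hs : Function.Surjective φ := by
    intro c
    refine ⟨∑ i, c i • x i, ?_⟩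
    ext j
    rw [hφ]
    simp [hxy]
  have := LinearMap.finrank_le_finrank_of_surjective hs
  rwa [Module.finrank_fintype_fun_eq_card, Module.finrank_fintype_fun_eq_card,
    Fintype.card_fin] at this

/-- Orthonormal vectors spanning `k + 1` dimensions with one timelike vector, `l` planes, and `m`
lines assemble to an isometry. -/
theorem exists_isom_of_frame {k l m : ℕ} (c : Fin (k + 1) → V p) (U W : Fin l → V p)
    (s : Fin m → V p) (hc : ∀ i j, mf p (c i) (c j) = if i = j then gDiag i else 0)
    (hU : ∀ i j, mf p (U i) (U j) = if i = j then 1 else 0)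
    (hW : ∀ i j, mf p (W i) (W j) = if i = j then 1 else 0)
    (hs : ∀ i j, mf p (s i) (s j) = if i = j then 1 else 0)
    (hUW : ∀ i j, mf p (U i) (W j) = 0) (hUs : ∀ i j, mf p (U i) (s j) = 0)
    (hWs : ∀ i j, mf p (W i) (s j) = 0) (hcU : ∀ i j, mf p (c i) (U j) = 0)
    (hcW : ∀ i j, mf p (c i) (W j) = 0) (hcs : ∀ i j, mf p (c i) (s j) = 0)
    (hcompl : ∀ v, (∀ i, mf p v (c i) = 0) → (∀ i, mf p v (U i) = 0) → (∀ i, mf p v (W i) = 0) →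
      (∀ i, mf p v (s i) = 0) → v = 0) :
    p = k + 2 * l + m ∧ ∃ G, Isom G ∧ (∀ i : Fin (k + 1), G *ᵥ ev p i = c i) ∧
      (∀ i : Fin l, G *ᵥ ev p (k + 2 * i + 1) = U i) ∧
      (∀ i : Fin l, G *ᵥ ev p (k + 2 * i + 2) = W i) ∧
      ∀ i : Fin m, G *ᵥ ev p (k + 2 * l + i + 1) = s i := by
  let Q : Fin (k + 1) ⊕ ((Fin l × Fin 2) ⊕ Fin m) → V p :=
    Sum.elim c (Sum.elim (fun i => if i.2 = 0 then U i.1 else W i.1) s)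
  let ε : Fin (k + 1) ⊕ ((Fin l × Fin 2) ⊕ Fin m) → ℝ := Sum.elim (fun i => gDiag i) fun _ => 1
  have hQ : ∀ i j, mf p (Q i) (Q j) = if i = j then ε i else 0 := by
    have h2 : ∀ i : Fin 2, i = 0 ∨ i = 1 := fun i => by omega
    rintro (i | ⟨i, i'⟩ | i) (j | ⟨j, j'⟩ | j)
    · simp [Q, ε, hc]
    · rcases h2 j' with rfl | rfl <;> simp [Q, hcU, hcW]
    · simp [Q, hcs]
    · rw [mf_comm]
      rcases h2 i' with rfl | rfl <;> simp [Q, hcU, hcW]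
    · rcases h2 i' with rfl | rfl <;> rcases h2 j' with rfl | rfl
      · simp [Q, ε, hU]
      · simp [Q, hUW]
      · simp [Q, mf_comm p (W i), hUW]
      · simp [Q, ε, hW]
    · rcases h2 i' with rfl | rfl <;> simp [Q, hUs, hWs]
    · simp [Q, mf_comm p (s i), hcs]
    · rcases h2 j' with rfl | rfl <;> simp [Q, mf_comm p (s i), hUs, hWs]
    · simp [Q, ε, hs]
  have hε : ∀ i, ε i * ε i = 1 := by
    rintro (i | i)
    · exact gDiag_mul_self _
    · simp [ε]
  have hcard : p + 1 = (k + 1) + (l * 2 + m) := by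
    have := finrank_eq_of_dual (⊤ : Submodule ℝ (V p)) Q (fun i => ε i • Q i) (fun _ => trivial)
      (fun i j => by
        rw [map_smul, hQ, smul_eq_mul, mul_ite, mul_zero]
        by_cases h : i = j
        · rw [if_pos h, if_pos h, h, hε]
        · rw [if_neg h, if_neg h]) (fun v _ hv => by
        have hv' : ∀ i, mf p v (Q i) = 0 := fun i => by
          have h1 := hv i
          rw [map_smul, smul_eq_mul] at h1
          rcases mul_eq_zero.mp h1 with h | h
          · have := hε i
            rw [h] at this
            norm_num at this
          · exact h
        exact hcompl v (fun i => hv' (.inl i)) (fun i => hv' (.inr (.inl (i, 0))))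
          (fun i => hv' (.inr (.inl (i, 1)))) (fun i => hv' (.inr (.inr i))))
    simpa [Fintype.card_sum, Fintype.card_prod] using this
  have hp : p = k + 2 * l + m := by omega
  -- The enumeration lists the block first, then the planes with their two vectors adjacent, then
  -- the lines, as in `std`.
  let φ : Fin (k + 1) ⊕ ((Fin l × Fin 2) ⊕ Fin m) ≃ Fin (p + 1) :=
    ((Equiv.sumCongr (Equiv.refl _) ((Equiv.sumCongr finProdFinEquiv (Equiv.refl _)).trans
      finSumFinEquiv)).trans finSumFinEquiv).trans (finCongr hcard.symm)
  have φ1 : ∀ i : Fin (k + 1), (φ (.inl i) : ℕ) = i := fun i => by simp [φ]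
  have φ2 : ∀ (i : Fin l) (j : Fin 2), (φ (.inr (.inl (i, j))) : ℕ) = k + 2 * i + j + 1 :=
    fun i j => by
      simp [φ, finProdFinEquiv]
      ring
  have φ3 : ∀ i : Fin m, (φ (.inr (.inr i)) : ℕ) = k + 2 * l + i + 1 := fun i => by
    simp [φ]
    ring
  obtain ⟨G, hG, hGq⟩ := exists_isom (fun i => Q (φ.symm i)) fun i j => by
    rw [hQ]
    obtain ⟨i, rfl⟩ := φ.surjective i
    simp only [Equiv.symm_apply_apply, Equiv.eq_symm_apply]
    refine if_congr Iff.rfl ?_ rfl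
    rcases i with i | ⟨i, j⟩ | i
    · rw [φ1]
      rfl
    · rw [φ2, gDiag_succ]
      rfl
    · rw [φ3, gDiag_succ]
      rfl
  have hGφ : ∀ i, G *ᵥ ev p (φ i) = Q i := fun i => by rw [hGq, Equiv.symm_apply_apply]
  refine ⟨hp, G, hG, fun i => ?_, fun i => ?_, fun i => ?_, fun i => ?_⟩
  · rw [← φ1, hGφ]
    rfl
  · have := φ2 i 0
    simp only [Fin.val_zero, add_zero] at this
    rw [← this, hGφ]
    rfl
  · have := φ2 i 1
    simp only [Fin.val_one] at this
    rw [← this, hGφ]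
    rfl
  · rw [← φ3, hGφ]
    rfl

end Frames

end MinkMASA
namespace MinkMASA

/-! ### Joint eigenvectors of commuting skew matrices -/

/-- Commuting endomorphisms have a joint eigenvector in every nonzero invariant subspace. -/
theorem exists_joint_eigenvector {E : Type*} [AddCommGroup E] [Module ℂ E]
    [FiniteDimensional ℂ E] (S : Set (Module.End ℂ E)) (hS : ∀ f ∈ S, ∀ g ∈ S, f * g = g * f)
    (U : Submodule ℂ E) (hU : U ≠ ⊥) (hinv : ∀ f ∈ S, ∀ z ∈ U, f z ∈ U) :
    ∃ z ∈ U, z ≠ 0 ∧ ∀ f ∈ S, ∃ μ : ℂ, f z = μ • z := by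
  -- In a minimal nonzero invariant subspace, the eigenspace of one element is invariant under all
  -- by commutation, hence is everything: each element acts as a scalar.
  obtain ⟨M, ⟨hMU, hM, hMinv⟩, hmin⟩ := wellFounded_lt.has_min
    {M : Submodule ℂ E | M ≤ U ∧ M ≠ ⊥ ∧ ∀ f ∈ S, ∀ z ∈ M, f z ∈ M} ⟨U, le_rfl, hU, hinv⟩
  obtain ⟨z, hz, hz0⟩ := M.ne_bot_iff.mp hM
  refine ⟨z, hMU hz, hz0, fun f hf => ?_⟩
  have : Nontrivial M := Submodule.nontrivial_iff_ne_bot.mpr hM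
  obtain ⟨μ, hμ⟩ := Module.End.exists_eigenvalue (f.restrict (hMinv f hf))
  obtain ⟨y, hy⟩ := hμ.exists_hasEigenvector
  refine ⟨μ, ?_⟩
  have hle : M ⊓ Module.End.eigenspace f μ = M := by
    by_contra hne
    refine hmin (M ⊓ Module.End.eigenspace f μ) ⟨inf_le_left.trans hMU, ?_, ?_⟩
      (lt_of_le_of_ne inf_le_left hne)
    · refine (Submodule.ne_bot_iff _).mpr ⟨y, ⟨y.2, ?_⟩, fun h => hy.2 (Subtype.ext h)⟩
      rw [SetLike.mem_coe, Module.End.mem_eigenspace_iff]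
      simpa using congrArg Subtype.val hy.apply_eq_smul
    · rintro g hg x ⟨hx, hx'⟩
      refine ⟨hMinv g hg x hx, ?_⟩
      rw [SetLike.mem_coe, Module.End.mem_eigenspace_iff] at hx' ⊢
      rw [← Module.End.mul_apply, hS f hf g hg, Module.End.mul_apply, hx', map_smul]
  rw [← hle] at hz
  exact Module.End.mem_eigenspace_iff.mp hz.2

/-! ### Real eigenvectors, rotated planes and maximal families -/

section Real

variable {p : ℕ} {𝓧 : Set (Matrix (Fin (p + 1)) (Fin (p + 1)) ℝ)}

/-- Commuting matrices have a joint eigenvector in the complexification of every nonzero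
invariant subspace. -/
theorem exists_complex_eigenvector (hc : ∀ X ∈ 𝓧, ∀ Y ∈ 𝓧, X * Y = Y * X)
    (W : Submodule ℝ (V p)) (hW : W ≠ ⊥) (hinv : ∀ X ∈ 𝓧, ∀ v ∈ W, X *ᵥ v ∈ W) :
    ∃ x ∈ W, ∃ y ∈ W, (x ≠ 0 ∨ y ≠ 0) ∧ ∀ X ∈ 𝓧, ∃ a β : ℝ,
      X *ᵥ x = a • x - β • y ∧ X *ᵥ y = β • x + a • y := by
  let re : (Fin (p + 1) → ℂ) → V p := fun z i => (z i).re
  let im : (Fin (p + 1) → ℂ) → V p := fun z i => (z i).im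
  have hre : ∀ (μ : ℂ) z, re (μ • z) = μ.re • re z - μ.im • im z := fun μ z => by
    ext i; simp [re, im]
  have him : ∀ (μ : ℂ) z, im (μ • z) = μ.im • re z + μ.re • im z := fun μ z => by
    ext i; simp [re, im]; ring
  let U : Submodule ℂ (Fin (p + 1) → ℂ) :=
    { carrier := {z | re z ∈ W ∧ im z ∈ W}
      add_mem' := fun {z w} hz hw => ⟨W.add_mem hz.1 hw.1, W.add_mem hz.2 hw.2⟩
      zero_mem' := ⟨W.zero_mem, W.zero_mem⟩
      smul_mem' := fun μ z hz => by
        refine ⟨?_, ?_⟩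
        · rw [hre]
          exact W.sub_mem (W.smul_mem _ hz.1) (W.smul_mem _ hz.2)
        · rw [him]
          exact W.add_mem (W.smul_mem _ hz.1) (W.smul_mem _ hz.2) }
  let Φ : Matrix (Fin (p + 1)) (Fin (p + 1)) ℝ → Module.End ℂ (Fin (p + 1) → ℂ) := fun X =>
    Matrix.mulVecLin (X.map Complex.ofReal)
  have hΦre : ∀ X z, re (Φ X z) = X *ᵥ re z := fun X z => by
    ext i
    simp [re, Φ, Matrix.mulVec, dotProduct]
  have hΦim : ∀ X z, im (Φ X z) = X *ᵥ im z := fun X z => by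
    ext i
    simp [im, Φ, Matrix.mulVec, dotProduct]
  have hext : ∀ z w, re z = re w → im z = im w → z = w := fun z w h h' => by
    ext i
    exact Complex.ext (congrFun h i) (congrFun h' i)
  have hU : U ≠ ⊥ := by
    obtain ⟨v, hv, hv0⟩ := W.ne_bot_iff.mp hW
    refine U.ne_bot_iff.mpr ⟨fun i => (v i : ℂ), ⟨?_, ?_⟩, fun h => hv0 ?_⟩
    · simpa [re] using hv
    · simp only [im, Complex.ofReal_im]
      exact W.zero_mem
    · ext i
      simpa using congrFun h i
  obtain ⟨z, hz, hz0, hzμ⟩ := exists_joint_eigenvector (Φ '' 𝓧) (by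
    rintro _ ⟨X, hX, rfl⟩ _ ⟨Y, hY, rfl⟩
    ext1 z
    refine LinearMap.ext fun c => hext _ _ ?_ ?_
    · simp only [LinearMap.comp_apply, Module.End.mul_apply, hΦre, Matrix.mulVec_mulVec,
        hc X hX Y hY]
    · simp only [LinearMap.comp_apply, Module.End.mul_apply, hΦim, Matrix.mulVec_mulVec,
        hc X hX Y hY]) U hU (by
    rintro _ ⟨X, hX, rfl⟩ z hz
    refine ⟨?_, ?_⟩
    · rw [hΦre]
      exact hinv X hX _ hz.1
    · rw [hΦim]
      exact hinv X hX _ hz.2)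
  refine ⟨re z, hz.1, im z, hz.2, ?_, fun X hX => ?_⟩
  · by_contra! h
    exact hz0 (hext _ _ h.1 h.2)
  · obtain ⟨μ, hμ⟩ := hzμ _ ⟨X, hX, rfl⟩
    refine ⟨μ.re, μ.im, ?_, ?_⟩
    · rw [← hΦre, hμ, hre]
    · rw [← hΦim, hμ, him]

/-- `X` rotates the plane of the orthonormal vectors `u`, `w` with angular velocity `θ`. -/
def Rotates (X : Matrix (Fin (p + 1)) (Fin (p + 1)) ℝ) (u w : V p) (θ : ℝ) : Prop :=
  X *ᵥ u = θ • w ∧ X *ᵥ w = -θ • u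

/-- Commuting skew matrices on a nonzero invariant subspace of `M(p,1)` have a joint eigenvector
or rotate a spacelike plane. -/
theorem exists_eigenvector_or_plane (hs : ∀ X ∈ 𝓧, Skew X)
    (hc : ∀ X ∈ 𝓧, ∀ Y ∈ 𝓧, X * Y = Y * X) (W : Submodule ℝ (V p)) (hW : W ≠ ⊥)
    (hinv : ∀ X ∈ 𝓧, ∀ v ∈ W, X *ᵥ v ∈ W) :
    (∃ x ∈ W, x ≠ 0 ∧ ∀ X ∈ 𝓧, ∃ c : ℝ, X *ᵥ x = c • x) ∨
    ∃ u ∈ W, ∃ w ∈ W, mf p u u = 1 ∧ mf p w w = 1 ∧ mf p u w = 0 ∧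
      (∀ X ∈ 𝓧, ∃ θ, Rotates X u w θ) ∧ ∃ X ∈ 𝓧, X *ᵥ u ≠ 0 := by
  obtain ⟨x, hx, y, hy, hxy, hX⟩ := exists_complex_eigenvector hc W hW hinv
  by_cases hβ : ∀ X ∈ 𝓧, ∀ a β : ℝ, X *ᵥ x = a • x - β • y → X *ᵥ y = β • x + a • y → β = 0
  · left
    rcases hxy with h | h
    · refine ⟨x, hx, h, fun X hXX => ?_⟩
      obtain ⟨a, β, h1, h2⟩ := hX X hXX
      refine ⟨a, ?_⟩
      rw [h1, hβ X hXX a β h1 h2, zero_smul, sub_zero]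
    · refine ⟨y, hy, h, fun X hXX => ?_⟩
      obtain ⟨a, β, h1, h2⟩ := hX X hXX
      refine ⟨a, ?_⟩
      rw [h2, hβ X hXX a β h1 h2, zero_smul, zero_add]
  · right
    push Not at hβ
    obtain ⟨X₀, hX₀, a₀, β₀, h1, h2, hβ₀⟩ := hβ
    -- Skewness evaluated on the pairs (x, x), (y, y) and (x, y).
    have key : ∀ X ∈ 𝓧, ∀ a β : ℝ, X *ᵥ x = a • x - β • y → X *ᵥ y = β • x + a • y →
        a * mf p x x = β * mf p x y ∧ a * mf p y y = -(β * mf p x y) ∧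
          2 * (a * mf p x y) = β * (mf p y y - mf p x x) := by
      intro X hXX a β h1 h2
      have e1 := (hs X hXX).mf_self x
      have e2 := (hs X hXX).mf_self y
      have e3 := hs X hXX x y
      rw [h1] at e1
      rw [h2] at e2
      rw [h1, h2] at e3
      simp only [map_add, map_sub, map_smul, LinearMap.add_apply, LinearMap.sub_apply,
        LinearMap.smul_apply, smul_eq_mul, mf_comm p y x] at e1 e2 e3
      refine ⟨?_, ?_, ?_⟩ <;> linarith
    obtain ⟨k1, k2, k3⟩ := key X₀ hX₀ a₀ β₀ h1 h2
    -- When a₀ ≠ 0 the three relations combine to (a₀² + β₀²)⟨x, y⟩ = 0; when a₀ = 0 the first one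
    -- suffices. The third then makes the squares of x and y equal.
    have hR : mf p x y = 0 := by
      by_cases ha : a₀ = 0
      · rw [ha, zero_mul] at k1
        exact (mul_eq_zero.mp k1.symm).resolve_left hβ₀
      · have hQ : mf p y y = -mf p x x :=
          mul_left_cancel₀ ha (by rw [k2, mul_neg, k1])
        rw [hQ] at k3
        have h5 : a₀ * mf p x y = -(β₀ * mf p x x) := by linarith
        have h6 : (a₀ * a₀ + β₀ * β₀) * mf p x y = 0 := by
          have : a₀ * (a₀ * mf p x y) = -(β₀ * (a₀ * mf p x x)) := by rw [h5]; ring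
          rw [k1] at this
          linarith
        refine (mul_eq_zero.mp h6).resolve_left ?_
        have := mul_self_pos.mpr ha
        nlinarith [mul_self_nonneg β₀]
    rw [hR, mul_zero, mul_zero] at k3
    have hPQ : mf p y y = mf p x x := by
      have := (mul_eq_zero.mp k3.symm).resolve_left hβ₀
      linarith
    have hx0 : x ≠ 0 := by
      rintro rfl
      rw [Matrix.mulVec_zero, smul_zero, zero_sub, eq_comm, neg_eq_zero] at h1
      exact hxy.elim (fun h => h rfl) fun h => h ((smul_eq_zero.mp h1).resolve_left hβ₀)
    -- Otherwise x and y are orthogonal and not spacelike, hence y = cx. The eigenvector relations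
    -- then give β₀(c² + 1) = 0.
    have hP : 0 < mf p x x := by
      by_contra! hP
      obtain ⟨c, rfl⟩ := exists_smul_of_nonpos hx0 hP hR (hPQ.trans_le hP)
      rw [Matrix.mulVec_smul, h1, smul_smul, ← sub_smul, smul_smul, smul_smul, ← add_smul] at h2
      have := smul_left_injective ℝ hx0 h2
      have h5 : β₀ * (c * c + 1) = 0 := by linarith
      have h6 := (mul_eq_zero.mp h5).resolve_left hβ₀
      nlinarith [mul_self_nonneg c]
    have hrt : √(mf p x x) * √(mf p x x) = mf p x x := Real.mul_self_sqrt hP.le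
    have hrt0 : √(mf p x x) ≠ 0 := (Real.sqrt_pos.mpr hP).ne'
    set r := √(mf p x x) with hr
    have hrr : r⁻¹ * (r⁻¹ * mf p x x) = 1 := by rw [← hrt]; field_simp
    have ha : ∀ X ∈ 𝓧, ∀ a β : ℝ, X *ᵥ x = a • x - β • y → X *ᵥ y = β • x + a • y →
        a = 0 := fun X hXX a β h1 h2 => by
      have := (key X hXX a β h1 h2).1
      rw [hR, mul_zero] at this
      exact (mul_eq_zero.mp this).resolve_right hP.ne'
    refine ⟨r⁻¹ • x, W.smul_mem _ hx, r⁻¹ • y, W.smul_mem _ hy, ?_, ?_, ?_, ?_, X₀, hX₀, ?_⟩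
    · simpa only [map_smul, LinearMap.smul_apply, smul_eq_mul] using hrr
    · simpa only [map_smul, LinearMap.smul_apply, smul_eq_mul, hPQ] using hrr
    · simp only [map_smul, LinearMap.smul_apply, smul_eq_mul, hR, mul_zero]
    · intro X hXX
      obtain ⟨a, β, h1, h2⟩ := hX X hXX
      obtain rfl := ha X hXX a β h1 h2
      refine ⟨-β, ?_, ?_⟩
      · rw [Matrix.mulVec_smul, h1, zero_smul, zero_sub, ← neg_smul, smul_comm]
      · rw [Matrix.mulVec_smul, h2, zero_smul, add_zero, neg_neg, smul_comm]
    · rw [Matrix.mulVec_smul, h1, ha X₀ hX₀ a₀ β₀ h1 h2, zero_smul, zero_sub]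
      have hy0 : y ≠ 0 := by
        rintro rfl
        rw [map_zero] at hPQ
        exact hP.ne hPQ
      simp [hrt0, hβ₀, hy0]

/-! ### Splitting off rotated planes and fixed spacelike lines -/

/-- An orthonormal family of `l` planes rotated by a set of matrices and `m` spacelike lines fixed
by it. -/
structure Family (𝓧 : Set (Matrix (Fin (p + 1)) (Fin (p + 1)) ℝ)) (l m : ℕ) (U W : Fin l → V p)
    (s : Fin m → V p) : Prop where
  UU : ∀ i j, mf p (U i) (U j) = if i = j then 1 else 0
  WW : ∀ i j, mf p (W i) (W j) = if i = j then 1 else 0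
  ss : ∀ i j, mf p (s i) (s j) = if i = j then 1 else 0
  UW : ∀ i j, mf p (U i) (W j) = 0
  Us : ∀ i j, mf p (U i) (s j) = 0
  Ws : ∀ i j, mf p (W i) (s j) = 0
  planes : ∀ i, (∀ X ∈ 𝓧, ∃ θ, Rotates X (U i) (W i) θ) ∧ ∃ X ∈ 𝓧, X *ᵥ U i ≠ 0
  lines : ∀ X ∈ 𝓧, ∀ i, X *ᵥ s i = 0

/-- The orthogonal complement of a family of planes and lines. -/
noncomputable def famCompl {l m : ℕ} (U W : Fin l → V p) (s : Fin m → V p) :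
    Submodule ℝ (V p) where
  carrier := {v | (∀ i, mf p v (U i) = 0) ∧ (∀ i, mf p v (W i) = 0) ∧ ∀ i, mf p v (s i) = 0}
  add_mem' := fun {v w} hv hw => by
    refine ⟨fun i => ?_, fun i => ?_, fun i => ?_⟩ <;> rw [map_add, LinearMap.add_apply]
    · rw [hv.1, hw.1, add_zero]
    · rw [hv.2.1, hw.2.1, add_zero]
    · rw [hv.2.2, hw.2.2, add_zero]
  zero_mem' := by simp
  smul_mem' := fun c v hv => by
    refine ⟨fun i => ?_, fun i => ?_, fun i => ?_⟩ <;>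
      rw [map_smul, LinearMap.smul_apply, smul_eq_mul]
    · rw [hv.1, mul_zero]
    · rw [hv.2.1, mul_zero]
    · rw [hv.2.2, mul_zero]

namespace Family

variable {l m : ℕ} {U W : Fin l → V p} {s : Fin m → V p}

theorem mulVec_mem (h : Family 𝓧 l m U W s) {X : Matrix (Fin (p + 1)) (Fin (p + 1)) ℝ}
    (hX : X ∈ 𝓧) (hs : Skew X) {v : V p} (hv : v ∈ famCompl U W s) :
    X *ᵥ v ∈ famCompl U W s := by
  refine ⟨fun i => ?_, fun i => ?_, fun i => ?_⟩ <;> rw [hs]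
  · obtain ⟨θ, h1, -⟩ := (h.planes i).1 X hX
    rw [h1, map_smul, hv.2.1, smul_zero, neg_zero]
  · obtain ⟨θ, -, h1⟩ := (h.planes i).1 X hX
    rw [h1, map_smul, hv.1, smul_zero, neg_zero]
  · rw [h.lines X hX, map_zero, neg_zero]

theorem add_line (h : Family 𝓧 l m U W s) {u : V p} (hu : u ∈ famCompl U W s)
    (huu : mf p u u = 1) (hX : ∀ X ∈ 𝓧, X *ᵥ u = 0) :
    Family 𝓧 l (m + 1) U W (Fin.cons u s) where
  UU := h.UU
  WW := h.WW
  ss := by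
    simp only [Fin.forall_fin_succ, Fin.cons_zero, Fin.cons_succ, huu, mf_comm p _ u, hu.2.2,
      h.ss, Fin.succ_inj, (Fin.succ_ne_zero _).symm, Fin.succ_ne_zero]
    simp
  UW := h.UW
  Us := by
    simp only [Fin.forall_fin_succ, Fin.cons_zero, Fin.cons_succ, mf_comm p _ u, hu.1, h.Us]
    simp
  Ws := by
    simp only [Fin.forall_fin_succ, Fin.cons_zero, Fin.cons_succ, mf_comm p _ u, hu.2.1, h.Ws]
    simp
  planes := h.planes
  lines X hXX := by
    simp only [Fin.forall_fin_succ, Fin.cons_zero, Fin.cons_succ]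
    exact ⟨hX X hXX, h.lines X hXX⟩

theorem add_plane (h : Family 𝓧 l m U W s) {u w : V p} (hu : u ∈ famCompl U W s)
    (hw : w ∈ famCompl U W s) (huu : mf p u u = 1) (hww : mf p w w = 1) (huw : mf p u w = 0)
    (hX : ∀ X ∈ 𝓧, ∃ θ, Rotates X u w θ) (hX' : ∃ X ∈ 𝓧, X *ᵥ u ≠ 0) :
    Family 𝓧 (l + 1) m (Fin.cons u U) (Fin.cons w W) s where
  UU := by
    simp only [Fin.forall_fin_succ, Fin.cons_zero, Fin.cons_succ, huu, mf_comm p _ u, hu.1,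
      h.UU, Fin.succ_inj, (Fin.succ_ne_zero _).symm, Fin.succ_ne_zero]
    simp
  WW := by
    simp only [Fin.forall_fin_succ, Fin.cons_zero, Fin.cons_succ, hww, mf_comm p _ w, hw.2.1,
      h.WW, Fin.succ_inj, (Fin.succ_ne_zero _).symm, Fin.succ_ne_zero]
    simp
  ss := h.ss
  UW := by
    have hwU := fun i => (mf_comm p (U i) w).trans (hw.1 i)
    simp only [Fin.forall_fin_succ, Fin.cons_zero, Fin.cons_succ, huw, hwU, hu.2.1, h.UW]
    simp
  Us := by
    simp only [Fin.forall_fin_succ, Fin.cons_zero, Fin.cons_succ, hu.2.2, h.Us]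
    simp
  Ws := by
    simp only [Fin.forall_fin_succ, Fin.cons_zero, Fin.cons_succ, hw.2.2, h.Ws]
    simp
  planes := by
    simp only [Fin.forall_fin_succ, Fin.cons_zero, Fin.cons_succ]
    exact ⟨⟨hX, hX'⟩, h.planes⟩
  lines := h.lines

theorem card_le (h : Family 𝓧 l m U W s) : 2 * l + m ≤ p + 1 := by
  let Q : (Fin l ⊕ Fin l) ⊕ Fin m → V p := Sum.elim (Sum.elim U W) s
  have hWU : ∀ i j, mf p (W i) (U j) = 0 := fun i j => by rw [mf_comm, h.UW]
  have hsU : ∀ i j, mf p (s i) (U j) = 0 := fun i j => by rw [mf_comm, h.Us]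
  have hsW : ∀ i j, mf p (s i) (W j) = 0 := fun i j => by rw [mf_comm, h.Ws]
  have := card_le_of_dual Q Q (by
    rintro ((i | i) | i) ((j | j) | j) <;>
      simp [Q, h.UU, h.WW, h.ss, h.UW, h.Us, h.Ws, hWU, hsU, hsW])
  simp only [Fintype.card_sum, Fintype.card_fin] at this
  omega

/-- Project e_0 onto the complement. The removed vectors are spacelike unit vectors, so the square
of the projection is -1 minus a sum of squares. -/
theorem exists_timelike (h : Family 𝓧 l m U W s) : ∃ t ∈ famCompl U W s, mf p t t < 0 := by
  have hWU : ∀ i j, mf p (W i) (U j) = 0 := fun i j => by rw [mf_comm, h.UW]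
  have hsU : ∀ i j, mf p (s i) (U j) = 0 := fun i j => by rw [mf_comm, h.Us]
  have hsW : ∀ i j, mf p (s i) (W j) = 0 := fun i j => by rw [mf_comm, h.Ws]
  set t : V p := ev p 0 - ∑ i, mf p (ev p 0) (U i) • U i - ∑ i, mf p (ev p 0) (W i) • W i -
    ∑ i, mf p (ev p 0) (s i) • s i with ht
  have htU : ∀ i, mf p t (U i) = 0 := fun i => by
    simp [ht, h.UU, hWU, hsU]
  have htW : ∀ i, mf p t (W i) = 0 := fun i => by
    simp [ht, h.WW, h.UW, hsW]
  have hts : ∀ i, mf p t (s i) = 0 := fun i => by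
    simp [ht, h.Us, h.Ws, h.ss]
  refine ⟨t, ⟨htU, htW, hts⟩, ?_⟩
  have h1 : mf p t t = mf p t (ev p 0) := by
    conv_lhs => rw [ht, ← ht]
    rw [map_sub, map_sub, map_sub, map_sum, map_sum, map_sum]
    simp [htU, htW, hts]
  rw [h1, ht]
  simp only [map_sub, map_sum, map_smul, LinearMap.sub_apply, LinearMap.sum_apply,
    LinearMap.smul_apply, smul_eq_mul, mf_ev_zero]
  have hsq : ∀ {n : ℕ} (x : Fin n → V p),
      0 ≤ ∑ i, mf p (ev p 0) (x i) * mf p (x i) (ev p 0) := fun x =>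
    Finset.sum_nonneg fun i _ => by rw [mf_comm p (x i)]; exact mul_self_nonneg _
  have := hsq U
  have := hsq W
  have := hsq s
  linarith

end Family

/-- A family of planes and lines that cannot be enlarged. -/
structure MaxFamily (𝓧 : Set (Matrix (Fin (p + 1)) (Fin (p + 1)) ℝ)) (l m : ℕ)
    (U W : Fin l → V p) (s : Fin m → V p) : Prop extends Family 𝓧 l m U W s where
  no_line : ∀ u ∈ famCompl U W s, mf p u u = 1 → ¬ ∀ X ∈ 𝓧, X *ᵥ u = 0
  no_plane : ∀ u ∈ famCompl U W s, ∀ w ∈ famCompl U W s, mf p u u = 1 → mf p w w = 1 →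
    mf p u w = 0 → (∀ X ∈ 𝓧, ∃ θ, Rotates X u w θ) → ¬ ∃ X ∈ 𝓧, X *ᵥ u ≠ 0

/-- Each enlargement increases 2l + m, which is bounded by the dimension. -/
theorem exists_maxFamily (𝓧 : Set (Matrix (Fin (p + 1)) (Fin (p + 1)) ℝ)) :
    ∃ (l m : ℕ) (U W : Fin l → V p) (s : Fin m → V p), MaxFamily 𝓧 l m U W s := by
  by_contra! hno
  have key : ∀ n : ℕ, ∃ (l m : ℕ) (U W : Fin l → V p) (s : Fin m → V p),
      Family 𝓧 l m U W s ∧ n ≤ 2 * l + m := by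
    intro n
    induction n with
    | zero =>
      refine ⟨0, 0, Fin.elim0, Fin.elim0, Fin.elim0, ?_, Nat.zero_le _⟩
      constructor <;> intros <;> exact Fin.elim0 ‹_›
    | succ n ih =>
      obtain ⟨l, m, U, W, s, h, hn⟩ := ih
      by_contra! hno'
      refine hno l m U W s ⟨h, fun u hu huu hX => ?_, fun u hu w hw huu hww huw hX hX' => ?_⟩
      · have := hno' _ _ _ _ _ (h.add_line hu huu hX)
        omega
      · have := hno' _ _ _ _ _ (h.add_plane hu hw huu hww huw hX hX')
        omega
  obtain ⟨l, m, U, W, s, h, hn⟩ := key (p + 2)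
  have := h.card_le
  omega

namespace MaxFamily

variable {l m : ℕ} {U W : Fin l → V p} {s : Fin m → V p}

/-- The nonzero invariant subspaces of the complement of a maximal family contain joint
eigenvectors that are not spacelike. -/
theorem exists_eigenvector (h : MaxFamily 𝓧 l m U W s) (hs : ∀ X ∈ 𝓧, Skew X)
    (hc : ∀ X ∈ 𝓧, ∀ Y ∈ 𝓧, X * Y = Y * X) {M : Submodule ℝ (V p)} (hM : M ≠ ⊥)
    (hMle : M ≤ famCompl U W s) (hinv : ∀ X ∈ 𝓧, ∀ v ∈ M, X *ᵥ v ∈ M) :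
    ∃ x ∈ M, x ≠ 0 ∧ mf p x x ≤ 0 ∧ ∀ X ∈ 𝓧, ∃ c : ℝ, X *ᵥ x = c • x := by
  rcases exists_eigenvector_or_plane hs hc M hM hinv with
    ⟨x, hx, hx0, hX⟩ | ⟨u, hu, w, hw, huu, hww, huw, hX, hX'⟩
  · refine ⟨x, hx, hx0, ?_, hX⟩
    by_contra! hpos
    have hr0 : √(mf p x x) ≠ 0 := (Real.sqrt_pos.mpr hpos).ne'
    have hrt : √(mf p x x) * √(mf p x x) = mf p x x := Real.mul_self_sqrt hpos.le
    set r := √(mf p x x) with hr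
    refine h.no_line (r⁻¹ • x) ((famCompl U W s).smul_mem _ (hMle hx)) ?_ fun X hXX => ?_
    · simp only [map_smul, LinearMap.smul_apply, smul_eq_mul]
      rw [← hrt]
      field_simp
    · obtain ⟨c, hc⟩ := hX X hXX
      have := (hs X hXX).mf_self x
      rw [hc, map_smul, LinearMap.smul_apply, smul_eq_mul] at this
      have hc0 := (mul_eq_zero.mp this).resolve_right hpos.ne'
      rw [Matrix.mulVec_smul, hc, hc0, zero_smul, smul_zero]
  · exact absurd hX' (h.no_plane u (hMle hu) w (hMle hw) huu hww huw hX)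

end MaxFamily

end Real

end MinkMASA
namespace MinkMASA

/-! ### Normal forms of maximal Abelian subalgebras -/

section NormalForm

variable {p : ℕ}

/-- The linear parts of the elements of a subalgebra. -/
def linParts (A : LieSubalgebra ℝ (Mat p)) : Set (Matrix (Fin (p + 1)) (Fin (p + 1)) ℝ) :=
  {X | ∃ α, aff X α ∈ A}

theorem IsMASA.skew {A : LieSubalgebra ℝ (Mat p)} (hA : IsMASA p A)
    {X : Matrix (Fin (p + 1)) (Fin (p + 1)) ℝ} (hX : X ∈ linParts A) : Skew X := by
  obtain ⟨α, h⟩ := hX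
  exact aff_mem_eAlg.mp (hA.1 h)

theorem IsMASA.comm {A : LieSubalgebra ℝ (Mat p)} (hA : IsMASA p A)
    {X Y : Matrix (Fin (p + 1)) (Fin (p + 1)) ℝ} (hX : X ∈ linParts A) (hY : Y ∈ linParts A) :
    X * Y = Y * X := by
  obtain ⟨α, h⟩ := hX
  obtain ⟨β, h'⟩ := hY
  exact (lie_aff_eq_zero.mp (hA.2.1 _ h _ h')).1

theorem IsMASA.cocycle {A : LieSubalgebra ℝ (Mat p)} (hA : IsMASA p A)
    {X Y : Matrix (Fin (p + 1)) (Fin (p + 1)) ℝ} {α β : V p} (hX : aff X α ∈ A)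
    (hY : aff Y β ∈ A) : X *ᵥ β = Y *ᵥ α :=
  (lie_aff_eq_zero.mp (hA.2.1 _ hX _ hY)).2

/-- The pairing of the cocycle identity with a vector. -/
theorem IsMASA.cocycle_mf {A : LieSubalgebra ℝ (Mat p)} (hA : IsMASA p A)
    {X Y : Matrix (Fin (p + 1)) (Fin (p + 1)) ℝ} {α β : V p} (hX : aff X α ∈ A)
    (hY : aff Y β ∈ A) (v : V p) : mf p β (X *ᵥ v) = mf p α (Y *ᵥ v) := by
  have h1 := hA.skew ⟨α, hX⟩ β v
  have h2 := hA.skew ⟨β, hY⟩ α v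
  rw [hA.cocycle hX hY] at h1
  linarith

/-- Maximality read after moving the origin to o: there every element (X, α) becomes (X, α + Xo),
and the candidate has translation part γ. The commutation is checked in these coordinates and the
conclusion is transported back. -/
theorem IsMASA.mem {A : LieSubalgebra ℝ (Mat p)} (hA : IsMASA p A)
    {Z : Matrix (Fin (p + 1)) (Fin (p + 1)) ℝ} {γ o : V p} (hZ : Skew Z)
    (h : ∀ X α, aff X α ∈ A → X * Z - Z * X = 0 ∧ X *ᵥ γ = Z *ᵥ (α + X *ᵥ o)) :
    aff Z (γ - Z *ᵥ o) ∈ A := by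
  refine hA.2.2 _ (aff_mem_eAlg.mpr hZ) fun Y hY => ?_
  obtain ⟨X, α, -, rfl⟩ := mem_eAlg_iff.mp (hA.1 hY)
  obtain ⟨h1, h2⟩ := h X α hY
  rw [lie_aff_eq_zero]
  refine ⟨(sub_eq_zero.mp h1).symm, ?_⟩
  rw [Matrix.mulVec_sub, h2, Matrix.mulVec_mulVec, sub_eq_zero.mp h1, Matrix.mulVec_add,
    Matrix.mulVec_mulVec, add_sub_cancel_right]

theorem IsMASA.translation_mem {A : LieSubalgebra ℝ (Mat p)} (hA : IsMASA p A) {v : V p}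
    (h : ∀ X ∈ linParts A, X *ᵥ v = 0) : aff 0 v ∈ A := by
  have := hA.mem (Z := 0) (γ := v) (o := 0) (fun u v => by simp) fun X α hX => by
    simp [h X ⟨α, hX⟩]
  simpa using this

/-- Translating the origin removes the components of all translation parts along a plane that
is rotated by the linear parts. -/
theorem IsMASA.exists_origin_plane {A : LieSubalgebra ℝ (Mat p)} (hA : IsMASA p A) {u w : V p}
    (h : ∀ X ∈ linParts A, ∃ θ, Rotates X u w θ)
    (h0 : ∃ X ∈ linParts A, X *ᵥ u ≠ 0) :
    ∃ x y : ℝ, ∀ o, mf p o u = x → mf p o w = y → ∀ X α, aff X α ∈ A →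
      mf p (α + X *ᵥ o) u = 0 ∧ mf p (α + X *ᵥ o) w = 0 := by
  obtain ⟨X₀, ⟨α₀, hX₀⟩, hne⟩ := h0
  obtain ⟨θ₀, h1, h2⟩ := h X₀ ⟨α₀, hX₀⟩
  have hθ₀ : θ₀ ≠ 0 := by
    rintro rfl
    exact hne (by rw [h1, zero_smul])
  -- These values make α₀ + X₀o orthogonal to u and w: for instance ⟨X₀o, u⟩ = -θ₀⟨o, w⟩. The
  -- cocycle identity carries this over to every other element.
  refine ⟨-(mf p α₀ w / θ₀), mf p α₀ u / θ₀, fun o hx hy X α hX => ?_⟩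
  obtain ⟨θ, h3, h4⟩ := h X ⟨α, hX⟩
  have hs := hA.skew ⟨α, hX⟩
  have e1 := hA.cocycle_mf hX hX₀ u
  have e2 := hA.cocycle_mf hX hX₀ w
  rw [h3, h1] at e1
  rw [h4, h2] at e2
  simp only [map_smul, smul_eq_mul] at e1 e2
  constructor
  · rw [map_add, LinearMap.add_apply, hs, h3, map_smul, hy, smul_eq_mul]
    field_simp
    linarith
  · rw [map_add, LinearMap.add_apply, hs, h4, map_smul, hx, smul_eq_mul]
    field_simp
    linarith

theorem exists_origin {G : Matrix (Fin (p + 1)) (Fin (p + 1)) ℝ} (hG : Isom G)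
    (val : ℕ → ℝ) : ∃ o, ∀ j ≤ p, mf p o (G *ᵥ ev p j) = val j := by
  refine ⟨G *ᵥ fun i => gDiag i * val i, fun j hj => ?_⟩
  rw [hG]
  have := mf_ev p (fun i : Fin (p + 1) => gDiag i * val i) ⟨j, by omega⟩
  simp only at this
  rw [this, ← mul_assoc, gDiag_mul_self, one_mul]

/-- A family of planes and lines together with a suitable frame of its complement determines a
conjugacy to a standard subalgebra. -/
theorem IsMASA.conj_of_frame {A : LieSubalgebra ℝ (Mat p)} (hA : IsMASA p A) {l m : ℕ}
    {U W : Fin l → V p} {s : Fin m → V p} (h : Family (linParts A) l m U W s) (B : Block)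
    (c : Fin (B.k + 1) → V p) (hcm : ∀ i, c i ∈ famCompl U W s)
    (hc : ∀ i j, mf p (c i) (c j) = if i = j then gDiag i else 0)
    (hcompl : ∀ v ∈ famCompl U W s, (∀ i, mf p v (c i) = 0) → v = 0)
    (val : Fin (B.k + 1) → ℝ)
    (hgen : ∀ G o, B.k ≤ p → Isom G → (∀ i : Fin (B.k + 1), G *ᵥ ev p i = c i) →
      (∀ i, mf p o (c i) = val i) → ∀ g ∈ B.gens p, grp G o * g * (grp G o)⁻¹ ∈ A) :
    p = B.k + 2 * l + m ∧ Conj (eGroup p) (std p B l m) A := by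
  obtain ⟨hp, G, hG, hGc, hGU, hGW, hGs⟩ := exists_isom_of_frame c U W s hc h.UU h.WW h.ss h.UW
    h.Us h.Ws (fun i => (hcm i).1) (fun i => (hcm i).2.1) (fun i => (hcm i).2.2)
    fun v h1 h2 h3 h4 => hcompl v ⟨h2, h3, h4⟩ h1
  choose x y hxy using fun i => hA.exists_origin_plane (h.planes i).1
    (h.planes i).2
  -- The parity and the half of the offset j - k - 1 tell which vector of which plane has index j.
  -- The value 0 along the lines is arbitrary, since the linear parts annihilate them.
  obtain ⟨o, ho⟩ := exists_origin hG fun j =>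
    if hj : j < B.k + 1 then val ⟨j, hj⟩ else
      if hj' : (j - B.k - 1) / 2 < l then
        if (j - B.k - 1) % 2 = 0 then x ⟨_, hj'⟩ else y ⟨_, hj'⟩ else 0
  have hov : ∀ i, mf p o (c i) = val i := fun i => by
    rw [← hGc, ho _ (by omega), dif_pos i.2]
  have hox : ∀ i, mf p o (U i) = x i := fun i => by
    have hd : (B.k + 2 * (i : ℕ) + 1 - B.k - 1) / 2 = i := by omega
    have hm : (B.k + 2 * (i : ℕ) + 1 - B.k - 1) % 2 = 0 := by omega
    rw [← hGU, ho _ (by omega), dif_neg (by omega), dif_pos (by omega), if_pos hm]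
    congr 1
    exact Fin.ext hd
  have hoy : ∀ i, mf p o (W i) = y i := fun i => by
    have hd : (B.k + 2 * (i : ℕ) + 2 - B.k - 1) / 2 = i := by omega
    have hm : (B.k + 2 * (i : ℕ) + 2 - B.k - 1) % 2 ≠ 0 := by omega
    rw [← hGW, ho _ (by omega), dif_neg (by omega), dif_pos (by omega), if_neg hm]
    congr 1
    exact Fin.ext hd
  refine ⟨hp, conj_of_gens hp hA.1 hA.2.1 (mem_eGroup_iff.mpr ⟨G, o, hG, rfl⟩) ?_⟩
  refine forall_stdGens.mpr ⟨hgen G o (by omega) hG hGc hov, fun i => ?_, fun i => ?_⟩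
  · rw [conj_aff_wedge hG, hGU, hGW, Matrix.mulVec_zero]
    refine hA.mem (skew_wedge _ _) fun X α hX => ⟨?_, ?_⟩
    · obtain ⟨θ, h1, h2⟩ := (h.planes i).1 X ⟨α, hX⟩
      rw [(hA.skew ⟨α, hX⟩).comm_wedge, h1, h2, wedge_smul_left, wedge_smul_right, wedge_self,
        wedge_self, smul_zero, smul_zero, add_zero]
    · obtain ⟨h1, h2⟩ := hxy i o (hox i) (hoy i) X α hX
      rw [wedge_mulVec, mf_comm, h2, mf_comm, h1]
      simp
  · rw [conj_translation hG, hGs]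
    exact hA.translation_mem fun X hX => h.lines X hX i

/-- A frame with null vectors `e`, `f` and transverse vectors `x`. -/
noncomputable def nullFrame {d : ℕ} (e f : V p) (x : Fin d → V p) : Fin (d + 2) → V p :=
  Fin.cons ((1 / 2 : ℝ) • (e + f)) (Fin.cons ((1 / 2 : ℝ) • (f - e)) x)

/-- A frame of a subspace consisting of null vectors `e`, `f` and transverse vectors `x`. -/
structure IsNullFrame (M : Submodule ℝ (V p)) {d : ℕ} (e f : V p) (x : Fin d → V p) : Prop where
  e_mem : e ∈ M
  f_mem : f ∈ M
  x_mem : ∀ i, x i ∈ M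
  ee : mf p e e = 0
  ff : mf p f f = 0
  ef : mf p e f = -2
  xe : ∀ i, mf p (x i) e = 0
  xf : ∀ i, mf p (x i) f = 0
  xx : ∀ i j, mf p (x i) (x j) = if i = j then 1 else 0
  complete : ∀ v ∈ M, mf p v e = 0 → mf p v f = 0 → (∀ i, mf p v (x i) = 0) → v = 0

namespace IsNullFrame

variable {M : Submodule ℝ (V p)} {d : ℕ} {e f : V p} {x : Fin d → V p}

theorem fe (h : IsNullFrame M e f x) : mf p f e = -2 := by rw [mf_comm, h.ef]

theorem frame_mem (h : IsNullFrame M e f x) (i) : nullFrame e f x i ∈ M := by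
  refine Fin.cases ?_ (fun i => Fin.cases ?_ (fun i => ?_) i) i
  · exact M.smul_mem _ (M.add_mem h.e_mem h.f_mem)
  · exact M.smul_mem _ (M.sub_mem h.f_mem h.e_mem)
  · exact h.x_mem i

theorem gram (h : IsNullFrame M e f x) (i j) :
    mf p (nullFrame e f x i) (nullFrame e f x j) = if i = j then gDiag i else 0 := by
  revert i j
  simp only [Fin.forall_fin_succ, nullFrame, Fin.cons_zero, Fin.cons_succ, map_smul, map_add,
    map_sub, LinearMap.smul_apply, LinearMap.add_apply, LinearMap.sub_apply, h.ee, h.ff, h.ef,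
    h.fe, h.xe, h.xf, h.xx, mf_comm p _ (x _), Fin.val_succ, gDiag_succ, Fin.succ_inj,
    Fin.succ_ne_zero, (Fin.succ_ne_zero _).symm]
  simp [gDiag]
  norm_num
  exact fun i j => if_congr eq_comm rfl rfl

theorem frame_complete (h : IsNullFrame M e f x) (v : V p) (hv : v ∈ M)
    (hv' : ∀ i, mf p v (nullFrame e f x i) = 0) : v = 0 := by
  simp only [Fin.forall_fin_succ, nullFrame, Fin.cons_zero, Fin.cons_succ, map_smul, map_add,
    map_sub, smul_eq_mul] at hv'
  exact h.complete v hv (by linarith [hv'.1, hv'.2.1]) (by linarith [hv'.1, hv'.2.1]) hv'.2.2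

theorem e_eq (e f : V p) (x : Fin d → V p) :
    nullFrame e f x 0 - nullFrame e f x 1 = e := by
  change (1 / 2 : ℝ) • (e + f) - (1 / 2 : ℝ) • (f - e) = e
  module

theorem f_eq (e f : V p) (x : Fin d → V p) :
    nullFrame e f x 0 + nullFrame e f x 1 = f := by
  change (1 / 2 : ℝ) • (e + f) + (1 / 2 : ℝ) • (f - e) = f
  module

theorem scale (h : IsNullFrame M e f x) {c : ℝ} (hc : c ≠ 0) :
    IsNullFrame M (c • e) (c⁻¹ • f) x where
  e_mem := M.smul_mem _ h.e_mem
  f_mem := M.smul_mem _ h.f_mem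
  x_mem := h.x_mem
  ee := by simp [h.ee]
  ff := by simp [h.ff]
  ef := by simp [h.ef, hc]
  xe i := by simp [h.xe]
  xf i := by simp [h.xf]
  xx := h.xx
  complete v hv h1 h2 h3 := by
    rw [map_smul, smul_eq_mul] at h1 h2
    exact h.complete v hv ((mul_eq_zero.mp h1).resolve_left hc)
      ((mul_eq_zero.mp h2).resolve_left (inv_ne_zero hc)) h3

/-- Vectors orthogonal to `e` and `f` are combinations of the transverse vectors. -/
theorem eq_sum (h : IsNullFrame M e f x) {v : V p} (hv : v ∈ M) (he : mf p v e = 0)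
    (hf : mf p v f = 0) : v = ∑ i, mf p v (x i) • x i := by
  refine sub_eq_zero.mp (h.complete _ (M.sub_mem hv (sum_mem fun i _ => M.smul_mem _ (h.x_mem i)))
    ?_ ?_ fun j => ?_)
  · simp [he, h.xe]
  · simp [hf, h.xf]
  · simp [h.xx]

theorem rotate (h : IsNullFrame M e f x) {O : Matrix (Fin d) (Fin d) ℝ} (hO : Oᵀ * O = 1) :
    IsNullFrame M e f fun j => ∑ i, O i j • x i where
  e_mem := h.e_mem
  f_mem := h.f_mem
  x_mem j := sum_mem fun i _ => M.smul_mem _ (h.x_mem i)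
  ee := h.ee
  ff := h.ff
  ef := h.ef
  xe j := by simp [h.xe]
  xf j := by simp [h.xf]
  xx i j := by
    have := congrFun (congrFun hO i) j
    rw [Matrix.mul_apply, Matrix.one_apply] at this
    rw [← this]
    simp [h.xx, mul_comm]
  complete v hv h1 h2 h3 := by
    refine h.complete v hv h1 h2 fun i => ?_
    have hO' : O * Oᵀ = 1 := mul_eq_one_comm.mp hO
    have h4 : ∀ j, ∑ k, O k j * mf p v (x k) = 0 := fun j => by simpa using h3 j
    have h5 : Oᵀ *ᵥ (fun k => mf p v (x k)) = 0 := by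
      ext j
      simpa [Matrix.mulVec, dotProduct] using h4 j
    have h6 := congrArg (fun w => O *ᵥ w) h5
    simp only [Matrix.mulVec_mulVec, hO', Matrix.one_mulVec, Matrix.mulVec_zero] at h6
    exact congrFun h6 i

end IsNullFrame

/-- A subspace on which the Lorentz form is positive definite has an orthonormal basis. -/
theorem exists_orthonormal (M : Submodule ℝ (V p)) (hM : ∀ v ∈ M, mf p v v ≤ 0 → v = 0) :
    ∃ (d : ℕ) (x : Fin d → V p), (∀ i, x i ∈ M) ∧
      (∀ i j, mf p (x i) (x j) = if i = j then 1 else 0) ∧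
      ∀ v ∈ M, (∀ i, mf p v (x i) = 0) → v = 0 := by
  by_contra! hno
  have key : ∀ d : ℕ, ∃ x : Fin d → V p, (∀ i, x i ∈ M) ∧
      ∀ i j, mf p (x i) (x j) = if i = j then 1 else 0 := by
    intro d
    induction d with
    | zero => exact ⟨Fin.elim0, fun i => i.elim0, fun i => i.elim0⟩
    | succ d ih =>
      obtain ⟨x, hx, hxx⟩ := ih
      obtain ⟨v, hv, hvx, hv0⟩ := hno d x hx hxx
      have hpos : 0 < mf p v v := by
        by_contra! h
        exact hv0 (hM v hv h)
      have hr0 : √(mf p v v) ≠ 0 := (Real.sqrt_pos.mpr hpos).ne'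
      have hrt : √(mf p v v) * √(mf p v v) = mf p v v := Real.mul_self_sqrt hpos.le
      have h1 : (√(mf p v v))⁻¹ * ((√(mf p v v))⁻¹ * mf p v v) = 1 := by
        nth_rewrite 3 [← hrt]
        field_simp
      refine ⟨Fin.cons ((√(mf p v v))⁻¹ • v) x, ?_, ?_⟩
      · simp only [Fin.forall_fin_succ, Fin.cons_zero, Fin.cons_succ]
        exact ⟨M.smul_mem _ hv, hx⟩
      · simp only [Fin.forall_fin_succ, Fin.cons_zero, Fin.cons_succ, mf_comm p _ (_ • v),
          map_smul, LinearMap.smul_apply, smul_eq_mul, h1, hvx, hxx, Fin.succ_inj,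
          Fin.succ_ne_zero, (Fin.succ_ne_zero _).symm]
        simp
  obtain ⟨x, -, hxx⟩ := key (p + 2)
  have := card_le_of_dual x x hxx
  simp at this

end NormalForm

end MinkMASA
namespace MinkMASA

/-! ### Timelike, boosted and nilpotent complements -/

section Cases

variable {p : ℕ} {A : LieSubalgebra ℝ (Mat p)} {l m : ℕ} {U W : Fin l → V p} {s : Fin m → V p}

/-- Normal form in the presence of a fixed timelike vector. -/
theorem IsMASA.conj_time (hA : IsMASA p A) (h : MaxFamily (linParts A) l m U W s) {t : V p}
    (ht : t ∈ famCompl U W s) (htt : mf p t t < 0) (hX : ∀ X ∈ linParts A, X *ᵥ t = 0) :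
    p = Block.time.k + 2 * l + m ∧ Conj (eGroup p) (std p .time l m) A := by
  have hr0 : √(-mf p t t) ≠ 0 := (Real.sqrt_pos.mpr (by linarith)).ne'
  have hrt : √(-mf p t t) * √(-mf p t t) = -mf p t t := Real.mul_self_sqrt (by linarith)
  set r := √(-mf p t t) with hr
  have ht0 : t ≠ 0 := by
    rintro rfl
    simp at htt
  -- The orthogonal complement of t in M is invariant. If nonzero, it would contain an eigenvector
  -- that is not spacelike, necessarily a multiple of t. Hence M is the line of t.
  have hM : ∀ v ∈ famCompl U W s, mf p v t = 0 → v = 0 := by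
    by_contra! hno
    obtain ⟨v₀, hv₀, hv₀t, hv₀0⟩ := hno
    obtain ⟨x, hx, hx0, hxx, -⟩ := h.exists_eigenvector (fun X => hA.skew)
      (fun X hX Y => hA.comm hX) (M := famCompl U W s ⊓ LinearMap.ker ((mf p).flip t))
      ((Submodule.ne_bot_iff _).mpr ⟨v₀, ⟨hv₀, hv₀t⟩, hv₀0⟩) inf_le_left fun X hXX v hv => by
        refine ⟨h.mulVec_mem hXX (hA.skew hXX) hv.1, ?_⟩
        change mf p (X *ᵥ v) t = 0
        rw [hA.skew hXX, hX X hXX, map_zero, neg_zero]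
    have hxt : mf p x t = 0 := hx.2
    obtain ⟨c, rfl⟩ := exists_smul_of_nonpos ht0 htt.le (by rw [mf_comm, hxt]) hxx
    rw [map_smul, LinearMap.smul_apply, smul_eq_mul] at hxt
    rcases mul_eq_zero.mp hxt with hc | hc
    · exact hx0 (by rw [hc, zero_smul])
    · exact htt.ne hc
  refine hA.conj_of_frame h.toFamily .time (fun _ => r⁻¹ • t)
    (fun _ => (famCompl U W s).smul_mem _ ht) ?_ ?_ (fun _ => 0) ?_
  · intro i j
    have hi : (i : ℕ) = 0 := by simpa [Block.k] using i.2
    have hj : (j : ℕ) = 0 := by simpa [Block.k] using j.2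
    rw [if_pos (Fin.ext (hi.trans hj.symm)), hi]
    simp only [map_smul, LinearMap.smul_apply, smul_eq_mul, gDiag, if_true]
    rw [← neg_neg (mf p t t), ← hrt]
    field_simp
  · intro v hv hv'
    have := hv' 0
    rw [map_smul, smul_eq_mul] at this
    exact hM v hv ((mul_eq_zero.mp this).resolve_left (inv_ne_zero hr0))
  · intro G o _ hG hGc _ g hg
    rw [time_gens, Set.mem_singleton_iff] at hg
    have h0 := hGc 0
    rw [Fin.val_zero] at h0
    rw [hg, conj_translation hG, h0]
    exact hA.translation_mem fun X hXX => by rw [Matrix.mulVec_smul, hX X hXX, smul_zero]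

/-- Normal form in the presence of a null eigenvector with nonzero eigenvalue. -/
theorem IsMASA.conj_boost (hA : IsMASA p A) (h : MaxFamily (linParts A) l m U W s) {e : V p}
    (he : e ∈ famCompl U W s) (he0 : e ≠ 0) (hee : mf p e e = 0)
    (hX : ∀ X ∈ linParts A, ∃ c : ℝ, X *ᵥ e = c • e) (hne : ∃ X ∈ linParts A, X *ᵥ e ≠ 0) :
    p = Block.boost.k + 2 * l + m ∧ Conj (eGroup p) (std p .boost l m) A := by
  obtain ⟨X₀, ⟨α₀, hX₀⟩, hX₀e⟩ := hne
  have hX₀' : X₀ ∈ linParts A := ⟨α₀, hX₀⟩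
  obtain ⟨c₀, hc₀⟩ := hX X₀ hX₀'
  have hc₀0 : c₀ ≠ 0 := by
    rintro rfl
    exact hX₀e (by rw [hc₀, zero_smul])
  have hs₀ := hA.skew hX₀'
  have hnull : ∀ v, mf p v v = 0 → mf p e v = 0 → ∃ c : ℝ, v = c • e := fun v hv hev =>
    exists_smul_of_nonpos he0 hee.le hev hv.le
  obtain ⟨t, ht, htt⟩ := h.exists_timelike
  have het : mf p e t ≠ 0 := by
    intro h0
    have ht0 : t ≠ 0 := by
      rintro rfl
      simp at htt
    obtain ⟨c, rfl⟩ := exists_smul_of_nonpos ht0 htt.le (by rw [mf_comm, h0]) hee.le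
    rw [map_smul, LinearMap.smul_apply, smul_eq_mul] at h0
    rcases mul_eq_zero.mp h0 with hc | hc
    · exact he0 (by rw [hc, zero_smul])
    · exact htt.ne hc
  -- Without such an f the map X₀ + c₀ is injective, hence surjective, on M. By skewness its image
  -- is orthogonal to e, whereas the timelike t is not.
  obtain ⟨f, hf, hf0, hX₀f⟩ : ∃ f ∈ famCompl U W s, f ≠ 0 ∧ X₀ *ᵥ f = -c₀ • f := by
    by_contra! hno
    let φ : famCompl U W s →ₗ[ℝ] famCompl U W s :=
      (Matrix.mulVecLin X₀ + c₀ • LinearMap.id).restrict fun v hv =>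
        (famCompl U W s).add_mem (h.mulVec_mem hX₀' hs₀ hv) ((famCompl U W s).smul_mem _ hv)
    have hφ : ∀ v, (φ v : V p) = X₀ *ᵥ v + c₀ • (v : V p) := fun v => rfl
    have hinj : Function.Injective φ := by
      rw [injective_iff_map_eq_zero]
      intro v hv
      by_contra hv0
      refine hno v v.2 (fun h => hv0 (Subtype.ext h)) ?_
      have := hφ v
      rw [hv, Submodule.coe_zero] at this
      rw [neg_smul]
      exact eq_neg_of_add_eq_zero_left this.symm
    obtain ⟨v, hv⟩ := LinearMap.surjective_of_injective hinj ⟨t, ht⟩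
    have h1 := hφ v
    rw [hv] at h1
    apply het
    change t = _ at h1
    rw [h1, map_add, mf_comm p e, hs₀, hc₀, map_smul, map_smul, mf_comm p e]
    simp
  have hff : mf p f f = 0 := by
    have := hs₀.mf_self f
    rw [hX₀f, map_smul, LinearMap.smul_apply, smul_eq_mul] at this
    exact (mul_eq_zero.mp this).resolve_left (neg_ne_zero.mpr hc₀0)
  have hef : mf p e f ≠ 0 := by
    intro h0
    obtain ⟨c, rfl⟩ := hnull f hff h0
    rw [Matrix.mulVec_smul, hc₀, smul_smul, smul_smul] at hX₀f
    have := smul_left_injective ℝ he0 hX₀f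
    have hc : c * c₀ = 0 := by linarith
    rcases mul_eq_zero.mp hc with hc | hc
    · exact hf0 (by rw [hc, zero_smul])
    · exact hc₀0 hc
  -- By commutation Xf is again an eigenvector of X₀ for -c₀, hence null. It is orthogonal to f by
  -- skewness, so it is a multiple of f, and the pairing with e gives the factor.
  have hXf : ∀ X ∈ linParts A, ∀ c : ℝ, X *ᵥ e = c • e → X *ᵥ f = -c • f := by
    intro X hXX c hc
    have hsX := hA.skew hXX
    have h1 : X₀ *ᵥ (X *ᵥ f) = -c₀ • (X *ᵥ f) := by
      rw [Matrix.mulVec_mulVec, hA.comm hX₀' hXX, ← Matrix.mulVec_mulVec, hX₀f,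
        Matrix.mulVec_smul]
    have h2 : mf p (X *ᵥ f) (X *ᵥ f) = 0 := by
      have := hs₀.mf_self (X *ᵥ f)
      rw [h1, map_smul, LinearMap.smul_apply, smul_eq_mul] at this
      exact (mul_eq_zero.mp this).resolve_left (neg_ne_zero.mpr hc₀0)
    obtain ⟨μ, hμ⟩ := exists_smul_of_nonpos hf0 hff.le
      (by rw [mf_comm, hsX.mf_self]) h2.le
    have h3 := hsX e f
    rw [hc, hμ, map_smul, LinearMap.smul_apply, map_smul, smul_eq_mul, smul_eq_mul] at h3
    have h4 : μ = -c := mul_right_cancel₀ hef (by linarith)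
    rw [hμ, h4]
  have hM : ∀ v ∈ famCompl U W s, mf p v e = 0 → mf p v f = 0 → v = 0 := by
    by_contra! hno
    obtain ⟨v₀, hv₀, hv₀e, hv₀f, hv₀0⟩ := hno
    obtain ⟨x, hx, hx0, hxx, -⟩ := h.exists_eigenvector (fun X => hA.skew)
      (fun X hX Y => hA.comm hX) (M := famCompl U W s ⊓ (LinearMap.ker ((mf p).flip e) ⊓
        LinearMap.ker ((mf p).flip f)))
      ((Submodule.ne_bot_iff _).mpr ⟨v₀, ⟨hv₀, hv₀e, hv₀f⟩, hv₀0⟩) inf_le_left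
      fun X hXX v hv => by
        obtain ⟨c, hc⟩ := hX X hXX
        have h1 : mf p v e = 0 := hv.2.1
        have h2 : mf p v f = 0 := hv.2.2
        refine ⟨h.mulVec_mem hXX (hA.skew hXX) hv.1, ?_, ?_⟩
        · change mf p (X *ᵥ v) e = 0
          rw [hA.skew hXX, hc, map_smul, h1, smul_zero, neg_zero]
        · change mf p (X *ᵥ v) f = 0
          rw [hA.skew hXX, hXf X hXX c hc, map_smul, h2, smul_zero, neg_zero]
    have hxe : mf p x e = 0 := hx.2.1
    have hxf : mf p x f = 0 := hx.2.2
    obtain ⟨c, rfl⟩ := exists_smul_of_nonpos he0 hee.le (by rw [mf_comm, hxe]) hxx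
    rw [map_smul, LinearMap.smul_apply, smul_eq_mul] at hxf
    rcases mul_eq_zero.mp hxf with hc | hc
    · exact hx0 (by rw [hc, zero_smul])
    · exact hef hc
  have hF : IsNullFrame (famCompl U W s) e ((-2 / mf p e f) • f) (Fin.elim0 : Fin 0 → V p) := by
    refine ⟨he, (famCompl U W s).smul_mem _ hf, fun i => i.elim0, hee, ?_, ?_, fun i => i.elim0,
      fun i => i.elim0, fun i => i.elim0, fun v hv h1 h2 _ => hM v hv h1 ?_⟩
    · simp [hff]
    · simp [hef]
    · rw [map_smul, smul_eq_mul] at h2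
      exact (mul_eq_zero.mp h2).resolve_left (div_ne_zero (by norm_num) hef)
  set f' := (-2 / mf p e f) • f with hf'
  set c : Fin (0 + 2) → V p := nullFrame e f' Fin.elim0 with hcdef
  have hc0 : c 0 = (1 / 2 : ℝ) • (e + f') := rfl
  have hc1 : c 1 = (1 / 2 : ℝ) • (f' - e) := rfl
  have hXc : ∀ X ∈ linParts A, ∀ μ : ℝ, X *ᵥ e = μ • e →
      X *ᵥ c 0 = -μ • c 1 ∧ X *ᵥ c 1 = -μ • c 0 := by
    intro X hXX μ hμ
    have : X *ᵥ f' = -μ • f' := by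
      rw [hf', Matrix.mulVec_smul, hXf X hXX μ hμ, smul_comm]
    rw [hc0, hc1]
    simp only [Matrix.mulVec_smul, Matrix.mulVec_add, Matrix.mulVec_sub, this, hμ]
    constructor <;> module
  -- The origin is chosen so that α₀ + X₀o is orthogonal to the boosted plane, using X₀c_0 = -c₀c_1
  -- and X₀c_1 = -c₀c_0.
  refine hA.conj_of_frame h.toFamily .boost c hF.frame_mem hF.gram hF.frame_complete
    (Fin.cons (-(mf p α₀ (c 1) / c₀)) fun _ => -(mf p α₀ (c 0) / c₀)) ?_
  intro G o hp hG hGc ho g hg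
  rw [boost_gens hp, Set.mem_singleton_iff] at hg
  have hG0 : G *ᵥ ev p 0 = c 0 := hGc 0
  have hG1 : G *ᵥ ev p 1 = c 1 := hGc 1
  have ho0 : mf p o (c 0) = -(mf p α₀ (c 1) / c₀) := ho 0
  have ho1 : mf p o (c 1) = -(mf p α₀ (c 0) / c₀) := ho 1
  rw [hg, conj_aff_wedge hG, hG0, hG1, Matrix.mulVec_zero]
  refine hA.mem (skew_wedge _ _) fun X α hXX => ?_
  obtain ⟨μ, hμ⟩ := hX X ⟨α, hXX⟩
  obtain ⟨h1, h2⟩ := hXc X ⟨α, hXX⟩ μ hμ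
  obtain ⟨h3, h4⟩ := hXc X₀ hX₀' c₀ hc₀
  have hsX := hA.skew ⟨α, hXX⟩
  have e0 := hA.cocycle_mf hXX hX₀ (c 0)
  have e1 := hA.cocycle_mf hXX hX₀ (c 1)
  rw [h1, h3, map_smul, map_smul, smul_eq_mul, smul_eq_mul] at e0
  rw [h2, h4, map_smul, map_smul, smul_eq_mul, smul_eq_mul] at e1
  constructor
  · rw [hsX.comm_wedge, h1, h2, wedge_smul_left, wedge_smul_right, wedge_self, wedge_self,
      smul_zero, add_zero]
  · have z0 : mf p (α + X *ᵥ o) (c 0) = 0 := by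
      rw [map_add, LinearMap.add_apply, hsX, h1, map_smul, ho1, smul_eq_mul]
      field_simp
      linarith
    have z1 : mf p (α + X *ᵥ o) (c 1) = 0 := by
      rw [map_add, LinearMap.add_apply, hsX, h2, map_smul, ho0, smul_eq_mul]
      field_simp
      linarith
    rw [wedge_mulVec, mf_comm, z1, mf_comm, z0]
    simp

/-- The structure of a maximal Abelian subalgebra on the complement of a maximal family, when all
linear parts are nilpotent there and the only fixed nonspacelike vectors are null. -/
structure NullData (A : LieSubalgebra ℝ (Mat p)) (M : Submodule ℝ (V p)) {d : ℕ} (e f : V p)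
    (x : Fin d → V p) : Prop extends IsNullFrame M e f x where
  Xe : ∀ X ∈ linParts A, X *ᵥ e = 0
  Xx : ∀ X ∈ linParts A, ∀ i, X *ᵥ x i = (1 / 2 * mf p (X *ᵥ f) (x i)) • e
  Xf : ∀ X ∈ linParts A, X *ᵥ f = ∑ i, mf p (X *ᵥ f) (x i) • x i
  surj : ∀ w : Fin d → ℝ, ∃ X ∈ linParts A, ∀ i, mf p (X *ᵥ f) (x i) = 2 * w i
  pos : 1 ≤ d

/-- The eigenvector supplied by maximality cannot be timelike, because skewness would make its
eigenvalues zero and `hT` excludes fixed timelike vectors. So it is null, and `hB` makes it fixed.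
-/
theorem IsMASA.exists_fixed_null (hA : IsMASA p A) (h : MaxFamily (linParts A) l m U W s)
    (hT : ∀ t ∈ famCompl U W s, mf p t t < 0 → ¬ ∀ X ∈ linParts A, X *ᵥ t = 0)
    (hB : ∀ e ∈ famCompl U W s, e ≠ 0 → mf p e e = 0 →
      (∀ X ∈ linParts A, ∃ c : ℝ, X *ᵥ e = c • e) → ∀ X ∈ linParts A, X *ᵥ e = 0)
    {M : Submodule ℝ (V p)} (hM : M ≠ ⊥) (hMle : M ≤ famCompl U W s)
    (hinv : ∀ X ∈ linParts A, ∀ v ∈ M, X *ᵥ v ∈ M) :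
    ∃ e ∈ M, e ≠ 0 ∧ mf p e e = 0 ∧ ∀ X ∈ linParts A, X *ᵥ e = 0 := by
  obtain ⟨e, he, he0, hee, hX⟩ := h.exists_eigenvector (fun X => hA.skew)
      (fun X hX Y => hA.comm hX) hM hMle hinv
  have hee' : mf p e e = 0 := by
    by_contra hne
    refine hT e (hMle he) (lt_of_le_of_ne hee hne) fun X hXX => ?_
    obtain ⟨c, hc⟩ := hX X hXX
    have := (hA.skew hXX).mf_self e
    rw [hc, map_smul, LinearMap.smul_apply, smul_eq_mul] at this
    rw [hc, (mul_eq_zero.mp this).resolve_right hne, zero_smul]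
  exact ⟨e, he, he0, hee', hB e (hMle he) he0 hee' hX⟩

/-- If the image of M under X^(p+1) were nonzero, it would be invariant and contain a nonzero fixed
vector X^(p+1)v. Then X^(p+2)v = 0, while the kernels of the powers are already stationary at p + 1.
-/
theorem IsMASA.nilpotent (hA : IsMASA p A) (h : MaxFamily (linParts A) l m U W s)
    (hT : ∀ t ∈ famCompl U W s, mf p t t < 0 → ¬ ∀ X ∈ linParts A, X *ᵥ t = 0)
    (hB : ∀ e ∈ famCompl U W s, e ≠ 0 → mf p e e = 0 →
      (∀ X ∈ linParts A, ∃ c : ℝ, X *ᵥ e = c • e) → ∀ X ∈ linParts A, X *ᵥ e = 0)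
    {X : Matrix (Fin (p + 1)) (Fin (p + 1)) ℝ} (hX : X ∈ linParts A) {v : V p}
    (hv : v ∈ famCompl U W s) : (Matrix.mulVecLin X ^ (p + 1)) v = 0 := by
  by_contra hne
  have hmem : ∀ n, ∀ v ∈ famCompl U W s, (Matrix.mulVecLin X ^ n) v ∈ famCompl U W s := by
    intro n
    induction n with
    | zero => exact fun v hv => hv
    | succ n ih =>
      intro v hv
      rw [pow_succ, Module.End.mul_apply]
      exact ih _ (h.mulVec_mem hX (hA.skew hX) hv)
  obtain ⟨_, ⟨v, hv, rfl⟩, he0, -, hXe⟩ := hA.exists_fixed_null h hT hB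
    (M := (famCompl U W s).map (Matrix.mulVecLin X ^ (p + 1)))
    ((Submodule.ne_bot_iff _).mpr ⟨_, ⟨v, hv, rfl⟩, hne⟩)
    (by rintro _ ⟨v, hv, rfl⟩; exact hmem _ v hv) (by
      rintro Y hY _ ⟨v, hv, rfl⟩
      refine ⟨Y *ᵥ v, h.mulVec_mem hY (hA.skew hY) hv, ?_⟩
      have : Commute (Matrix.mulVecLin X) (Matrix.mulVecLin Y) := by
        refine LinearMap.ext fun z => ?_
        simp [Matrix.mulVec_mulVec, hA.comm hX hY]
      exact congrArg (fun φ : Module.End ℝ (V p) => φ v) (this.pow_left (p + 1)).eq)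
  apply he0
  have hk : v ∈ LinearMap.ker (Matrix.mulVecLin X ^ (p + 2)) := by
    rw [LinearMap.mem_ker, pow_succ', Module.End.mul_apply]
    exact hXe X hX
  have hfr : Module.finrank ℝ (Fin (p + 1) → ℝ) = p + 1 := by
    rw [Module.finrank_fintype_fun_eq_card, Fintype.card_fin]
  rw [Module.End.ker_pow_eq_ker_pow_finrank_of_le (hfr.le.trans (Nat.le_succ _)), hfr] at hk
  exact hk

/-- Nilpotency forces every X to send the part of M orthogonal to the fixed null vector e into the
line of e. Completing e by a null f and an orthonormal transverse basis, skewness then expresses X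
on M through Xf alone. Maximality of the family supplies surjectivity and a transverse direction. -/
theorem IsMASA.exists_nullData (hA : IsMASA p A) (h : MaxFamily (linParts A) l m U W s)
    (hT : ∀ t ∈ famCompl U W s, mf p t t < 0 → ¬ ∀ X ∈ linParts A, X *ᵥ t = 0)
    (hB : ∀ e ∈ famCompl U W s, e ≠ 0 → mf p e e = 0 →
      (∀ X ∈ linParts A, ∃ c : ℝ, X *ᵥ e = c • e) → ∀ X ∈ linParts A, X *ᵥ e = 0) :
    ∃ (d : ℕ) (e f : V p) (x : Fin d → V p), NullData A (famCompl U W s) e f x := by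
  obtain ⟨t, ht, htt⟩ := h.exists_timelike
  have ht0 : t ≠ 0 := by
    rintro rfl
    simp at htt
  obtain ⟨e, he, he0, hee, hXe⟩ := hA.exists_fixed_null h hT hB
    ((Submodule.ne_bot_iff _).mpr ⟨t, ht, ht0⟩) le_rfl fun X hX v hv =>
      h.mulVec_mem hX (hA.skew hX) hv
  have het : mf p e t ≠ 0 := by
    intro h0
    obtain ⟨c, rfl⟩ := exists_smul_of_nonpos ht0 htt.le (by rw [mf_comm, h0]) hee.le
    rw [map_smul, LinearMap.smul_apply, smul_eq_mul] at h0
    rcases mul_eq_zero.mp h0 with hc | hc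
    · exact he0 (by rw [hc, zero_smul])
    · exact htt.ne hc
  have hXu : ∀ X ∈ linParts A, ∀ u ∈ famCompl U W s, mf p e u = 0 → ∃ c : ℝ, X *ᵥ u = c • e := by
    intro X hX u hu heu
    have hs := hA.skew hX
    have hort : ∀ n, ∀ v ∈ famCompl U W s, mf p e v = 0 →
        (Matrix.mulVecLin X ^ n) v ∈ famCompl U W s ∧ mf p e ((Matrix.mulVecLin X ^ n) v) = 0 := by
      intro n
      induction n with
      | zero => exact fun v hv hev => ⟨hv, hev⟩
      | succ n ih =>
        intro v hv hev
        rw [pow_succ, Module.End.mul_apply]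
        refine ih _ (h.mulVec_mem hX hs hv) ?_
        change mf p e (X *ᵥ v) = 0
        rw [mf_comm, hs, mf_comm, hXe X hX]
        simp
    have key : ∀ n, (∃ c : ℝ, (Matrix.mulVecLin X ^ (n + 1)) u = c • e) →
        ∃ c : ℝ, X *ᵥ u = c • e := by
      intro n
      induction n with
      | zero =>
        rw [zero_add, pow_one]
        exact id
      | succ n ih =>
        rintro ⟨c, hc⟩
        apply ih
        -- If X^(n+2)u = ce, then X^(n+1)u has square -c⟨X^n u, e⟩ = 0. Being also orthogonal to e,
        -- it is a multiple of e, so the exponent can be lowered.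
        obtain ⟨hw, hew⟩ := hort n u hu heu
        obtain ⟨hw', hew'⟩ := hort (n + 1) u hu heu
        refine exists_smul_of_nonpos he0 hee.le hew' ?_
        rw [pow_succ', Module.End.mul_apply] at hc ⊢
        change X *ᵥ _ = _ at hc
        change mf p (X *ᵥ _) _ ≤ 0
        rw [hs]
        change -mf p _ (X *ᵥ _) ≤ 0
        have hz : X *ᵥ (X *ᵥ (Matrix.mulVecLin X ^ n) u) = c • e := by
          rw [pow_succ', Module.End.mul_apply] at hc
          exact hc
        rw [Matrix.mulVecLin_apply, hz, map_smul, mf_comm, hew]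
        simp
    exact key p ⟨0, by rw [hA.nilpotent h hT hB hX hu, zero_smul]⟩
  obtain ⟨f, hf, hff, hef⟩ : ∃ f ∈ famCompl U W s, mf p f f = 0 ∧ mf p e f = -2 := by
    -- Subtracting a multiple of e makes t null; the outer factor normalizes the pairing with e to
    -- -2.
    refine ⟨(-2 / mf p e t) • (t - (mf p t t / (2 * mf p e t)) • e),
      (famCompl U W s).smul_mem _ ((famCompl U W s).sub_mem ht ((famCompl U W s).smul_mem _ he)),
      ?_, ?_⟩
    · simp only [map_smul, map_sub, LinearMap.smul_apply, LinearMap.sub_apply, hee,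
        mf_comm p t e, smul_eq_mul]
      field_simp
      ring
    · simp only [map_smul, map_sub, hee, smul_eq_mul]
      field_simp
      ring
  have hfe : mf p f e = -2 := by rw [mf_comm, hef]
  obtain ⟨d, x, hx, hxx, hxc⟩ := exists_orthonormal (famCompl U W s ⊓
    (LinearMap.ker ((mf p).flip e) ⊓ LinearMap.ker ((mf p).flip f))) (by
      rintro v ⟨hv, hve, hvf⟩ hvv
      change mf p v e = 0 at hve
      change mf p v f = 0 at hvf
      obtain ⟨c, rfl⟩ := exists_smul_of_nonpos he0 hee.le (by rw [mf_comm, hve]) hvv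
      rw [map_smul, LinearMap.smul_apply, hef, smul_eq_mul] at hvf
      have hc : c = 0 := by linarith
      rw [hc, zero_smul])
  have hxe : ∀ i, mf p (x i) e = 0 := fun i => (hx i).2.1
  have hxf : ∀ i, mf p (x i) f = 0 := fun i => (hx i).2.2
  have hF : IsNullFrame (famCompl U W s) e f x :=
    ⟨he, hf, fun i => (hx i).1, hee, hff, hef, hxe, hxf, hxx, fun v hv h1 h2 h3 =>
      hxc v ⟨hv, h1, h2⟩ h3⟩
  have hXx : ∀ X ∈ linParts A, ∀ u ∈ famCompl U W s, mf p u e = 0 →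
      X *ᵥ u = (1 / 2 * mf p (X *ᵥ f) u) • e := by
    intro X hX u hu hue
    obtain ⟨c, hc⟩ := hXu X hX u hu (by rw [mf_comm, hue])
    rw [hA.skew hX, hc, map_smul, hfe, smul_eq_mul]
    congr 1
    ring
  have hXf : ∀ X ∈ linParts A, X *ᵥ f = ∑ i, mf p (X *ᵥ f) (x i) • x i := by
    intro X hX
    refine hF.eq_sum (h.mulVec_mem hX (hA.skew hX) hf) ?_ ((hA.skew hX).mf_self f)
    rw [hA.skew hX, hXe X hX, map_zero, neg_zero]
  have hfix : ∀ u ∈ famCompl U W s, 0 < mf p u u → ¬ ∀ X ∈ linParts A, X *ᵥ u = 0 := by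
    intro u hu huu hX
    have hr0 : √(mf p u u) ≠ 0 := (Real.sqrt_pos.mpr huu).ne'
    have hrt : √(mf p u u) * √(mf p u u) = mf p u u := Real.mul_self_sqrt huu.le
    refine h.no_line ((√(mf p u u))⁻¹ • u) ((famCompl U W s).smul_mem _ hu) ?_ fun X hXX => by
      rw [Matrix.mulVec_smul, hX X hXX, smul_zero]
    simp only [map_smul, LinearMap.smul_apply, smul_eq_mul]
    nth_rewrite 3 [← hrt]
    field_simp
  refine ⟨d, e, f, x, hF, hXe, fun X hX i => hXx X hX _ (hx i).1 (hxe i), hXf, ?_, ?_⟩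
  -- If not all transverse vectors occurred, a nonzero functional vanishing on those that do would
  -- be represented by a transverse vector u with ⟨Xf, u⟩ = 0 for all X. Then Xu = 0, and u is a
  -- fixed spacelike direction excluded by maximality.
  · let Q : Submodule ℝ (Fin d → ℝ) :=
      { carrier := {w | ∃ X ∈ linParts A, ∀ i, mf p (X *ᵥ f) (x i) = 2 * w i}
        add_mem' := by
          rintro w w' ⟨X, ⟨α, hX⟩, h1⟩ ⟨X', ⟨α', hX'⟩, h2⟩
          refine ⟨X + X', ⟨α + α', ?_⟩, fun i => ?_⟩
          · rw [← aff_add]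
            exact add_mem hX hX'
          · rw [Matrix.add_mulVec, map_add, LinearMap.add_apply, h1, h2, Pi.add_apply]
            ring
        zero_mem' := ⟨0, ⟨0, by rw [aff_zero]; exact A.zero_mem⟩, by simp⟩
        smul_mem' := by
          rintro c w ⟨X, ⟨α, hX⟩, h1⟩
          refine ⟨c • X, ⟨c • α, ?_⟩, fun i => ?_⟩
          · rw [← aff_smul]
            exact SMulMemClass.smul_mem c hX
          · rw [Matrix.smul_mulVec, map_smul, LinearMap.smul_apply, h1, Pi.smul_apply,
              smul_eq_mul, smul_eq_mul]
            ring }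
    have hQ : Q = ⊤ := by
      by_contra hne
      obtain ⟨φ, hφ0, hφ⟩ := Submodule.exists_le_ker_of_lt_top Q (lt_top_iff_ne_top.mpr hne)
      set u := ∑ i, φ (Pi.single i 1) • x i with hu
      have hum : u ∈ famCompl U W s := sum_mem fun i _ =>
        (famCompl U W s).smul_mem _ (hx i).1
      have hux : ∀ i, mf p u (x i) = φ (Pi.single i 1) := fun i => by simp [hu, hxx]
      have hue : mf p u e = 0 := by simp [hu, hxe]
      have huu : mf p u u = ∑ i, φ (Pi.single i 1) * φ (Pi.single i 1) := by
        conv_lhs => rw [hu, ← hu]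
        rw [map_sum]
        exact Finset.sum_congr rfl fun i _ => by rw [map_smul, hux, smul_eq_mul]
      have hpos : 0 < mf p u u := by
        refine lt_of_le_of_ne (by rw [huu]; exact Finset.sum_nonneg fun i _ => mul_self_nonneg _)
          fun h0 => hφ0 ?_
        rw [huu, eq_comm, Finset.sum_eq_zero_iff_of_nonneg fun i _ => mul_self_nonneg _] at h0
        refine LinearMap.pi_ext' fun i => LinearMap.ext_ring ?_
        simpa using h0 i (Finset.mem_univ i)
      refine hfix u hum hpos fun X hX => ?_
      have h1 : (fun i => 1 / 2 * mf p (X *ᵥ f) (x i)) ∈ Q := ⟨X, hX, fun i => by ring⟩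
      have h2 := hφ h1
      rw [LinearMap.mem_ker, LinearMap.pi_apply_eq_sum_univ φ] at h2
      have h3 : mf p (X *ᵥ f) u = 0 := by
        rw [hu, map_sum]
        have h4 : ∀ i : Fin d, (fun j => if i = j then (1 : ℝ) else 0) = Pi.single i 1 := fun i => by
          ext j
          rw [Pi.single_apply]
          exact if_congr eq_comm rfl rfl
        simp only [h4, smul_eq_mul] at h2
        simp only [map_smul, smul_eq_mul]
        have h5 : ∑ i, φ (Pi.single i 1) * mf p (X *ᵥ f) (x i) =
            2 * ∑ i, 1 / 2 * mf p (X *ᵥ f) (x i) * φ (Pi.single i 1) := by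
          rw [Finset.mul_sum]
          exact Finset.sum_congr rfl fun i _ => by ring
        rw [h5, h2, mul_zero]
      rw [hXx X hX u hum hue, h3, mul_zero, zero_smul]
    intro w
    have : w ∈ Q := hQ ▸ Submodule.mem_top
    exact this
  · by_contra! hd
    obtain rfl : d = 0 := by omega
    -- Without transverse directions f is fixed too, and f - e is a fixed vector of square 4.
    refine hfix (f - e) ((famCompl U W s).sub_mem hf he) ?_ fun X hX => ?_
    · simp only [map_sub, LinearMap.sub_apply, hff, hee, hef, hfe]
      norm_num
    · rw [Matrix.mulVec_sub, hXe X hX, hXf X hX]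
      simp

end Cases

end MinkMASA
namespace MinkMASA

/-! ### Normalizing the constants of the null blocks -/

section NullCase

variable {p : ℕ} {A : LieSubalgebra ℝ (Mat p)} {l m : ℕ} {U W : Fin l → V p} {s : Fin m → V p}

/-- Replacing e by ce multiplies the surviving constant by a positive square, so its size can be
normalized but its sign remains. -/
theorem exists_sign_scale (r : ℝ) : ∃ (c : ℝ) (κ : SignType), c ≠ 0 ∧ -(c * c * r) = 2 * (κ : ℝ) := by
  rcases lt_trichotomy r 0 with h | rfl | h
  · refine ⟨√(2 / -r), 1, (Real.sqrt_pos.mpr (div_pos two_pos (neg_pos.mpr h))).ne', ?_⟩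
    rw [Real.mul_self_sqrt (div_nonneg zero_le_two (neg_pos.mpr h).le)]
    have := h.ne
    simp only [SignType.coe_one]
    field_simp
  · exact ⟨1, 0, one_ne_zero, by simp⟩
  · refine ⟨√(2 / r), -1, (Real.sqrt_pos.mpr (div_pos two_pos h)).ne', ?_⟩
    rw [Real.mul_self_sqrt (div_nonneg zero_le_two h.le)]
    have := h.ne'
    simp only [SignType.coe_neg_one]
    field_simp

/-- Constants can be normalized by a permutation, a shift, and a scaling. -/
theorem exists_normalized {n : ℕ} (r : Fin (n + 2) → ℝ) :
    ∃ (σ : Equiv.Perm (Fin (n + 2))) (c τ : ℝ), c ≠ 0 ∧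
      (Block.multi n fun j => c * (r (σ j) - τ)).Normalized := by
  -- The mean is the shift that makes the sum of the constants vanish.
  set τ : ℝ := (∑ i, r i) / (n + 2) with hτ
  have hsum : ∑ i, (r i - τ) = 0 := by
    rw [Finset.sum_sub_distrib, Finset.sum_const, Finset.card_univ, Fintype.card_fin, hτ,
      nsmul_eq_mul]
    push_cast
    have : (n : ℝ) + 2 ≠ 0 := by positivity
    field_simp
    ring
  set σ := Tuple.sort fun i => -|r i - τ| with hσ
  have hmono : ∀ i j, i ≤ j → |r (σ j) - τ| ≤ |r (σ i) - τ| := fun i j hij => by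
    have := Tuple.monotone_sort (fun i => -|r i - τ|) hij
    simp only [Function.comp_apply] at this
    linarith
  by_cases h0 : r (σ 0) - τ = 0
  · refine ⟨σ, 1, τ, one_ne_zero, Or.inr fun i => ?_⟩
    have := hmono 0 i (Fin.zero_le _)
    rw [h0, abs_zero] at this
    simpa using abs_nonpos_iff.mp this
  · refine ⟨σ, (r (σ 0) - τ)⁻¹, τ, inv_ne_zero h0, Or.inl ⟨inv_mul_cancel₀ h0, ?_, ?_⟩⟩
    · intro i j hij
      rw [abs_mul, abs_mul]
      exact mul_le_mul_of_nonneg_left (hmono i j hij) (abs_nonneg _)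
    · rw [← Finset.mul_sum, Equiv.sum_comp σ (fun i => r i - τ), hsum, mul_zero]

theorem exists_diagonalization {d : ℕ} (M : Matrix (Fin d) (Fin d) ℝ) (hM : Mᵀ = M) :
    ∃ (O : Matrix (Fin d) (Fin d) ℝ) (r : Fin d → ℝ), Oᵀ * O = 1 ∧
      Oᵀ * M * O = Matrix.diagonal r := by
  have hH : M.IsHermitian := by rwa [Matrix.IsHermitian, Matrix.conjTranspose_eq_transpose_of_trivial]
  have h1 : (hH.eigenvectorUnitary : Matrix (Fin d) (Fin d) ℝ)ᵀ *
      (hH.eigenvectorUnitary : Matrix (Fin d) (Fin d) ℝ) = 1 := by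
    have := Unitary.coe_star_mul_self hH.eigenvectorUnitary
    rwa [Matrix.star_eq_conjTranspose, Matrix.conjTranspose_eq_transpose_of_trivial] at this
  refine ⟨hH.eigenvectorUnitary, hH.eigenvalues, h1, ?_⟩
  have h2 := hH.conjStarAlgAut_star_eigenvectorUnitary
  rw [Unitary.conjStarAlgAut_apply] at h2
  simpa [Matrix.star_eq_conjTranspose, Matrix.conjTranspose_eq_transpose_of_trivial] using h2

/-- The normal form in the case of a null direction, once the translation parts are
diagonalized. -/
theorem IsMASA.conj_null_of_frame (hA : IsMASA p A) (h : Family (linParts A) l m U W s) {d : ℕ}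
    {e f : V p} {x : Fin d → V p} (hN : NullData A (famCompl U W s) e f x) (B : Block)
    (hk : B.k = d + 1) (τ : ℝ) (t : Fin d → V p) (t' : Fin d → V p)
    (hgens : B.k ≤ p → B.gens p = nullGens p d t)
    (ht : ∀ G, (∀ i : Fin (d + 2), G *ᵥ ev p i = nullFrame e f x i) → ∀ j, G *ᵥ t j = t' j)
    (hcomm : ∀ o, mf p o e = τ → ∀ X α, aff X α ∈ A → ∀ j,
      X *ᵥ t' j = wedge e (x j) *ᵥ (α + X *ᵥ o)) :
    p = B.k + 2 * l + m ∧ Conj (eGroup p) (std p B l m) A := by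
  have hd2 : B.k + 1 = d + 2 := by omega
  let c : Fin (B.k + 1) → V p := fun i => nullFrame e f x (finCongr hd2 i)
  -- Since e is the difference of the first two frame vectors, these values give ⟨o, e⟩ = τ; the
  -- other values of o do not matter for `hcomm`.
  refine hA.conj_of_frame h B c (fun i => hN.frame_mem _) (fun i j => ?_) (fun v hv hv' => ?_)
    (fun i => if (i : ℕ) = 0 then τ else 0) ?_
  · rw [hN.gram]
    simp
  · exact hN.frame_complete v hv fun i => by
      have := hv' ((finCongr hd2).symm i)
      simpa [c] using this
  · intro G o hkp hG hGc ho g hg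
    have hGc' : ∀ i : Fin (d + 2), G *ᵥ ev p i = nullFrame e f x i := fun i => by
      have := hGc ((finCongr hd2).symm i)
      simpa [c] using this
    have h0 : G *ᵥ ev p 0 = nullFrame e f x 0 := hGc' 0
    have h1 : G *ᵥ ev p 1 = nullFrame e f x 1 := hGc' 1
    have hGe : G *ᵥ nullE p = e := by
      rw [nullE, Matrix.mulVec_sub, h0, h1, IsNullFrame.e_eq]
    have hoe : mf p o e = τ := by
      have o0 := ho ((finCongr hd2).symm 0)
      have o1 := ho ((finCongr hd2).symm 1)
      simp only [c, Equiv.apply_symm_apply] at o0 o1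
      rw [← IsNullFrame.e_eq e f x, map_sub, o0, o1]
      simp
    revert g
    rw [hgens hkp, forall_nullGens]
    refine ⟨?_, fun j => ?_⟩
    · rw [conj_translation hG, hGe]
      exact hA.translation_mem fun X hX => hN.Xe X hX
    · have hx : G *ᵥ ev p (j + 2) = x j := hGc' j.succ.succ
      rw [conj_aff_wedge hG, hGe, hx, ht G hGc']
      refine hA.mem (skew_wedge _ _) fun X α hX => ⟨?_, hcomm o hoe X α hX j⟩
      rw [(hA.skew ⟨α, hX⟩).comm_wedge, hN.Xe X ⟨α, hX⟩, hN.Xx X ⟨α, hX⟩, wedge_smul_right,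
        wedge_self, smul_zero, add_zero]
      ext i j
      simp [wedge]

namespace NullData

variable {M : Submodule ℝ (V p)} {d : ℕ} {e f : V p} {x : Fin d → V p}

theorem scale (h : NullData A M e f x) {c : ℝ} (hc : c ≠ 0) :
    NullData A M (c • e) (c⁻¹ • f) x where
  toIsNullFrame := h.toIsNullFrame.scale hc
  Xe X hX := by rw [Matrix.mulVec_smul, h.Xe X hX, smul_zero]
  Xx X hX i := by
    rw [h.Xx X hX, Matrix.mulVec_smul, map_smul, LinearMap.smul_apply, smul_eq_mul, smul_smul]
    congr 1
    field_simp
  Xf X hX := by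
    rw [Matrix.mulVec_smul]
    conv_lhs => rw [h.Xf X hX]
    rw [Finset.smul_sum]
    simp only [map_smul, LinearMap.smul_apply, smul_smul, smul_eq_mul]
  surj w := by
    obtain ⟨X, hX, hXw⟩ := h.surj fun i => c * w i
    refine ⟨X, hX, fun i => ?_⟩
    rw [Matrix.mulVec_smul, map_smul, LinearMap.smul_apply, hXw, smul_eq_mul]
    field_simp
  pos := h.pos

theorem mulVec_sum (h : NullData A M e f x) {X : Matrix (Fin (p + 1)) (Fin (p + 1)) ℝ}
    (hX : X ∈ linParts A) (c : Fin d → ℝ) :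
    X *ᵥ ∑ i, c i • x i = (1 / 2 * mf p (X *ᵥ f) (∑ i, c i • x i)) • e := by
  rw [Matrix.mulVec_sum, map_sum, Finset.mul_sum, Finset.sum_smul]
  refine Finset.sum_congr rfl fun i _ => ?_
  rw [Matrix.mulVec_smul, h.Xx X hX, smul_smul, map_smul, smul_eq_mul]
  congr 1
  ring

theorem rotate (h : NullData A M e f x) {O : Matrix (Fin d) (Fin d) ℝ} (hO : Oᵀ * O = 1)
    (hM : ∀ X ∈ linParts A, X *ᵥ f ∈ M) :
    NullData A M e f fun j => ∑ i, O i j • x i where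
  toIsNullFrame := h.toIsNullFrame.rotate hO
  Xe := h.Xe
  Xx X hX j := h.mulVec_sum hX _
  Xf X hX := by
    refine (h.toIsNullFrame.rotate hO).eq_sum (hM X hX) ?_ ?_
    · rw [h.Xf X hX]
      simp [h.xe]
    · rw [h.Xf X hX]
      simp [h.xf]
  surj w := by
    obtain ⟨X, hX, hXw⟩ := h.surj (O *ᵥ w)
    refine ⟨X, hX, fun j => ?_⟩
    have h1 : (Oᵀ *ᵥ (O *ᵥ w)) j = w j := by rw [Matrix.mulVec_mulVec, hO, Matrix.one_mulVec]
    rw [← h1, map_sum, Matrix.mulVec, dotProduct, Finset.mul_sum]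
    refine Finset.sum_congr rfl fun i _ => ?_
    rw [map_smul, hXw, smul_eq_mul, Matrix.transpose_apply]
    ring
  pos := h.pos

/-- The elements dual to the transverse vectors determine the transverse components of all
translation parts. -/
theorem mf_transverse (h : NullData A M e f x) (hA : IsMASA p A)
    {X X' : Matrix (Fin (p + 1)) (Fin (p + 1)) ℝ} {α α' : V p} (hX : aff X α ∈ A)
    (hX' : aff X' α' ∈ A) {j : Fin d}
    (hj : ∀ i, mf p (X' *ᵥ f) (x i) = 2 * if i = j then 1 else 0) :
    2 * mf p α (x j) = ∑ i, mf p (X *ᵥ f) (x i) * mf p α' (x i) := by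
  have h1 := hA.cocycle_mf hX hX' f
  rw [h.Xf X ⟨α, hX⟩, h.Xf X' ⟨α', hX'⟩] at h1
  simp only [hj, map_sum, map_smul, smul_eq_mul] at h1
  rw [h1]
  simp

/-- The cocycle identity paired with a transverse vector makes ⟨α, e⟩ proportional to every single
transverse component of Xf. With two directions this forces ⟨α, e⟩ = 0; with one it leaves a
constant, the source of κ. -/
theorem mf_null (h : NullData A M e f x) (hA : IsMASA p A)
    {X X' : Matrix (Fin (p + 1)) (Fin (p + 1)) ℝ} {α α' : V p} (hX : aff X α ∈ A)
    (hX' : aff X' α' ∈ A) (i : Fin d) :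
    mf p (X *ᵥ f) (x i) * mf p α' e = mf p (X' *ᵥ f) (x i) * mf p α e := by
  have h1 := hA.cocycle_mf hX hX' (x i)
  rw [h.Xx X ⟨α, hX⟩, h.Xx X' ⟨α', hX'⟩, map_smul, map_smul, smul_eq_mul, smul_eq_mul] at h1
  linarith

end NullData

/-- With X₀f = 2x_0, every translation part is controlled by α₀: its transverse component is removed
by the origin, and its pairing with e is scaled to give κ. -/
theorem IsMASA.conj_null_one (hA : IsMASA p A) (h : Family (linParts A) l m U W s)
    {e f : V p} {x : Fin 1 → V p} (hN : NullData A (famCompl U W s) e f x) :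
    ∃ κ : SignType, p = (Block.null κ).k + 2 * l + m ∧
      Conj (eGroup p) (std p (.null κ) l m) A := by
  obtain ⟨X₀, ⟨α₀, hX₀⟩, hX₀f⟩ := hN.surj fun _ => 1
  obtain ⟨c, κ, hc, hcκ⟩ := exists_sign_scale (mf p α₀ e)
  -- The null vector is now ce, so the origin must satisfy ⟨o, e⟩ = ⟨α₀, x_0⟩; then α₀ + X₀o has no
  -- transverse component, because X₀x_0 = e.
  refine ⟨κ, hA.conj_null_of_frame h (hN.scale hc) (.null κ) rfl (c * mf p α₀ (x 0))
    (fun _ => (κ : ℝ) • nullF p) (fun _ => (κ : ℝ) • c⁻¹ • f) (fun hp => null_gens hp κ) ?_ ?_⟩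
  · intro G hG _
    have h0 : G *ᵥ ev p 0 = _ := hG 0
    have h1 : G *ᵥ ev p 1 = _ := hG 1
    rw [Matrix.mulVec_smul, nullF, Matrix.mulVec_add, h0, h1, IsNullFrame.f_eq]
  · intro o ho X α hX j
    obtain rfl : j = 0 := Subsingleton.elim _ _
    have hX' : X ∈ linParts A := ⟨α, hX⟩
    have hs := hA.skew hX'
    rw [map_smul, smul_eq_mul] at ho
    have ho' := mul_left_cancel₀ hc ho
    have e1 := hN.mf_transverse hA hX hX₀ (j := 0) fun i => by
      rw [hX₀f, if_pos (Subsingleton.elim _ _)]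
    have e2 := hN.mf_null hA hX hX₀ 0
    have e3 := hN.Xf X hX'
    rw [hX₀f] at e2
    rw [Fin.sum_univ_one] at e1 e3
    have z1 : mf p (α + X *ᵥ o) (x 0) = 0 := by
      rw [map_add, LinearMap.add_apply, hs, hN.Xx X hX', map_smul, ho', smul_eq_mul]
      linarith
    have z2 : mf p (α + X *ᵥ o) e = mf p α e := by
      rw [map_add, LinearMap.add_apply, hs, hN.Xe X hX', map_zero, neg_zero, add_zero]
    rw [wedge_mulVec, mf_comm, z1, zero_smul, zero_sub, map_smul, LinearMap.smul_apply, mf_comm,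
      z2, Matrix.mulVec_smul, Matrix.mulVec_smul, e3, smul_smul, smul_smul, ← neg_smul]
    congr 1
    rw [smul_eq_mul]
    have e4 : mf p α e = 1 / 2 * mf p (X *ᵥ f) (x 0) * mf p α₀ e := by linarith
    have e5 : (κ : ℝ) = -(c * c * mf p α₀ e) / 2 := by linarith
    rw [e4, e5]
    field_simp

/-- Choose elements dual to the transverse basis; the transverse components of their translation
parts form a matrix S, symmetric by the cocycle identity, which determines those of all elements. An
orthogonal diagonalization of S, followed by a permutation, a shift of the origin by the mean and a
rescaling of e, produces normalized constants. -/
theorem IsMASA.conj_multi (hA : IsMASA p A) (h : Family (linParts A) l m U W s) {n : ℕ}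
    {e f : V p} {x : Fin (n + 2) → V p} (hN : NullData A (famCompl U W s) e f x) :
    ∃ a : Fin (n + 2) → ℝ, (Block.multi n a).Normalized ∧
      p = (Block.multi n a).k + 2 * l + m ∧ Conj (eGroup p) (std p (.multi n a) l m) A := by
  have hfM : ∀ X ∈ linParts A, X *ᵥ f ∈ famCompl U W s := fun X hX =>
    h.mulVec_mem hX (hA.skew hX) hN.f_mem
  have hdual : ∀ j : Fin (n + 2), ∃ X α, aff X α ∈ A ∧
      ∀ i, mf p (X *ᵥ f) (x i) = 2 * if i = j then 1 else 0 := fun j => by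
    obtain ⟨X, ⟨α, hX⟩, h'⟩ := hN.surj fun i => if i = j then 1 else 0
    exact ⟨X, α, hX, h'⟩
  choose X₀ α₀ hX₀ hX₀x using hdual
  have hαe₀ : ∀ i, mf p (α₀ i) e = 0 := by
    intro i
    -- Here at least two transverse directions are needed.
    obtain ⟨j, hj⟩ := exists_ne i
    have := hN.mf_null hA (hX₀ j) (hX₀ i) j
    rw [hX₀x, hX₀x, if_pos rfl, if_neg hj] at this
    linarith
  have hαe : ∀ X α, aff X α ∈ A → mf p α e = 0 := by
    intro X α hX
    have := hN.mf_null hA hX (hX₀ 0) 0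
    rw [hX₀x, if_pos rfl, hαe₀] at this
    linarith
  let S : Matrix (Fin (n + 2)) (Fin (n + 2)) ℝ := Matrix.of fun i j => mf p (α₀ i) (x j)
  have hS : Sᵀ = S := by
    ext i j
    have := hN.mf_transverse hA (hX₀ j) (hX₀ i) (hX₀x i)
    simp only [hX₀x, mul_ite, mul_one, mul_zero, ite_mul, zero_mul, Finset.sum_ite_eq',
      Finset.mem_univ, if_true] at this
    simp only [S, Matrix.transpose_apply, Matrix.of_apply]
    linarith
  obtain ⟨O, r, hO, hOr⟩ := exists_diagonalization S hS
  obtain ⟨σ, c, τ, hc, hnorm⟩ := exists_normalized r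
  have hO' : (O.submatrix id σ)ᵀ * O.submatrix id σ = 1 := by
    rw [Matrix.transpose_submatrix, ← Matrix.submatrix_mul _ _ _ _ _ Function.bijective_id, hO,
      Matrix.submatrix_one_equiv]
  have hN' := (hN.rotate hO' hfM).scale hc
  have hcomp : ∀ X α, aff X α ∈ A → ∀ j, 2 * mf p α (∑ i, O i j • x i) =
      r j * mf p (X *ᵥ f) (∑ i, O i j • x i) := by
    intro X α hX j
    have h1 : ∀ j, 2 * mf p α (x j) = ∑ i, mf p (X *ᵥ f) (x i) * S j i := fun j =>
      hN.mf_transverse hA hX (hX₀ j) (hX₀x j)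
    have hO2 : O * Oᵀ = 1 := mul_eq_one_comm.mp hO
    have h2 : Oᵀ * S = Matrix.diagonal r * Oᵀ := by
      rw [← hOr, Matrix.mul_assoc, hO2, Matrix.mul_one]
    rw [map_sum, map_sum, Finset.mul_sum, Finset.mul_sum]
    have h3 : ∀ i, 2 * mf p α (O i j • x i) = ∑ k, mf p (X *ᵥ f) (x k) * (O i j * S i k) :=
      fun i => by
        rw [map_smul, smul_eq_mul, mul_left_comm, h1, Finset.mul_sum]
        exact Finset.sum_congr rfl fun k _ => by ring
    simp only [h3]
    rw [Finset.sum_comm]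
    refine Finset.sum_congr rfl fun k _ => ?_
    rw [← Finset.mul_sum]
    have h4 := congrFun (congrFun h2 j) k
    rw [Matrix.mul_apply, Matrix.diagonal_mul] at h4
    simp only [Matrix.transpose_apply] at h4
    rw [h4, map_smul, smul_eq_mul]
    ring
  -- An origin with ⟨o, e⟩ = τ subtracts τ from every eigenvalue; the value is cτ because the null
  -- vector has become ce.
  refine ⟨fun j => c * (r (σ j) - τ), hnorm, hA.conj_null_of_frame h hN' _ rfl (c * τ)
    _ (fun j => (c * (r (σ j) - τ)) • ∑ i, O i (σ j) • x i) (fun hp => multi_gens hp _) ?_ ?_⟩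
  · intro G hG j
    have h1 : G *ᵥ ev p (j + 2) = _ := hG j.succ.succ
    rw [Matrix.mulVec_smul, h1]
    rfl
  · intro o ho X α hX j
    have hX' : X ∈ linParts A := ⟨α, hX⟩
    have hs := hA.skew hX'
    rw [map_smul, smul_eq_mul] at ho
    have ho' := mul_left_cancel₀ hc ho
    have z1 : mf p (α + X *ᵥ o) (∑ i, O i (σ j) • x i) =
        1 / 2 * ((r (σ j) - τ) * mf p (X *ᵥ f) (∑ i, O i (σ j) • x i)) := by
      rw [map_add, LinearMap.add_apply, hs, hN.mulVec_sum hX', map_smul, ho', smul_eq_mul]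
      have := hcomp X α hX (σ j)
      linarith
    have z2 : mf p (α + X *ᵥ o) e = 0 := by
      rw [map_add, LinearMap.add_apply, hs, hN.Xe X hX', map_zero, neg_zero, add_zero,
        hαe X α hX]
    simp only [Matrix.submatrix_apply, id_eq]
    rw [wedge_mulVec, mf_comm, z1, map_smul, LinearMap.smul_apply, mf_comm p e, z2, smul_zero,
      zero_smul, sub_zero, Matrix.mulVec_smul, hN.mulVec_sum hX', smul_smul, smul_smul]
    congr 1
    ring

/-- Every maximal Abelian subalgebra is conjugate to a standard one. -/
theorem IsMASA.exists_conj_std (hA : IsMASA p A) : ∃ (B : Block) (l m : ℕ),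
    B.Normalized ∧ p = B.k + 2 * l + m ∧ Conj (eGroup p) (std p B l m) A := by
  obtain ⟨l, m, U, W, s, h⟩ := exists_maxFamily (linParts A)
  by_cases hT : ∀ t ∈ famCompl U W s, mf p t t < 0 → ¬ ∀ X ∈ linParts A, X *ᵥ t = 0
  · by_cases hB : ∀ e ∈ famCompl U W s, e ≠ 0 → mf p e e = 0 →
      (∀ X ∈ linParts A, ∃ c : ℝ, X *ᵥ e = c • e) → ∀ X ∈ linParts A, X *ᵥ e = 0
    · obtain ⟨d, e, f, x, hN⟩ := hA.exists_nullData h hT hB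
      have hd := hN.pos
      rcases d with _ | _ | n
      · omega
      · obtain ⟨κ, h1, h2⟩ := hA.conj_null_one h.toFamily hN
        exact ⟨.null κ, l, m, trivial, h1, h2⟩
      · obtain ⟨a, h0, h1, h2⟩ := hA.conj_multi h.toFamily hN
        exact ⟨_, l, m, h0, h1, h2⟩
    · push Not at hB
      obtain ⟨e, he, he0, hee, hX, hne⟩ := hB
      obtain ⟨h1, h2⟩ := hA.conj_boost h he he0 hee hX hne
      exact ⟨.boost, l, m, trivial, h1, h2⟩
  · push Not at hT
    obtain ⟨t, ht, htt, hX⟩ := hT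
    obtain ⟨h1, h2⟩ := hA.conj_time h ht htt hX
    exact ⟨.time, l, m, trivial, h1, h2⟩

end NullCase

end MinkMASA
namespace MinkMASA

/-! ### Invariants of the standard subalgebras -/

section Invariants

variable {p : ℕ}

/-- The vectors annihilated by all linear parts. -/
def fixSpace (A : LieSubalgebra ℝ (Mat p)) : Submodule ℝ (V p) where
  carrier := {v | ∀ X ∈ linParts A, X *ᵥ v = 0}
  add_mem' := fun {v w} hv hw X hX => by rw [Matrix.mulVec_add, hv X hX, hw X hX, add_zero]
  zero_mem' := fun X _ => Matrix.mulVec_zero X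
  smul_mem' := fun c v hv X hX => by rw [Matrix.mulVec_smul, hv X hX, smul_zero]

/-- The vectors annihilated by all products of two linear parts. -/
def fixSpaceTwo (A : LieSubalgebra ℝ (Mat p)) : Submodule ℝ (V p) where
  carrier := {v | ∀ X ∈ linParts A, X *ᵥ v ∈ fixSpace A}
  add_mem' := fun {v w} hv hw X hX => by
    rw [Matrix.mulVec_add]
    exact add_mem (hv X hX) (hw X hX)
  zero_mem' := fun X _ => by
    rw [Matrix.mulVec_zero]
    exact zero_mem _
  smul_mem' := fun c v hv X hX => by
    rw [Matrix.mulVec_smul]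
    exact Submodule.smul_mem _ _ (hv X hX)

theorem fixSpace_le (A : LieSubalgebra ℝ (Mat p)) : fixSpace A ≤ fixSpaceTwo A :=
  fun v hv X hX => by
    rw [hv X hX]
    exact zero_mem _

/-- The affine isometry with linear part `G` and translation part `a` conjugates `A` to `A'`. -/
structure ConjBy (G : Matrix (Fin (p + 1)) (Fin (p + 1)) ℝ) (a : V p)
    (A A' : LieSubalgebra ℝ (Mat p)) : Prop where
  isom : Isom G
  iff : ∀ Y, Y ∈ A ↔ grp G a * Y * (grp G a)⁻¹ ∈ A'

theorem Conj.exists_conjBy {S : Set (Mat p)} (hS : S ⊆ eGroup p) {A A' : LieSubalgebra ℝ (Mat p)}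
    (h : Conj S A A') : ∃ G a, grp G a ∈ S ∧ ConjBy G a A A' := by
  obtain ⟨H, hH, h⟩ := (conj_iff hS).mp h
  obtain ⟨G, a, hG, rfl⟩ := mem_eGroup_iff.mp (hS hH)
  exact ⟨G, a, hH, hG, h⟩

namespace ConjBy

variable {G : Matrix (Fin (p + 1)) (Fin (p + 1)) ℝ} {a : V p} {A A' : LieSubalgebra ℝ (Mat p)}

theorem symm (h : ConjBy G a A A') : ∃ G' a', G * G' = 1 ∧ G' * G = 1 ∧ ConjBy G' a' A' A := by
  obtain ⟨G', h1, h2, hG'⟩ := h.isom.exists_inverse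
  refine ⟨G', -(G' *ᵥ a), h1, h2, hG', fun Y => ?_⟩
  have h3 : grp G a * grp G' (-(G' *ᵥ a)) = 1 := by
    rw [← grp_inv h1]
    exact eGroup_mul_inv (mem_eGroup_iff.mpr ⟨G, a, h.isom, rfl⟩)
  have h4 : (grp G' (-(G' *ᵥ a)))⁻¹ = grp G a := Matrix.inv_eq_left_inv h3
  rw [h.iff, h4, grp_inv h1, conj_conj h3]

theorem mulVec_mem_fixSpace (h : ConjBy G a A A') {v : V p}
    (hv : v ∈ fixSpace A) : G *ᵥ v ∈ fixSpace A' := by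
  obtain ⟨G', a', h1, h2, h'⟩ := h.symm
  rintro X ⟨α, hX⟩
  have h3 := (h'.iff _).mp hX
  rw [grp_conj h2] at h3
  have := hv _ ⟨_, h3⟩
  have h4 := congrArg (fun w => G *ᵥ w) this
  simpa only [Matrix.mulVec_mulVec, ← Matrix.mul_assoc, h1, Matrix.one_mul, Matrix.mulVec_zero]
    using h4

theorem mulVec_mem_fixSpaceTwo (h : ConjBy G a A A') {v : V p}
    (hv : v ∈ fixSpaceTwo A) : G *ᵥ v ∈ fixSpaceTwo A' := by
  obtain ⟨G', a', h1, h2, h'⟩ := h.symm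
  rintro X ⟨α, hX⟩
  have h3 := (h'.iff _).mp hX
  rw [grp_conj h2] at h3
  have := h.mulVec_mem_fixSpace (hv _ ⟨_, h3⟩)
  simpa only [Matrix.mulVec_mulVec, ← Matrix.mul_assoc, h1, Matrix.one_mul] using this

theorem injective (h : ConjBy G a A A') : Function.Injective (Matrix.mulVecLin G) := by
  obtain ⟨G', -, h2, -⟩ := h.isom.exists_inverse
  intro u v huv
  have := congrArg (fun w => G' *ᵥ w) huv
  simpa [Matrix.mulVec_mulVec, h2] using this

theorem finrank_le (h : ConjBy G a A A') {F F' : Submodule ℝ (V p)}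
    (hF : ∀ v ∈ F, G *ᵥ v ∈ F') : Module.finrank ℝ F ≤ Module.finrank ℝ F' := by
  refine LinearMap.finrank_le_finrank_of_injective (f := (Matrix.mulVecLin G).restrict hF) ?_
  intro u v huv
  exact Subtype.ext (h.injective (congrArg Subtype.val huv))

theorem finrank_fixSpace (h : ConjBy G a A A') :
    Module.finrank ℝ (fixSpace A) = Module.finrank ℝ (fixSpace A') := by
  obtain ⟨G', a', -, -, h'⟩ := h.symm
  exact le_antisymm (h.finrank_le fun _ => h.mulVec_mem_fixSpace)
    (h'.finrank_le fun _ => h'.mulVec_mem_fixSpace)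

theorem finrank_fixSpaceTwo (h : ConjBy G a A A') :
    Module.finrank ℝ (fixSpaceTwo A) = Module.finrank ℝ (fixSpaceTwo A') := by
  obtain ⟨G', a', -, -, h'⟩ := h.symm
  exact le_antisymm (h.finrank_le fun _ => h.mulVec_mem_fixSpaceTwo)
    (h'.finrank_le fun _ => h'.mulVec_mem_fixSpaceTwo)

end ConjBy

variable {B : Block} {l m : ℕ}

theorem std_comm_gens (hp : p = B.k + 2 * l + m) {X : Matrix (Fin (p + 1)) (Fin (p + 1)) ℝ}
    {α : V p} (h : aff X α ∈ std p B l m) : ∀ g ∈ stdGens p B l m, ⁅aff X α, g⁆ = 0 :=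
  fun _ hg => std_abelian hp _ h _ (mem_std_of_gens hp hg)

theorem skew_of_mem_std (hp : p = B.k + 2 * l + m) {X : Matrix (Fin (p + 1)) (Fin (p + 1)) ℝ}
    {α : V p} (h : aff X α ∈ std p B l m) : Skew X :=
  aff_mem_eAlg.mp (std_le_eAlg hp h)

theorem splits_of_mem_std (hp : p = B.k + 2 * l + m) {X : Matrix (Fin (p + 1)) (Fin (p + 1)) ℝ}
    {α : V p} (h : aff X α ∈ std p B l m) : Splits B.k l m X :=
  splits_of_comm hp (skew_of_mem_std hp h) (std_comm_gens hp h)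

theorem line_mem_fixSpace (hp : p = B.k + 2 * l + m) (i : Fin m) :
    ev p (B.k + 2 * l + i + 1) ∈ fixSpace (std p B l m) := by
  rintro X ⟨α, hX⟩
  exact (splits_of_mem_std hp hX).lines i

/-- The square of u ∧ w acts on the nondegenerate plane of u and w as the nonzero scalar -⟨u, u⟩⟨w,
w⟩. -/
theorem mf_eq_zero_of_wedge {u w v : V p} (huu : mf p u u ≠ 0) (hww : mf p w w ≠ 0)
    (huw : mf p u w = 0) (h : wedge u w *ᵥ (wedge u w *ᵥ v) = 0) :
    mf p v u = 0 ∧ mf p v w = 0 := by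
  have hwu : mf p w u = 0 := by rw [mf_comm, huw]
  rw [wedge_mulVec u w v, Matrix.mulVec_sub, Matrix.mulVec_smul, Matrix.mulVec_smul, wedge_mulVec,
    wedge_mulVec, huw, hwu] at h
  have h1 := congrArg (fun z => mf p z u) h
  have h2 := congrArg (fun z => mf p z w) h
  simp only [map_sub, map_smul, LinearMap.sub_apply, LinearMap.smul_apply, smul_eq_mul, huw, hwu,
    map_zero, LinearMap.zero_apply, zero_smul, zero_sub, sub_zero, map_neg, LinearMap.neg_apply,
    mul_zero, mul_neg, neg_eq_zero, mul_eq_zero, huu, hww, or_false,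
    neg_zero] at h1 h2
  rw [mf_comm p v, mf_comm p v]
  exact ⟨h1, h2⟩

theorem mf_plane_of_mem (hp : p = B.k + 2 * l + m) {v : V p}
    (hv : v ∈ fixSpaceTwo (std p B l m)) (i : Fin l) :
    mf p v (ev p (B.k + 2 * i + 1)) = 0 ∧ mf p v (ev p (B.k + 2 * i + 2)) = 0 := by
  have hmem := mem_std_of_gens hp (g := aff (wedge (ev p (B.k + 2 * i + 1))
    (ev p (B.k + 2 * i + 2))) 0) (Or.inl (Or.inr ⟨i, rfl⟩))
  refine mf_eq_zero_of_wedge ?_ ?_ (mf_ev_ne p (by omega)) (hv _ ⟨_, hmem⟩ _ ⟨_, hmem⟩)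
  · rw [mf_ev_self p (by omega) (by omega)]
    norm_num
  · rw [mf_ev_self p (by omega) (by omega)]
    norm_num

/-- A vector annihilated by all products of two linear parts is determined by its components in
`M(k,1)` and along the lines. -/
theorem eq_zero_of_mem (hp : p = B.k + 2 * l + m) {v : V p}
    (hv : v ∈ fixSpaceTwo (std p B l m)) (h1 : ∀ j ≤ B.k, mf p v (ev p j) = 0)
    (h2 : ∀ i : Fin m, mf p v (ev p (B.k + 2 * l + i + 1)) = 0) : v = 0 := by
  refine eq_zero_of_mf p fun j hj => ?_
  rcases index_cases hp hj with h | ⟨c, rfl⟩ | ⟨c, rfl⟩ | ⟨c, rfl⟩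
  · exact h1 j h
  · exact (mf_plane_of_mem hp hv c).1
  · exact (mf_plane_of_mem hp hv c).2
  · exact h2 c

theorem mf_lines (hp : p = B.k + 2 * l + m) (i j : Fin m) :
    mf p (ev p (B.k + 2 * l + i + 1)) (ev p (B.k + 2 * l + j + 1)) = if i = j then 1 else 0 := by
  by_cases hij : i = j
  · rw [if_pos hij, hij, mf_ev_self p (by omega) (by omega)]
  · have : (i : ℕ) ≠ j := by simpa [Fin.val_inj] using hij
    rw [if_neg hij, mf_ev_ne p (by omega)]

theorem ev_zero_mem_fixSpace (hp : p = Block.time.k + 2 * l + m) :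
    ev p 0 ∈ fixSpace (std p .time l m) := by
  rintro X ⟨α, hX⟩
  have := (forall_stdGens.mp (std_comm_gens hp hX)).1
  rw [time_gens] at this
  exact time_comm (this _ rfl)

theorem finrank_time (hp : p = Block.time.k + 2 * l + m) :
    Module.finrank ℝ (fixSpace (std p .time l m)) = m + 1 ∧
      Module.finrank ℝ (fixSpaceTwo (std p .time l m)) = m + 1 := by
  let x : Option (Fin m) → V p := fun i => i.elim (ev p 0) fun i =>
    ev p (Block.time.k + 2 * l + i + 1)
  let y : Option (Fin m) → V p := fun i => i.elim (-ev p 0) fun i =>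
    ev p (Block.time.k + 2 * l + i + 1)
  have hx : ∀ i, x i ∈ fixSpace (std p .time l m) := by
    rintro (_ | i)
    · exact ev_zero_mem_fixSpace hp
    · exact line_mem_fixSpace hp i
  have hxy : ∀ i j, mf p (x i) (y j) = if i = j then 1 else 0 := by
    rintro (_ | i) (_ | j)
    · simp [x, y, mf_ev_zero]
    · simp [x, y, mf_ev_ne]
    · simp [x, y, mf_ev_ne]
    · simp only [x, y, Option.elim, mf_lines hp, Option.some_inj]
  have hF : ∀ v ∈ fixSpaceTwo (std p .time l m), (∀ i, mf p v (y i) = 0) → v = 0 := by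
    intro v hv hvy
    refine eq_zero_of_mem hp hv (fun j hj => ?_) fun i => hvy (some i)
    obtain rfl : j = 0 := by simpa [Block.k] using hj
    simpa [y] using hvy none
  have hcard : Fintype.card (Option (Fin m)) = m + 1 := by simp
  exact ⟨(finrank_eq_of_dual _ x y hx hxy fun v hv => hF v (fixSpace_le _ hv)).trans hcard,
    (finrank_eq_of_dual _ x y (fun i => fixSpace_le _ (hx i)) hxy hF).trans hcard⟩

theorem mf_boost_of_mem (hp : p = Block.boost.k + 2 * l + m) {v : V p}
    (hv : v ∈ fixSpaceTwo (std p .boost l m)) :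
    mf p v (ev p 0) = 0 ∧ mf p v (ev p 1) = 0 := by
  have hp1 : 1 ≤ p := by simp only [Block.k] at hp; omega
  have hmem := mem_std_of_gens hp (g := aff (wedge (ev p 0) (ev p 1)) 0)
    (Or.inl (Or.inl (by rw [boost_gens hp1]; rfl)))
  refine mf_eq_zero_of_wedge ?_ ?_ (mf_ev_ne p (by omega)) (hv _ ⟨_, hmem⟩ _ ⟨_, hmem⟩)
  · rw [mf_ev_zero]
    norm_num
  · rw [mf_ev_self p hp1 (by omega)]
    norm_num

theorem finrank_boost (hp : p = Block.boost.k + 2 * l + m) :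
    Module.finrank ℝ (fixSpace (std p .boost l m)) = m ∧
      Module.finrank ℝ (fixSpaceTwo (std p .boost l m)) = m := by
  let x : Fin m → V p := fun i => ev p (Block.boost.k + 2 * l + i + 1)
  have hF : ∀ v ∈ fixSpaceTwo (std p .boost l m), (∀ i, mf p v (x i) = 0) → v = 0 := by
    intro v hv hvy
    refine eq_zero_of_mem hp hv (fun j hj => ?_) fun i => hvy i
    obtain rfl | rfl : j = 0 ∨ j = 1 := by simp only [Block.k] at hj; omega
    · exact (mf_boost_of_mem hp hv).1
    · exact (mf_boost_of_mem hp hv).2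
  have hcard : Fintype.card (Fin m) = m := by simp
  exact ⟨(finrank_eq_of_dual _ x x (line_mem_fixSpace hp) (mf_lines hp)
      fun v hv => hF v (fixSpace_le _ hv)).trans hcard,
    (finrank_eq_of_dual _ x x (fun i => fixSpace_le _ (line_mem_fixSpace hp i)) (mf_lines hp)
      hF).trans hcard⟩

/-! ### Fixed vectors of the null blocks -/

section Null

variable {d : ℕ} {τ : Fin d → V p}

theorem null_mulVec (hp : p = B.k + 2 * l + m) (hB : NullType p B d τ)
    {X : Matrix (Fin (p + 1)) (Fin (p + 1)) ℝ} {α : V p} (h : aff X α ∈ std p B l m) :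
    X *ᵥ nullE p = 0 ∧ ∃ c : Fin d → ℝ, (∀ j : Fin d, X *ᵥ ev p (j + 2) = c j • nullE p) ∧
      ∀ j : Fin d, X *ᵥ τ j =
        mf p α (ev p (j + 2)) • nullE p - mf p α (nullE p) • ev p (j + 2) := by
  have := (forall_stdGens.mp (std_comm_gens hp h)).1
  rw [hB.gens_eq] at this
  have hk := hB.k_eq
  exact null_comm (by omega) hB.pos (skew_of_mem_std hp h) this

theorem null_gen_mem (hp : p = B.k + 2 * l + m) (hB : NullType p B d τ) (j : Fin d) :
    aff (wedge (nullE p) (ev p (j + 2))) (τ j) ∈ std p B l m :=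
  mem_std_of_gens hp (Or.inl (Or.inl (by rw [hB.gens_eq]; exact Or.inr ⟨j, rfl⟩)))

theorem nullE_mem_fixSpace (hp : p = B.k + 2 * l + m) (hB : NullType p B d τ) :
    nullE p ∈ fixSpace (std p B l m) := by
  rintro X ⟨α, hX⟩
  exact (null_mulVec hp hB hX).1

theorem transverse_mem_fixSpaceTwo (hp : p = B.k + 2 * l + m) (hB : NullType p B d τ)
    (j : Fin d) : ev p (j + 2) ∈ fixSpaceTwo (std p B l m) := by
  rintro X ⟨α, hX⟩
  obtain ⟨-, c, hc, -⟩ := null_mulVec hp hB hX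
  rw [hc]
  exact Submodule.smul_mem _ _ (nullE_mem_fixSpace hp hB)

/-- The square of e ∧ e_2 sends v to -⟨e, v⟩e. -/
theorem mf_nullE_of_mem (hp : p = B.k + 2 * l + m) (hB : NullType p B d τ) {v : V p}
    (hv : v ∈ fixSpaceTwo (std p B l m)) : mf p v (nullE p) = 0 := by
  have hk := hB.k_eq
  have hd := hB.pos
  have hmem : wedge (nullE p) (ev p 2) ∈ linParts (std p B l m) :=
    ⟨_, null_gen_mem hp hB ⟨0, hd⟩⟩
  have h := hv _ hmem _ hmem
  rw [wedge_mulVec _ _ v, Matrix.mulVec_sub, Matrix.mulVec_smul, Matrix.mulVec_smul, wedge_mulVec,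
    wedge_mulVec, mf_ev_ne' p le_rfl, mf_ne_ev p le_rfl, mf_ne_ne (by omega),
    mf_ev_self p (by omega) (by omega)] at h
  have h1 := congrArg (fun z => mf p z (nullF p)) h
  simp [mf_ne_nf (show 1 ≤ p by omega)] at h1
  rw [mf_comm, h1]

theorem mf_transverse_of_mem (hp : p = B.k + 2 * l + m) (hB : NullType p B d τ) {v : V p}
    (hv : v ∈ fixSpace (std p B l m)) (j : Fin d) : mf p v (ev p (j + 2)) = 0 := by
  have hk := hB.k_eq
  have hd := hB.pos
  have h := hv _ ⟨_, null_gen_mem hp hB j⟩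
  rw [wedge_mulVec] at h
  have h1 := congrArg (fun z => mf p z (nullF p)) h
  simp [mf_ne_nf (show 1 ≤ p by omega), mf_ev_nf] at h1
  rw [mf_comm, h1]

theorem null_eq_zero_of_mem (hp : p = B.k + 2 * l + m) (hB : NullType p B d τ) {v : V p}
    (hv : v ∈ fixSpaceTwo (std p B l m)) (hf : mf p v (nullF p) = 0)
    (hx : ∀ j : Fin d, mf p v (ev p (j + 2)) = 0)
    (hs : ∀ i : Fin m, mf p v (ev p (B.k + 2 * l + i + 1)) = 0) : v = 0 := by
  have hk := hB.k_eq
  have he := mf_nullE_of_mem hp hB hv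
  refine eq_zero_of_mem hp hv (fun j hj => ?_) hs
  by_cases hj2 : 2 ≤ j
  · have := hx ⟨j - 2, by omega⟩
    simp only at this
    rwa [show j - 2 + 2 = j by omega] at this
  · obtain rfl | rfl : j = 0 ∨ j = 1 := by omega
    · rw [ev_zero_eq, map_smul, map_add, he, hf]
      simp
    · rw [ev_one_eq, map_smul, map_sub, he, hf]
      simp

/-- The annihilated vectors are spanned by e and the lines. Products of two linear parts also
annihilate the transverse directions, but not f, so the two ranks differ by d. -/
theorem finrank_null (hp : p = B.k + 2 * l + m) (hB : NullType p B d τ) :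
    Module.finrank ℝ (fixSpace (std p B l m)) = m + 1 ∧
      Module.finrank ℝ (fixSpaceTwo (std p B l m)) = d + m + 1 := by
  have hk := hB.k_eq
  have hp1 : 1 ≤ p := by omega
  have hef : mf p (nullE p) (-(1 / 2 : ℝ) • nullF p) = 1 := by
    rw [map_smul, mf_ne_nf hp1]
    norm_num
  have hes : ∀ i : ℕ, mf p (nullE p) (ev p (B.k + 2 * l + i + 1)) = 0 := fun i =>
    mf_ne_ev p (by omega)
  have hsf : ∀ i : ℕ, mf p (ev p (B.k + 2 * l + i + 1)) (-(1 / 2 : ℝ) • nullF p) = 0 := fun i => by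
    rw [map_smul, mf_ev_nf p (by omega), smul_zero]
  have hf : ∀ v, mf p v (-(1 / 2 : ℝ) • nullF p) = 0 → mf p v (nullF p) = 0 := fun v hv => by
    rw [map_smul, smul_eq_mul] at hv
    linarith
  constructor
  · let x : Option (Fin m) → V p := fun i => i.elim (nullE p) fun i => ev p (B.k + 2 * l + i + 1)
    let y : Option (Fin m) → V p := fun i => i.elim (-(1 / 2 : ℝ) • nullF p) fun i =>
      ev p (B.k + 2 * l + i + 1)
    refine (finrank_eq_of_dual _ x y ?_ ?_ ?_).trans (by simp)
    · rintro (_ | i)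
      · exact nullE_mem_fixSpace hp hB
      · exact line_mem_fixSpace hp i
    · rintro (_ | i) (_ | j)
      · exact hef
      · exact hes j
      · exact hsf i
      · simp only [x, y, Option.elim, mf_lines hp, Option.some_inj]
    · intro v hv hvy
      exact null_eq_zero_of_mem hp hB (fixSpace_le _ hv) (hf v (hvy none))
        (mf_transverse_of_mem hp hB hv) fun i => hvy (some i)
  · let x : Option (Fin d ⊕ Fin m) → V p := fun i => i.elim (nullE p)
      (Sum.elim (fun j => ev p (j + 2)) fun i => ev p (B.k + 2 * l + i + 1))
    let y : Option (Fin d ⊕ Fin m) → V p := fun i => i.elim (-(1 / 2 : ℝ) • nullF p)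
      (Sum.elim (fun j => ev p (j + 2)) fun i => ev p (B.k + 2 * l + i + 1))
    refine (finrank_eq_of_dual _ x y ?_ ?_ ?_).trans (by simp)
    · rintro (_ | j | i)
      · exact fixSpace_le _ (nullE_mem_fixSpace hp hB)
      · exact transverse_mem_fixSpaceTwo hp hB j
      · exact fixSpace_le _ (line_mem_fixSpace hp i)
    · rintro (_ | i | i) (_ | j | j)
      · exact hef
      · exact mf_ne_ev p (by omega)
      · exact hes j
      · change mf p (ev p (i + 2)) (-(1 / 2 : ℝ) • nullF p) = 0
        rw [map_smul, mf_ev_nf p (by omega), smul_zero]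
      · change mf p (ev p (i + 2)) (ev p (j + 2)) = _
        by_cases hij : i = j
        · rw [hij, mf_ev_self p (by omega) (by omega), if_pos rfl]
        · have : (i : ℕ) ≠ j := by simpa [Fin.val_inj] using hij
          rw [mf_ev_ne p (by omega), if_neg (by simpa using hij)]
      · exact mf_ev_ne p (by omega)
      · exact hsf i
      · exact mf_ev_ne p (by omega)
      · simp only [x, y, Option.elim, Sum.elim_inr, mf_lines hp, Option.some_inj, Sum.inr.injEq]
    · intro v hv hvy
      exact null_eq_zero_of_mem hp hB hv (hf v (hvy none)) (fun j => hvy (some (.inl j)))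
        fun i => hvy (some (.inr i))

end Null

/-- The ranks do not separate these types: l = l' + 1, m' = m + 1 is compatible with them. A fixed
timelike vector does, because the fixed vectors of a boost algebra have no time component. -/
theorem not_conjBy_time_boost {G : Matrix (Fin (p + 1)) (Fin (p + 1)) ℝ} {a : V p} {l' m' : ℕ}
    (hp : p = Block.time.k + 2 * l + m) (hp' : p = Block.boost.k + 2 * l' + m') :
    ¬ ConjBy G a (std p .time l m) (std p .boost l' m') := by
  intro h
  have h1 := h.mulVec_mem_fixSpace (ev_zero_mem_fixSpace hp)
  have h2 := (mf_boost_of_mem hp' (fixSpace_le _ h1)).1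
  have h3 : (G *ᵥ ev p 0) 0 = 0 := by
    have := mf_ev p (G *ᵥ ev p 0) 0
    rw [Fin.val_zero, h2] at this
    exact (mul_eq_zero.mp this.symm).resolve_left (gDiag_ne_zero _)
  have h4 := h.isom (ev p 0) (ev p 0)
  rw [mf_ev_zero, mf_eq_sum_succ, h3] at h4
  have : 0 ≤ ∑ i : Fin p, (G *ᵥ ev p 0) i.succ * (G *ᵥ ev p 0) i.succ :=
    Finset.sum_nonneg fun i _ => mul_self_nonneg _
  linarith

/-- Conjugate standard subalgebras have the same numbers of planes and lines. -/
theorem ConjBy.dims {G : Matrix (Fin (p + 1)) (Fin (p + 1)) ℝ} {a : V p} {B' : Block} {l' m' : ℕ}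
    (hp : p = B.k + 2 * l + m) (hp' : p = B'.k + 2 * l' + m')
    (h : ConjBy G a (std p B l m) (std p B' l' m')) : l = l' ∧ m = m' := by
  have h1 := h.finrank_fixSpace
  have h2 := h.finrank_fixSpaceTwo
  obtain ⟨G', a', -, -, h'⟩ := h.symm
  -- The two ranks differ precisely for null types, which separates those from the others. Within
  -- one type the ranks give m (and d), and p then gives l.
  rcases Block.cases_type (p := p) B (by omega) with rfl | rfl | ⟨d, τ, hB⟩ <;>
    rcases Block.cases_type (p := p) B' (by omega) with rfl | rfl | ⟨d', τ', hB'⟩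
  · rw [(finrank_time hp).1, (finrank_time hp').1] at h1
    omega
  · exact absurd h (not_conjBy_time_boost hp hp')
  · rw [(finrank_time hp).1, (finrank_null hp' hB').1] at h1
    rw [(finrank_time hp).2, (finrank_null hp' hB').2] at h2
    have := hB'.pos
    omega
  · exact absurd h' (not_conjBy_time_boost hp' hp)
  · rw [(finrank_boost hp).1, (finrank_boost hp').1] at h1
    omega
  · rw [(finrank_boost hp).1, (finrank_null hp' hB').1] at h1
    rw [(finrank_boost hp).2, (finrank_null hp' hB').2] at h2
    have := hB'.pos
    omega
  · rw [(finrank_null hp hB).1, (finrank_time hp').1] at h1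
    rw [(finrank_null hp hB).2, (finrank_time hp').2] at h2
    have := hB.pos
    omega
  · rw [(finrank_null hp hB).1, (finrank_boost hp').1] at h1
    rw [(finrank_null hp hB).2, (finrank_boost hp').2] at h2
    have := hB.pos
    omega
  · rw [(finrank_null hp hB).1, (finrank_null hp' hB').1] at h1
    rw [(finrank_null hp hB).2, (finrank_null hp' hB').2] at h2
    have := hB.k_eq
    have := hB'.k_eq
    omega

end Invariants

end MinkMASA
namespace MinkMASA

/-! ### The constants are invariants -/

theorem exists_perm_of_map_eq {ι γ : Type*} [Fintype ι] {f g : ι → γ}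
    (h : Finset.univ.val.map f = Finset.univ.val.map g) :
    ∃ σ : Equiv.Perm ι, f = g ∘ σ := by
  classical
  have hc : ∀ c, Nonempty ({i // f i = c} ≃ {i // g i = c}) := fun c => by
    have := congrArg (Multiset.count c) h
    rw [Multiset.count_map, Multiset.count_map] at this
    refine Fintype.card_eq.mp ?_
    rw [Fintype.card_subtype, Fintype.card_subtype, Finset.card_def, Finset.card_def,
      Finset.filter_val, Finset.filter_val]
    simpa only [eq_comm] using this
  refine ⟨Equiv.ofFiberEquiv fun c => (hc c).some, funext fun i => ?_⟩
  exact (Equiv.ofFiberEquiv_map _ i).symm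

/-- Similar diagonal matrices have the same entries up to a permutation. -/
theorem exists_perm_of_diagonal_similar {ι : Type*} [Fintype ι] [DecidableEq ι] {b b' : ι → ℝ}
    {R R' : Matrix ι ι ℝ} (hR : R' * R = 1)
    (h : Matrix.diagonal b' * R = R * Matrix.diagonal b) :
    ∃ σ : Equiv.Perm ι, b = b' ∘ σ := by
  have hR' : R * R' = 1 := mul_eq_one_comm.mp hR
  have h1 : Matrix.diagonal b' = R * Matrix.diagonal b * R' := by
    rw [← h, Matrix.mul_assoc, hR', Matrix.mul_one]
  have h2 := Matrix.charpoly_units_conj ⟨R, R', hR', hR⟩ (Matrix.diagonal b)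
  rw [Units.val_mk, Matrix.inv_eq_right_inv hR', ← h1, Matrix.charpoly_diagonal, Matrix.charpoly_diagonal] at h2
  have key : ∀ c : ι → ℝ, (∏ i, (Polynomial.X - Polynomial.C (c i))).roots =
      Finset.univ.val.map c := fun c => by
    have := Polynomial.roots_multiset_prod_X_sub_C (Finset.univ.val.map c)
    rwa [Multiset.map_map] at this
  have h3 := congrArg Polynomial.roots h2
  rw [key, key] at h3
  exact exists_perm_of_map_eq h3.symm

theorem ev_eq_single (p : ℕ) (i : Fin (p + 1)) : ev p i = Pi.single i 1 := by
  ext c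
  simp [ev, Pi.single_apply, Fin.val_inj]

section Constants

variable {p d l m : ℕ} {B B' : Block} {τ τ' : Fin d → V p}
  {G : Matrix (Fin (p + 1)) (Fin (p + 1)) ℝ} {a : V p}

namespace ConjBy

variable (hp : p = B.k + 2 * l + m) (hp' : p = B'.k + 2 * l + m) (hB : NullType p B d τ)
  (hB' : NullType p B' d τ') (h : ConjBy G a (std p B l m) (std p B' l m))

include hp hp' hB hB' h in
-- The line of e is the radical of the form on the space of fixed vectors, and G maps fixed vectors
-- to fixed vectors isometrically.
theorem mulVec_nullE : ∃ c : ℝ, c ≠ 0 ∧ G *ᵥ nullE p = c • nullE p := by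
  have hk := hB'.k_eq
  have hp1 : 1 ≤ p := by omega
  have hef := mf_ne_nf hp1
  have hv : G *ᵥ nullE p ∈ fixSpace (std p B' l m) :=
    h.mulVec_mem_fixSpace (nullE_mem_fixSpace hp hB)
  obtain ⟨G', a', h1, h2, h'⟩ := h.symm
  have hperp : ∀ w ∈ fixSpace (std p B' l m), mf p (G *ᵥ nullE p) w = 0 := fun w hw => by
    have hw' := mf_nullE_of_mem hp hB (fixSpace_le _ (h'.mulVec_mem_fixSpace hw))
    have hww : w = G *ᵥ (G' *ᵥ w) := by rw [Matrix.mulVec_mulVec, h1, Matrix.one_mulVec]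
    rw [hww, h.isom, mf_comm, hw']
  have hu : G *ᵥ nullE p + (1 / 2 * mf p (G *ᵥ nullE p) (nullF p)) • nullE p = 0 := by
    have hmem := add_mem hv (Submodule.smul_mem _ (1 / 2 * mf p (G *ᵥ nullE p) (nullF p))
      (nullE_mem_fixSpace hp' hB'))
    refine null_eq_zero_of_mem hp' hB' (fixSpace_le _ hmem) ?_
      (mf_transverse_of_mem hp' hB' hmem) fun i => ?_
    · rw [map_add, map_smul, LinearMap.add_apply, LinearMap.smul_apply, hef, smul_eq_mul]
      ring
    · rw [map_add, map_smul, LinearMap.add_apply, LinearMap.smul_apply,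
        hperp _ (line_mem_fixSpace hp' i), mf_ne_ev p (by omega), smul_zero, add_zero]
  refine ⟨-(1 / 2 * mf p (G *ᵥ nullE p) (nullF p)), fun h0 => ?_, ?_⟩
  · rw [neg_eq_zero] at h0
    rw [h0, zero_smul, add_zero] at hu
    refine ne_ne_zero hp1 (h.injective (?_ : G *ᵥ nullE p = G *ᵥ 0))
    rw [hu, Matrix.mulVec_zero]
  · rw [neg_smul]
    exact eq_neg_of_add_eq_zero_left hu

include hp hp' hB hB' h in
-- The image is annihilated by products of two linear parts and orthogonal to all fixed vectors.
-- This rules out components along f and along the lines.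
theorem mulVec_transverse (j : Fin d) : ∃ c : ℝ, G *ᵥ ev p (j + 2) =
    (∑ i : Fin d, mf p (G *ᵥ ev p (j + 2)) (ev p (i + 2)) • ev p (i + 2)) + c • nullE p := by
  have hk := hB'.k_eq
  have hp1 : 1 ≤ p := by omega
  set v := G *ᵥ ev p (j + 2) with hv
  have hmemv : v ∈ fixSpaceTwo (std p B' l m) :=
    h.mulVec_mem_fixSpaceTwo (transverse_mem_fixSpaceTwo hp hB j)
  obtain ⟨G', a', h1, h2, h'⟩ := h.symm
  have hperp : ∀ w ∈ fixSpace (std p B' l m), mf p v w = 0 := fun w hw => by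
    have hw' := mf_transverse_of_mem hp hB (h'.mulVec_mem_fixSpace hw) j
    have hww : w = G *ᵥ (G' *ᵥ w) := by rw [Matrix.mulVec_mulVec, h1, Matrix.one_mulVec]
    rw [hww, hv, h.isom, mf_comm, hw']
  have hsum : ∀ w, mf p (∑ i : Fin d, mf p v (ev p (i + 2)) • ev p (i + 2)) w =
      ∑ i : Fin d, mf p v (ev p (i + 2)) * mf p (ev p (i + 2)) w := fun w => by
    rw [map_sum, LinearMap.sum_apply]
    simp only [map_smul, LinearMap.smul_apply, smul_eq_mul]
  set c := -(1 / 2 * mf p v (nullF p)) with hc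
  refine ⟨c, sub_eq_zero.mp ?_⟩
  have hmem := sub_mem hmemv (add_mem (sum_mem (t := Finset.univ) fun (i : Fin d) _ => Submodule.smul_mem _
    (mf p v (ev p (i + 2))) (transverse_mem_fixSpaceTwo hp' hB' i))
    (Submodule.smul_mem _ c (fixSpace_le _ (nullE_mem_fixSpace hp' hB'))))
  refine null_eq_zero_of_mem hp' hB' hmem ?_ (fun i => ?_) fun i => ?_
  · rw [map_sub, map_add, map_smul, LinearMap.sub_apply, LinearMap.add_apply,
      LinearMap.smul_apply, hsum, Finset.sum_eq_zero fun i _ => ?_, mf_ne_nf hp1, smul_eq_mul, hc]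
    · ring
    · rw [mf_ev_nf p (by omega), mul_zero]
  · rw [map_sub, map_add, map_smul, LinearMap.sub_apply, LinearMap.add_apply,
      LinearMap.smul_apply, hsum, Finset.sum_eq_single i, mf_ev_self p (by omega) (by omega),
      mf_ne_ev p (by omega)]
    · simp
    · intro b _ hb
      have : (b : ℕ) ≠ i := by simpa [Fin.val_inj] using hb
      rw [mf_ev_ne p (by omega), mul_zero]
    · simp
  · rw [map_sub, map_add, map_smul, LinearMap.sub_apply, LinearMap.add_apply,
      LinearMap.smul_apply, hsum, Finset.sum_eq_zero fun i _ => ?_, mf_ne_ev p (by omega),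
      hperp _ (line_mem_fixSpace hp' i)]
    · simp
    · rw [mf_ev_ne p (by omega), mul_zero]

/-- The matrix of an isometry on the transverse directions. -/
noncomputable def transverse (d : ℕ) (G : Matrix (Fin (p + 1)) (Fin (p + 1)) ℝ) : Matrix (Fin d) (Fin d) ℝ :=
  Matrix.of fun i j => mf p (G *ᵥ ev p (j + 2)) (ev p (i + 2))

include hp hp' hB hB' h in
theorem mf_nullE_mulVec (j : Fin d) : mf p (nullE p) (G *ᵥ ev p (j + 2)) = 0 := by
  obtain ⟨c, hc, hc'⟩ := h.mulVec_nullE hp hp' hB hB'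
  have := h.isom (nullE p) (ev p (j + 2))
  rw [hc', map_smul, LinearMap.smul_apply, mf_ne_ev p (by omega), smul_eq_mul] at this
  exact (mul_eq_zero.mp this).resolve_left hc

include hp hp' hB hB' h in
-- The e-components of the images are orthogonal to the images of transverse vectors, so the
-- transverse components alone carry the inner products.
theorem transverse_mul : (transverse d G)ᵀ * transverse d G = 1 := by
  have hk := hB'.k_eq
  ext j k
  obtain ⟨c, hc⟩ := h.mulVec_transverse hp hp' hB hB' j
  have h1 := h.isom (ev p (j + 2)) (ev p (k + 2))
  rw [hc, map_add, map_smul, LinearMap.add_apply, LinearMap.smul_apply,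
    h.mf_nullE_mulVec hp hp' hB hB', smul_zero, add_zero, map_sum, LinearMap.sum_apply] at h1
  simp only [map_smul, LinearMap.smul_apply, smul_eq_mul] at h1
  rw [Matrix.mul_apply]
  simp only [Matrix.transpose_apply, transverse, Matrix.of_apply]
  simp only [mf_comm p (G *ᵥ ev p (k + 2))]
  rw [h1, Matrix.one_apply]
  by_cases hjk : j = k
  · rw [hjk, mf_ev_self p (by omega) (by omega), if_pos rfl]
  · have : (j : ℕ) ≠ k := by simpa [Fin.val_inj] using hjk
    rw [mf_ev_ne p (by omega), if_neg hjk]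

include hp hp' hB' h hB in
-- The conjugate of the j-th generator commutes with the i-th generator of the target; this is the
-- cocycle condition between them.
theorem relation {c : ℝ} (hc : G *ᵥ nullE p = c • nullE p) (i j : Fin d) :
    (c • wedge (nullE p) (G *ᵥ ev p (j + 2))) *ᵥ τ' i =
      mf p (G *ᵥ τ j - (c • wedge (nullE p) (G *ᵥ ev p (j + 2))) *ᵥ a) (ev p (i + 2)) • nullE p -
      mf p (G *ᵥ τ j - (c • wedge (nullE p) (G *ᵥ ev p (j + 2))) *ᵥ a) (nullE p) •
        ev p (i + 2) := by
  have h1 := (h.iff _).mp (null_gen_mem hp hB j)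
  rw [conj_aff_wedge h.isom, hc, wedge_smul_left] at h1
  obtain ⟨-, -, -, h2⟩ := null_mulVec hp' hB' h1
  exact h2 i

end ConjBy

/-- Pairing `relation` with f gives b'_i R_ij = R_ij (c⁻¹ b_j + ⟨e, a⟩) for the orthogonal matrix R
of transverse components. The two diagonal matrices are similar, so their entries agree up to a
permutation. -/
theorem ConjBy.multi {n : ℕ} {b b' : Fin (n + 2) → ℝ}
    (hp : p = (Block.multi n b).k + 2 * l + m)
    (h : ConjBy G a (std p (.multi n b) l m) (std p (.multi n b') l m)) {c : ℝ} (hc0 : c ≠ 0)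
    (hc : G *ᵥ nullE p = c • nullE p) :
    ∃ (t : ℝ) (σ : Equiv.Perm (Fin (n + 2))), ∀ i, c⁻¹ * b i + t = b' (σ i) := by
  have hn : n + 3 ≤ p := by simp only [Block.k] at hp; omega
  have hp' : p = (Block.multi n b').k + 2 * l + m := hp
  have hB := nullType_multi hn b
  have hB' := nullType_multi hn b'
  have hR := h.transverse_mul hp hp' hB hB'
  have key : Matrix.diagonal b' * transverse (n + 2) G = transverse (n + 2) G *
      Matrix.diagonal fun i => c⁻¹ * b i + mf p (nullE p) a := by
    ext i j
    rw [Matrix.diagonal_mul, Matrix.mul_diagonal]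
    have h1 := congrArg (fun v => mf p v (nullF p)) (h.relation hp hp' hB hB' hc i j)
    have h2 := h.mf_nullE_mulVec hp hp' hB hB' j
    simp only [Matrix.smul_mulVec, wedge_mulVec, Matrix.mulVec_smul, map_sub, map_smul,
      LinearMap.sub_apply, LinearMap.smul_apply, smul_eq_mul, mf_ne_ev p (Nat.le_add_left 2 i),
      mf_ev_nf p (Nat.le_add_left 2 i), mf_ne_nf (show 1 ≤ p by omega)] at h1
    change b' i * mf p (G *ᵥ ev p (j + 2)) (ev p (i + 2)) =
      mf p (G *ᵥ ev p (j + 2)) (ev p (i + 2)) * _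
    field_simp
    linarith
  obtain ⟨σ, hσ⟩ := exists_perm_of_diagonal_similar hR key
  exact ⟨_, σ, fun i => congrFun hσ i⟩

/-- With one transverse direction R is a sign r. Pairing `relation` with e_2 compares the
f-components, and ⟨Gf, e⟩ = -2/c accounts for the second factor c. -/
theorem ConjBy.null {κ κ' : SignType} (hp : p = (Block.null κ).k + 2 * l + m)
    (h : ConjBy G a (std p (.null κ) l m) (std p (.null κ') l m)) {c : ℝ} (hc0 : c ≠ 0)
    (hc : G *ᵥ nullE p = c • nullE p) :
    ∃ r : ℝ, (r = 1 ∨ r = -1) ∧ κ' * c ^ 2 * r = (κ : ℝ) ∧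
      ∃ s : ℝ, G *ᵥ ev p 2 = r • ev p 2 + s • nullE p := by
  have hn : 2 ≤ p := by simp only [Block.k] at hp; omega
  have hp' : p = (Block.null κ').k + 2 * l + m := hp
  have hB := nullType_null hn κ
  have hB' := nullType_null hn κ'
  have hR := congrFun (congrFun (h.transverse_mul hp hp' hB hB') 0) 0
  obtain ⟨s, hs⟩ := h.mulVec_transverse hp hp' hB hB' 0
  have h1 := congrArg (fun v => mf p v (ev p 2)) (h.relation hp hp' hB hB' hc 0 0)
  have h2 := h.mf_nullE_mulVec hp hp' hB hB' 0
  have h3 := h.isom (nullF p) (nullE p)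
  simp only [Fin.val_zero, zero_add, Finset.univ_unique, Fin.default_eq_zero,
    Finset.sum_singleton] at hs h1 h2
  rw [hc, map_smul, mf_nf_ne (by omega), smul_eq_mul] at h3
  simp only [Matrix.mul_apply, Matrix.transpose_apply, transverse, Matrix.of_apply, Fin.val_zero,
    zero_add, Finset.univ_unique, Fin.default_eq_zero, Finset.sum_singleton,
    Matrix.one_apply_eq] at hR
  refine ⟨_, mul_self_eq_one_iff.mp hR, ?_, s, hs⟩
  rw [mf_comm] at h2
  simp only [Matrix.smul_mulVec, wedge_mulVec, Matrix.mulVec_smul, map_sub, map_smul,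
    LinearMap.sub_apply, LinearMap.smul_apply, smul_eq_mul, mf_ne_ev p le_rfl,
    mf_ne_nf (show 1 ≤ p by omega), mf_ev_self p hn two_ne_zero, h2, mf_ne_ne (show 1 ≤ p by omega)]
    at h1
  have h4 : mf p (G *ᵥ nullF p) (nullE p) = -2 * c⁻¹ := by
    field_simp
    linarith
  rw [h4] at h1
  field_simp at h1
  linarith

/-- A time-orientation preserving isometry multiplies null vectors by positive numbers. -/
theorem Isom.pos_of_mulVec_nullE (hp : 1 ≤ p) (hG : Isom G) (h0 : 0 < G 0 0) {c : ℝ}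
    (hc : G *ᵥ nullE p = c • nullE p) : 0 < c := by
  obtain ⟨q, rfl⟩ : ∃ q, p = q + 1 := ⟨p - 1, by omega⟩
  have h1 := congrFun (congrFun ((isom_iff G).mpr hG) 0) 0
  have h2 : c = G 0 0 - G 0 1 := by
    have h3 : nullE (q + 1) = Pi.single 0 1 - Pi.single 1 1 :=
      congrArg₂ _ (ev_eq_single (q + 1) 0) (ev_eq_single (q + 1) 1)
    rw [h3, Matrix.mulVec_sub, Matrix.mulVec_single_one, Matrix.mulVec_single_one] at hc
    simpa using (congrFun hc 0).symm
  have h3 : -(G 0 0 * G 0 0) + ∑ i : Fin (q + 1), G 0 i.succ * G 0 i.succ = -1 := by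
    rw [metric, Matrix.mul_apply, Fin.sum_univ_succ] at h1
    simpa [gDiag] using h1
  rw [Fin.sum_univ_succ] at h3
  have h4 : 0 ≤ ∑ i : Fin q, G 0 i.succ.succ * G 0 i.succ.succ :=
    Finset.sum_nonneg fun i _ => mul_self_nonneg _
  simp only [Fin.succ_zero_eq_one] at h3
  -- The first row satisfies G_00² = 1 + ∑ G_0i², so G_00 exceeds |G_01|.
  rw [h2]
  nlinarith

/-- In the basis e, e_2, f the matrix is triangular with diagonal c, r, 1/c. -/
theorem det_eq_of_null {G : Matrix (Fin 3) (Fin 3) ℝ} (hG : Isom (p := 2) G) {c r s : ℝ}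
    (hc : G *ᵥ nullE 2 = c • nullE 2) (hs : G *ᵥ ev 2 2 = r • ev 2 2 + s • nullE 2) :
    G.det = r := by
  have e0 : ev 2 0 = Pi.single 0 1 := ev_eq_single 2 0
  have e1 : ev 2 1 = Pi.single 1 1 := ev_eq_single 2 1
  have e2 : ev 2 2 = Pi.single 2 1 := ev_eq_single 2 2
  have h3 := hG (nullF 2) (nullE 2)
  rw [hc, map_smul, mf_nf_ne (by omega), smul_eq_mul, mf_eq_sum_succ] at h3
  rw [nullE, e0, e1, Matrix.mulVec_sub, Matrix.mulVec_single_one, Matrix.mulVec_single_one] at hc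
  rw [nullE, e0, e1, e2, Matrix.mulVec_single_one] at hs
  rw [nullE, nullF, e0, e1, Matrix.mulVec_add, Matrix.mulVec_single_one,
    Matrix.mulVec_single_one] at h3
  have c0 := congrFun hc 0
  have c1 := congrFun hc 1
  have c2 := congrFun hc 2
  have s0 := congrFun hs 0
  have s1 := congrFun hs 1
  have s2 := congrFun hs 2
  simp [Fin.sum_univ_two] at c0 c1 c2 s0 s1 s2 h3
  have h5 : G 0 1 = G 0 0 - c := by linarith
  have h6 : G 1 1 = G 1 0 + c := by linarith
  have h7 : G 2 1 = G 2 0 := by linarith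
  have h4 : c * (G 0 0 + G 1 0) = 1 := by
    rw [h5, h6] at h3
    linarith
  rw [Matrix.det_fin_three, s0, s1, s2, h5, h6, h7]
  calc _ = c * (G 0 0 + G 1 0) * r := by ring
    _ = r := by rw [h4, one_mul]

theorem Block.Normalized.sum_eq_zero {n : ℕ} {b : Fin (n + 2) → ℝ}
    (h : (Block.multi n b).Normalized) : ∑ i, b i = 0 := by
  rcases h with ⟨-, -, h⟩ | h
  · exact h
  · exact Finset.sum_eq_zero fun i _ => h i

/-- Both families have zero sum, so the shift vanishes. Unless all constants are zero, the largest
absolute value is 1 on both sides, so the scale is 1 or -1. -/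
theorem Block.same_of_perm {n : ℕ} {b b' : Fin (n + 2) → ℝ} (hb : (Block.multi n b).Normalized)
    (hb' : (Block.multi n b').Normalized) {c t : ℝ} (hc : c ≠ 0) {σ : Equiv.Perm (Fin (n + 2))}
    (h : ∀ i, c * b i + t = b' (σ i)) :
    (0 < c ∧ (Block.multi n b).Same (.multi n b')) ∨
      ((Block.multi n b).Same (.multi n b') ∨ (Block.multi n b).neg.Same (.multi n b')) ∧
        ¬ 0 < c := by
  have ht : t = 0 := by
    have h1 : ∑ i, (c * b i + t) = ∑ i, b' i := by
      simp only [h]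
      exact Equiv.sum_comp σ b'
    rw [hb'.sum_eq_zero, Finset.sum_add_distrib, ← Finset.mul_sum, hb.sum_eq_zero] at h1
    simp only [mul_zero, Finset.sum_const, Finset.card_univ, Fintype.card_fin, nsmul_eq_mul,
      zero_add, mul_eq_zero] at h1
    refine h1.resolve_left ?_
    positivity
  subst ht
  simp only [add_zero] at h
  have h' : ∀ i, b' i = c * b (σ.symm i) := fun i => by rw [h, Equiv.apply_symm_apply]
  have same : c = 1 → (Block.multi n b).Same (.multi n b') := fun hc1 => by
    have : b' = b ∘ σ.symm := funext fun i => by rw [h', hc1, one_mul, Function.comp_apply]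
    rw [this]
    exact Block.Same.multi n b σ.symm
  have key : (∀ i, b i = 0) ∧ (∀ i, b' i = 0) ∨ |c| = 1 := by
    rcases hb with ⟨hb0, hb1, -⟩ | hb
    · rcases hb' with ⟨hb0', hb1', -⟩ | hb'
      · refine Or.inr (le_antisymm ?_ ?_)
        · have h1 := hb1' 0 (σ 0) (Fin.zero_le _)
          rwa [← h, hb0, hb0', mul_one, abs_one] at h1
        · have h1 := hb1 0 (σ.symm 0) (Fin.zero_le _)
          have h2 := h' 0
          rw [hb0'] at h2
          rw [hb0, abs_one] at h1
          have h3 := congrArg abs h2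
          rw [abs_one, abs_mul] at h3
          nlinarith [abs_nonneg c]
      · have h1 := h 0
        rw [hb', hb0, mul_one] at h1
        exact absurd h1 hc
    · refine Or.inl ⟨hb, fun i => ?_⟩
      rw [h', hb, mul_zero]
  rcases key with ⟨h1, h2⟩ | h1
  · have : (Block.multi n b).Same (.multi n b') := by
      have : b' = b ∘ Equiv.refl _ := funext fun i => by rw [h2, Function.comp_apply, h1]
      rw [this]
      exact Block.Same.multi n b _
    by_cases hc0 : 0 < c
    · exact Or.inl ⟨hc0, this⟩
    · exact Or.inr ⟨Or.inl this, hc0⟩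
  · rcases eq_or_eq_neg_of_abs_eq h1 with rfl | rfl
    · exact Or.inl ⟨one_pos, same rfl⟩
    · refine Or.inr ⟨Or.inr ?_, by norm_num⟩
      have : b' = (-b) ∘ σ.symm := funext fun i => by
        rw [h', neg_one_mul, Function.comp_apply, Pi.neg_apply]
      rw [this]
      exact Block.Same.multi n (-b) σ.symm

theorem SignType.eq_or_of_mul {κ κ' : SignType} {c r : ℝ} (hc : c ≠ 0) (hr : r = 1 ∨ r = -1)
    (h : κ' * c ^ 2 * r = (κ : ℝ)) : κ = κ' ∨ (κ' = -κ ∧ r = -1) := by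
  have hc2 : 0 < c ^ 2 := by positivity
  rcases hr with rfl | rfl <;> rcases κ with _ | _ | _ <;> rcases κ' with _ | _ | _ <;>
    simp_all <;> linarith

/-- Conjugate normalized standard subalgebras have the same constants up to a sign, and the sign
is trivial if the conjugation preserves the orientation of time (and, in dimension three, is
proper). -/
theorem ConjBy.same {l' m' : ℕ} (hN : B.Normalized) (hN' : B'.Normalized)
    (hp : p = B.k + 2 * l + m) (hp' : p = B'.k + 2 * l' + m')
    (h : ConjBy G a (std p B l m) (std p B' l' m')) :
    (B.Same B' ∨ B.neg.Same B') ∧ (0 < G 0 0 → B.k ≠ 2 → B.Same B') ∧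
      (0 < G 0 0 → 0 < G.det → p = 2 → B.Same B') := by
  obtain ⟨rfl, rfl⟩ := h.dims hp hp'
  have hk : B.k = B'.k := by omega
  rcases B with _ | _ | κ | ⟨n, b⟩ <;> rcases B' with _ | _ | κ' | ⟨n', b'⟩ <;>
    simp only [Block.k] at hk <;> try omega
  · exact ⟨Or.inl .time, fun _ _ => .time, fun _ _ _ => .time⟩
  · exact ⟨Or.inl .boost, fun _ _ => .boost, fun _ _ _ => .boost⟩
  · have hn : 2 ≤ p := by simp only [Block.k] at hp; omega
    obtain ⟨c, hc0, hc⟩ := h.mulVec_nullE hp hp' (nullType_null hn κ) (nullType_null hn κ')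
    obtain ⟨r, hr, hκ, s, hs⟩ := h.null hp hc0 hc
    have key := SignType.eq_or_of_mul hc0 hr hκ
    refine ⟨?_, fun _ h2 => absurd rfl h2, ?_⟩
    · rcases key with rfl | ⟨rfl, -⟩
      · exact Or.inl (.null _)
      · exact Or.inr (.null _)
    · rintro - hdet rfl
      rw [det_eq_of_null h.isom hc hs] at hdet
      rcases key with rfl | ⟨-, rfl⟩
      · exact .null _
      · norm_num at hdet
  · obtain rfl : n = n' := by omega
    have hn : n + 3 ≤ p := by simp only [Block.k] at hp; omega
    obtain ⟨c, hc0, hc⟩ := h.mulVec_nullE hp hp' (nullType_multi hn b) (nullType_multi hn b')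
    obtain ⟨t, σ, hσ⟩ := h.multi hp hc0 hc
    have hpos := fun h0 => inv_pos.mpr (h.isom.pos_of_mulVec_nullE (by omega) h0 hc)
    rcases Block.same_of_perm hN hN' (inv_ne_zero hc0) hσ with ⟨h1, h2⟩ | ⟨h1, h2⟩
    · exact ⟨Or.inl h2, fun _ _ => h2, fun _ _ _ => h2⟩
    · exact ⟨h1, fun h0 _ => absurd (hpos h0) h2, fun h0 _ _ => absurd (hpos h0) h2⟩

end Constants

end MinkMASA
namespace MinkMASA

/-! ### Orthogonal decomposability -/

section Decomposable

variable {p l m : ℕ} {B : Block}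

theorem ConjBy.orthDecomposable {G : Matrix (Fin (p + 1)) (Fin (p + 1)) ℝ} {a : V p}
    {A A' : LieSubalgebra ℝ (Mat p)} (hA' : A' ≤ eAlg p) (h : ConjBy G a A A')
    (hA : OrthDecomposable p A) : OrthDecomposable p A' := by
  obtain ⟨G', a', h1, h2, h'⟩ := h.symm
  let e : V p ≃ₗ[ℝ] V p := Matrix.toLin'OfInv h2 h1
  have he : ∀ v, e v = G *ᵥ v := fun v => by
    simp [e, Matrix.toLin'OfInv]
  have hne : ∀ W : Submodule ℝ (V p), W ≠ ⊥ → W.map (e : V p →ₗ[ℝ] V p) ≠ ⊥ := fun W hW h0 =>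
    hW (by simpa using h0)
  obtain ⟨W₁, W₂, hW₁, hW₂, hc, ho, hY⟩ := hA
  have hlin : ∀ Y ∈ A', ∃ X, X ∈ linParts A ∧ ∀ u, Y.toBlocks₁₁ *ᵥ e u = e (X *ᵥ u) := by
    intro Y hY
    obtain ⟨X, α, -, rfl⟩ := mem_eAlg_iff.mp (hA' hY)
    have h3 := (h'.iff _).mp hY
    rw [grp_conj h2] at h3
    refine ⟨_, ⟨_, h3⟩, fun u => ?_⟩
    rw [toBlocks_aff, he, he]
    simp only [Matrix.mulVec_mulVec, ← Matrix.mul_assoc, h1, Matrix.one_mul]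
  refine ⟨W₁.map (e : V p →ₗ[ℝ] V p), W₂.map (e : V p →ₗ[ℝ] V p), hne _ hW₁, hne _ hW₂,
    (Submodule.orderIsoMapComap e).isCompl_iff.mp hc, ?_, fun Y hYA => ?_⟩
  · rintro _ ⟨u, hu, rfl⟩ _ ⟨v, hv, rfl⟩
    have := ho u hu v hv
    rw [← mf_eq] at this ⊢
    rw [← h.isom, ← he, ← he] at this
    exact this
  · obtain ⟨X, ⟨α, hX⟩, hX'⟩ := hlin Y hYA
    obtain ⟨h3, h4⟩ := hY _ hX
    rw [toBlocks_aff] at h3 h4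
    constructor
    · rintro _ ⟨u, hu, rfl⟩
      exact ⟨_, h3 u hu, (hX' u).symm⟩
    · rintro _ ⟨u, hu, rfl⟩
      exact ⟨_, h4 u hu, (hX' u).symm⟩

theorem mf_mulVec_ev (X : Matrix (Fin (p + 1)) (Fin (p + 1)) ℝ) (i j : Fin (p + 1)) :
    mf p (X *ᵥ ev p i) (ev p j) = gDiag j * X j i := by
  rw [mf_ev, ev_eq_single, Matrix.mulVec_single_one, Matrix.col_apply]

/-- The linear parts do not mix M(k,1) with the coordinates beyond k. The two summands are given by
the vanishing of one or the other group of coordinates. -/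
theorem orthDecomposable_std (hp : p = B.k + 2 * l + m) (hlm : 0 < l + m) :
    OrthDecomposable p (std p B l m) := by
  let W (s : Set (Fin (p + 1))) : Submodule ℝ (V p) :=
    { carrier := {v | ∀ j ∈ s, v j = 0}
      add_mem' := fun {u v} hu hv j hj => by rw [Pi.add_apply, hu j hj, hv j hj, add_zero]
      zero_mem' := fun j _ => rfl
      smul_mem' := fun c v hv j hj => by rw [Pi.smul_apply, hv j hj, smul_zero] }
  have hW : ∀ s (X : Matrix (Fin (p + 1)) (Fin (p + 1)) ℝ), (∀ j ∈ s, ∀ i ∉ s, X j i = 0) →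
      ∀ u ∈ W s, X *ᵥ u ∈ W s := by
    intro s X hX u hu j hj
    rw [Matrix.mulVec, dotProduct]
    refine Finset.sum_eq_zero fun i _ => ?_
    by_cases hi : i ∈ s
    · rw [hu i hi, mul_zero]
    · rw [hX j hj i hi, zero_mul]
  let s : Set (Fin (p + 1)) := {j | B.k < j}
  have hs : ∀ j, j ∉ s ↔ (j : ℕ) ≤ B.k := fun j => by
    simp [s]
  have hne : ∀ (s : Set (Fin (p + 1))) (i : Fin (p + 1)), i ∉ s → W s ≠ ⊥ := by
    intro s i hi h0
    have h1 : Pi.single i (1 : ℝ) ∈ W s := fun j hj =>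
      Pi.single_eq_of_ne (show j ≠ i from fun h2 => hi (h2 ▸ hj)) 1
    rw [h0, Submodule.mem_bot] at h1
    simpa using congrFun h1 i
  refine ⟨W s, W sᶜ, hne s 0 ((hs 0).mpr (Nat.zero_le _)), hne sᶜ (Fin.last p) ?_, ?_, ?_, ?_⟩
  · rw [Set.notMem_compl_iff]
    change B.k < (Fin.last p : ℕ)
    rw [Fin.val_last]
    omega
  · refine isCompl_iff.mpr ⟨Submodule.disjoint_def.mpr fun v hv hv' => funext fun j => ?_,
      Submodule.codisjoint_iff_exists_add_eq.mpr fun v => ?_⟩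
    · by_cases hj : j ∈ s
      · exact hv j hj
      · exact hv' j hj
    · classical
      refine ⟨sᶜ.indicator v, s.indicator v, fun j hj => ?_, fun j hj => ?_,
        Set.indicator_compl_add_self s v⟩
      · exact Set.indicator_of_notMem (by simpa using hj) v
      · exact Set.indicator_of_notMem hj v
  · intro u hu v hv
    rw [← mf_eq, mf_eq_sum]
    refine Finset.sum_eq_zero fun j _ => ?_
    by_cases hj : j ∈ s
    · rw [hu j hj, zero_mul, mul_zero]
    · rw [hv j hj, mul_zero, mul_zero]
  · intro Y hY
    obtain ⟨X, α, hX, rfl⟩ := mem_eAlg_iff.mp (std_le_eAlg hp hY)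
    have hS := splits_of_mem_std hp hY
    rw [toBlocks_aff]
    refine ⟨hW s X fun j hj i hi => ?_, hW sᶜ X fun j hj i hi => ?_⟩
    · have := hS.mf_eq_zero hp hX ((hs i).mp hi) hj (by omega)
      rw [mf_mulVec_ev] at this
      exact (mul_eq_zero.mp this).resolve_left (gDiag_ne_zero _)
    · rw [Set.notMem_compl_iff] at hi
      have := hS.mf_eq_zero hp hX ((hs j).mp hj) hi (by omega)
      rw [hX, mf_comm, neg_eq_zero, mf_mulVec_ev] at this
      exact (mul_eq_zero.mp this).resolve_left (gDiag_ne_zero _)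

/-- An invariant subspace of a block of null type contains the null direction. -/
theorem nullE_mem_of_invariant {d : ℕ} {τ : Fin d → V p} (hp : p = B.k)
    (hB : NullType p B d τ) {W : Submodule ℝ (V p)} (hW : W ≠ ⊥)
    (h : ∀ Y ∈ std p B 0 0, ∀ u ∈ W, Y.toBlocks₁₁ *ᵥ u ∈ W) : nullE p ∈ W := by
  have hk := hB.k_eq
  have hd := hB.pos
  have hN : ∀ (j : Fin d), ∀ u ∈ W,
      mf p (ev p (j + 2)) u • nullE p - mf p (nullE p) u • ev p (j + 2) ∈ W := fun j u hu => by
    have := h _ (null_gen_mem (by omega) hB j) u hu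
    rwa [toBlocks_aff, wedge_mulVec] at this
  obtain ⟨u, hu, hu0⟩ := (Submodule.ne_bot_iff W).mp hW
  by_cases h1 : mf p (nullE p) u = 0
  · by_cases h2 : ∀ j : Fin d, mf p (ev p (j + 2)) u = 0
    · have h3 : u + (1 / 2 * mf p u (nullF p)) • nullE p = 0 := by
        refine eq_zero_of_mf p fun j hj => ?_
        by_cases hj2 : 2 ≤ j
        · have := h2 ⟨j - 2, by omega⟩
          simp only [show j - 2 + 2 = j by omega] at this
          rw [map_add, map_smul, LinearMap.add_apply, LinearMap.smul_apply, mf_comm, this,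
            mf_ne_ev p hj2, smul_zero, add_zero]
        · obtain rfl | rfl : j = 0 ∨ j = 1 := by omega
          · simp only [ev_zero_eq, map_add, map_smul, LinearMap.add_apply, LinearMap.smul_apply,
              smul_eq_mul, mf_comm p u (nullE p), h1, mf_ne_ne (show 1 ≤ p by omega),
              mf_ne_nf (show 1 ≤ p by omega)]
            ring
          · simp only [ev_one_eq, map_add, map_sub, map_smul, LinearMap.add_apply,
              LinearMap.smul_apply,
              smul_eq_mul, mf_comm p u (nullE p), h1, mf_ne_ne (show 1 ≤ p by omega),
              mf_ne_nf (show 1 ≤ p by omega)]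
            ring
      have h4 : 1 / 2 * mf p u (nullF p) ≠ 0 := fun h0 => hu0 (by rwa [h0, zero_smul, add_zero] at h3)
      have h5 := eq_neg_of_add_eq_zero_right h3
      exact (Submodule.smul_mem_iff W h4).mp (h5 ▸ neg_mem hu)
    · push Not at h2
      obtain ⟨j, hj⟩ := h2
      have := hN j u hu
      rw [h1, zero_smul, sub_zero] at this
      exact (Submodule.smul_mem_iff W hj).mp this
  -- Applying e ∧ e_2 twice to u gives -⟨e, u⟩e.
  · have := hN ⟨0, hd⟩ _ (hN ⟨0, hd⟩ u hu)
    simp only [map_sub, map_smul, mf_ne_ne (show 1 ≤ p by omega), zero_add, mf_ne_ev p le_rfl,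
      mf_ev_ne' p le_rfl, mf_ev_self p (show 2 ≤ p by omega) two_ne_zero, smul_eq_mul, mul_zero,
      mul_one, zero_sub, sub_zero, zero_smul] at this
    exact (Submodule.smul_mem_iff W (neg_ne_zero.mpr h1)).mp this

theorem not_orthDecomposable_time : ¬ OrthDecomposable 0 (std 0 .time 0 0) := by
  rintro ⟨W₁, W₂, hW₁, hW₂, -, ho, -⟩
  obtain ⟨u, hu, hu0⟩ := (Submodule.ne_bot_iff W₁).mp hW₁
  obtain ⟨v, hv, hv0⟩ := (Submodule.ne_bot_iff W₂).mp hW₂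
  have h := ho u hu v hv
  rw [← mf_eq, mf_eq_sum_succ] at h
  simp only [Finset.univ_eq_empty, Finset.sum_empty, add_zero, neg_eq_zero, mul_eq_zero] at h
  rcases h with h | h
  · exact hu0 (funext fun i => by rwa [Fin.fin_one_eq_zero i])
  · exact hv0 (funext fun i => by rwa [Fin.fin_one_eq_zero i])

/-- Orthogonality of v to both u and the boosted u says that products of opposite null coordinates
vanish. Hence u and v lie on the same null line, against complementarity. -/
theorem not_orthDecomposable_boost : ¬ OrthDecomposable 1 (std 1 .boost 0 0) := by
  rintro ⟨W₁, W₂, hW₁, hW₂, hc, ho, hY⟩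
  obtain ⟨u, hu, hu0⟩ := (Submodule.ne_bot_iff W₁).mp hW₁
  obtain ⟨v, hv, hv0⟩ := (Submodule.ne_bot_iff W₂).mp hW₂
  have hmem := mem_std_of_gens (p := 1) (B := .boost) (l := 0) (m := 0) rfl
    (g := aff (wedge (ev 1 0) (ev 1 1)) 0) (Or.inl (Or.inl (by rw [boost_gens le_rfl]; rfl)))
  have h1 := ho u hu v hv
  have h2 := ho _ ((hY _ hmem).1 u hu) v hv
  rw [toBlocks_aff, wedge_mulVec] at h2
  rw [← mf_eq] at h1 h2
  have e0 : ∀ w, mf 1 (ev 1 0) w = -w 0 := fun w => by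
    rw [mf_comm]
    simpa [gDiag] using mf_ev 1 w 0
  have e1 : ∀ w, mf 1 (ev 1 1) w = w 1 := fun w => by
    rw [mf_comm]
    simpa [gDiag] using mf_ev 1 w 1
  rw [map_sub, map_smul, map_smul, LinearMap.sub_apply, LinearMap.smul_apply,
    LinearMap.smul_apply, e0, e0, e1, e1, smul_eq_mul, smul_eq_mul] at h2
  rw [mf_eq_sum_succ] at h1
  simp only [Finset.univ_unique, Fin.default_eq_zero, Finset.sum_singleton,
    Fin.succ_zero_eq_one] at h1
  have ext2 : ∀ w w' : V 1, w 0 = w' 0 → w 1 = w' 1 → w = w' := fun w w' h h' => by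
    ext i
    fin_cases i
    · exact h
    · exact h'
  have hsum : (u 0 - u 1) * (v 0 + v 1) = 0 := by linarith
  have hdiff : (u 0 + u 1) * (v 0 - v 1) = 0 := by linarith
  have hprop : u 0 • v = v 0 • u := by
    refine ext2 _ _ (mul_comm _ _) ?_
    simp only [Pi.smul_apply, smul_eq_mul]
    rcases mul_eq_zero.mp hsum with h3 | h3 <;> rcases mul_eq_zero.mp hdiff with h4 | h4
    · have : u 0 = 0 := by linarith
      have h5 : u 1 = 0 := by linarith
      rw [this, h5, zero_mul, mul_zero]
    · rw [sub_eq_zero.mp h3, ← sub_eq_zero.mp h4, mul_comm]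
    · rw [eq_neg_of_add_eq_zero_left h3, eq_neg_of_add_eq_zero_left h4]
      ring
    · have : v 0 = 0 := by linarith
      have h5 : v 1 = 0 := by linarith
      rw [this, h5, zero_mul, mul_zero]
  have hd := Submodule.disjoint_def.mp hc.disjoint
  have h3 := hd (v 0 • u) (W₁.smul_mem _ hu) (hprop ▸ W₂.smul_mem _ hv)
  have h4 : v 0 = 0 := (smul_eq_zero.mp h3).resolve_right hu0
  rw [h4, zero_smul] at hprop
  have h5 : u 0 = 0 := (smul_eq_zero.mp hprop).resolve_right hv0
  have hu1 : u 1 ≠ 0 := fun h => hu0 (ext2 _ _ h5 h)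
  have hv1 : v 1 ≠ 0 := fun h => hv0 (ext2 _ _ h4 h)
  rw [h4, h5, mul_zero, neg_zero, zero_add] at h1
  exact mul_ne_zero hu1 hv1 h1

/-- For null types both summands would contain the null direction e; the other two types live in
dimensions one and two. -/
theorem not_orthDecomposable_std (hp : B.k = p) : ¬ OrthDecomposable p (std p B 0 0) := by
  rcases Block.cases_type (p := p) B hp.le with rfl | rfl | ⟨d, τ, hB⟩
  · obtain rfl : 0 = p := hp
    exact not_orthDecomposable_time
  · obtain rfl : 1 = p := hp
    exact not_orthDecomposable_boost
  · rintro ⟨W₁, W₂, hW₁, hW₂, hc, -, hY⟩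
    have hk := hB.k_eq
    have hd := hB.pos
    have h1 := nullE_mem_of_invariant hp.symm hB hW₁ fun Y hYA => (hY Y hYA).1
    have h2 := nullE_mem_of_invariant hp.symm hB hW₂ fun Y hYA => (hY Y hYA).2
    exact ne_ne_zero (by omega) (Submodule.disjoint_def.mp hc.disjoint _ h1 h2)

end Decomposable

/-! ### The connected component of the identity -/

section Component

variable {p : ℕ}

theorem one_mem_eGroup (p : ℕ) : (1 : Mat p) ∈ eGroup p :=
  mem_eGroup_iff.mpr ⟨1, 0, fun u v => by rw [Matrix.one_mulVec, Matrix.one_mulVec],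
    grp_one.symm⟩

theorem eGroup₀_subset (p : ℕ) : eGroup₀ p ⊆ eGroup p := connectedComponentIn_subset _ _

/-- A continuous function without zeros on the group keeps its sign on a connected component. It is
applied to the determinant and to the entry G_00, where G_00² ≥ 1. -/
theorem pos_of_mem_eGroup₀ {H : Mat p} (hH : H ∈ eGroup₀ p) {f : Mat p → ℝ} (hf : Continuous f)
    (h0 : ∀ H ∈ eGroup p, f H ≠ 0) (h1 : 0 < f 1) : 0 < f H := by
  by_contra hneg
  obtain ⟨H', hH', h2⟩ := isPreconnected_connectedComponentIn.intermediate_value hH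
    (mem_connectedComponentIn (one_mem_eGroup p)) hf.continuousOn ⟨not_lt.mp hneg, h1.le⟩
  exact h0 H' (eGroup₀_subset p hH') h2

theorem det_pos_of_mem_eGroup₀ {G : Matrix (Fin (p + 1)) (Fin (p + 1)) ℝ} {a : V p}
    (h : grp G a ∈ eGroup₀ p) : 0 < G.det := by
  have hdet : ∀ (G : Matrix (Fin (p + 1)) (Fin (p + 1)) ℝ) (a : V p),
      (grp G a).det = G.det := fun G a => by
    rw [grp, Matrix.det_fromBlocks_zero₂₁, Matrix.det_one, mul_one]
  rw [← hdet G a]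
  refine pos_of_mem_eGroup₀ h (f := Matrix.det) continuous_id.matrix_det (fun H hH h0 => ?_) (by simp)
  have h1 := congrArg Matrix.det (eGroup_mul_inv hH)
  rw [Matrix.det_mul, Matrix.det_one] at h1
  rw [h0, zero_mul] at h1
  exact zero_ne_one h1

theorem time_pos_of_mem_eGroup₀ {G : Matrix (Fin (p + 1)) (Fin (p + 1)) ℝ} {a : V p}
    (h : grp G a ∈ eGroup₀ p) : 0 < G 0 0 := by
  refine pos_of_mem_eGroup₀ (f := fun H => H (Sum.inl 0) (Sum.inl 0)) h (by fun_prop)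
    (fun H hH h0 => ?_) (by simp)
  obtain ⟨G, a, hG, rfl⟩ := mem_eGroup_iff.mp hH
  change G 0 0 = 0 at h0
  have h1 := congrFun (congrFun ((isom_iff G).mpr hG) 0) 0
  have h3 : -(G 0 0 * G 0 0) + ∑ i : Fin p, G 0 i.succ * G 0 i.succ = -1 := by
    rw [metric, Matrix.mul_apply, Fin.sum_univ_succ] at h1
    simpa [gDiag] using h1
  have h4 : 0 ≤ ∑ i : Fin p, G 0 i.succ * G 0 i.succ :=
    Finset.sum_nonneg fun i _ => mul_self_nonneg _
  rw [h0] at h3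
  linarith

end Component

/-! ### Equivalences between standard subalgebras -/

section Equivalence

variable {p l m : ℕ} {B B' : Block}

theorem Conj.refl (A : LieSubalgebra ℝ (Mat p)) : Conj (eGroup p) A A :=
  ⟨1, one_mem_eGroup p, by simp⟩

theorem Conj.trans {A A' A'' : LieSubalgebra ℝ (Mat p)} (h : Conj (eGroup p) A A')
    (h' : Conj (eGroup p) A' A'') : Conj (eGroup p) A A'' := by
  rw [conj_iff subset_rfl] at h h' ⊢
  obtain ⟨H, hH, h⟩ := h
  obtain ⟨H', hH', h'⟩ := h'
  refine ⟨H' * H, ?_, fun Y => ?_⟩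
  · obtain ⟨G, a, hG, rfl⟩ := mem_eGroup_iff.mp hH
    obtain ⟨G', a', hG', rfl⟩ := mem_eGroup_iff.mp hH'
    rw [grp_mul]
    exact mem_eGroup_iff.mpr ⟨_, _, fun u v => by
      rw [← Matrix.mulVec_mulVec, ← Matrix.mulVec_mulVec, hG', hG], rfl⟩
  · rw [h, h', Matrix.mul_inv_rev]
    simp only [Matrix.mul_assoc]

theorem Block.neg_k (B : Block) : B.neg.k = B.k := by
  cases B <;> rfl

/-- Conjugation by -1, an element of O(p,1), fixes all linear parts and negates all translation
parts, hence negates the constants. -/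
theorem conj_std_neg (hp : p = B.k + 2 * l + m) :
    Conj (eGroup p) (std p B l m) (std p B.neg l m) := by
  have hp' : p = B.neg.k + 2 * l + m := by rw [B.neg_k, ← hp]
  have hG : Isom (p := p) (-1) := fun u v => by simp [Matrix.neg_mulVec]
  have hconj : ∀ X (α : V p), grp (-1) 0 * aff X α * (grp (-1) 0)⁻¹ = aff X (-α) := fun X α => by
    rw [grp_conj (G' := -1) (by simp)]
    simp [Matrix.neg_mulVec]
  have hsub : ∀ g ∈ stdGens p B.neg l m, g ∈ std p B.neg l m := fun g => mem_std_of_gens hp'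
  have htr : ∀ v : V p, aff 0 v ∈ std p B.neg l m → aff 0 (-v) ∈ std p B.neg l m := fun v hv => by
    have := neg_mem hv
    rwa [← neg_one_smul ℝ, aff_smul, smul_zero, neg_one_smul] at this
  rw [forall_stdGens, B.neg_k] at hsub
  refine conj_of_gens hp (std_le_eAlg hp') (std_abelian hp') (H := grp (-1) 0)
    (mem_eGroup_iff.mpr ⟨_, _, hG, rfl⟩) (forall_stdGens.mpr ⟨?_, fun i => ?_, fun i => ?_⟩)
  · have h1 := hsub.1
    rcases B with _ | _ | κ | ⟨n, b⟩
    · simp only [Block.neg, time_gens, Set.mem_singleton_iff, forall_eq] at h1 ⊢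
      rw [hconj]
      exact htr _ h1
    · have hp1 : 1 ≤ p := by simp only [Block.k] at hp; omega
      simp only [Block.neg, boost_gens hp1, Set.mem_singleton_iff, forall_eq] at h1 ⊢
      rw [hconj, neg_zero]
      exact h1
    · have hp2 : 2 ≤ p := by simp only [Block.k] at hp; omega
      simp only [Block.neg, null_gens hp2, forall_nullGens, SignType.coe_neg, neg_smul] at h1 ⊢
      simp only [hconj]
      exact ⟨htr _ h1.1, h1.2⟩
    · have hp2 : n + 3 ≤ p := by simp only [Block.k] at hp; omega
      simp only [Block.neg, multi_gens hp2, forall_nullGens, Pi.neg_apply, neg_smul] at h1 ⊢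
      simp only [hconj]
      exact ⟨htr _ h1.1, h1.2⟩
  · rw [hconj, neg_zero]
    exact hsub.2.1 i
  · rw [hconj]
    exact htr _ (hsub.2.2 i)

/-- Permuting the transverse coordinates is an isometry fixing e and all coordinates beyond the
block. -/
theorem conj_std_perm {n : ℕ} (b : Fin (n + 2) → ℝ) (σ : Equiv.Perm (Fin (n + 2)))
    (hp : p = (Block.multi n b).k + 2 * l + m) :
    Conj (eGroup p) (std p (.multi n b) l m) (std p (.multi n (b ∘ σ)) l m) := by
  have hp' : p = (Block.multi n (b ∘ σ)).k + 2 * l + m := hp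
  have hpn : p = n + 3 + 2 * l + m := hp
  -- The inverse permutation appears because the constant of index σ⁻¹(j) in b ∘ σ is b_j.
  let π : ℕ → ℕ := fun i => if h : 2 ≤ i ∧ i < n + 4 then
    (σ.symm ⟨i - 2, by omega⟩ : ℕ) + 2 else i
  have hπ1 : ∀ j : Fin (n + 2), π (j + 2) = σ.symm j + 2 := fun j => by
    simp only [π]
    rw [dif_pos (by omega)]
    rfl
  have hπ2 : ∀ i : ℕ, ¬ (2 ≤ i ∧ i < n + 4) → π i = i := fun i hi => dif_neg hi
  have hcases : ∀ i : ℕ, (∃ j : Fin (n + 2), i = j + 2) ∨ π i = i ∧ ¬ (2 ≤ i ∧ i < n + 4) := fun i => by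
    by_cases hi : 2 ≤ i ∧ i < n + 4
    · exact Or.inl ⟨⟨i - 2, by omega⟩, by simp only; omega⟩
    · exact Or.inr ⟨hπ2 i hi, hi⟩
  have hinj : ∀ i j, π i = π j → i = j := by
    intro i j hij
    rcases hcases i with ⟨i, rfl⟩ | ⟨hi, hi'⟩ <;> rcases hcases j with ⟨j, rfl⟩ | ⟨hj, hj'⟩
    · rw [hπ1, hπ1, Nat.add_right_cancel_iff, Fin.val_inj, σ.symm.injective.eq_iff] at hij
      rw [hij]
    · rw [hπ1, hj] at hij
      omega
    · rw [hπ1, hi] at hij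
      omega
    · rwa [hi, hj] at hij
  have hle : ∀ i, i ≤ p → π i ≤ p := fun i hi => by
    rcases hcases i with ⟨i, rfl⟩ | ⟨hi', -⟩
    · rw [hπ1]
      omega
    · rwa [hi']
  have hg : ∀ i, gDiag (π i) = gDiag i := fun i => by
    rcases hcases i with ⟨i, rfl⟩ | ⟨hi', -⟩
    · rw [hπ1]
      simp [gDiag]
    · rw [hi']
  obtain ⟨G, hG, hGev⟩ := exists_isom (p := p) (fun i => ev p (π i)) fun i j => by
    rw [mf_ev_ev p _ _ (hle i (by omega)), hg]
    by_cases hij : i = j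
    · rw [if_pos (by rw [hij]), if_pos hij]
    · rw [if_neg fun h => hij (Fin.ext (hinj _ _ h)), if_neg hij]
  have hGev' : ∀ i ≤ p, G *ᵥ ev p i = ev p (π i) := fun i hi => hGev ⟨i, by omega⟩
  have hfix : ∀ i ≤ p, ¬ (2 ≤ i ∧ i < n + 4) → G *ᵥ ev p i = ev p i := fun i hi h => by
    rw [hGev' i hi, hπ2 i h]
  have hGe : G *ᵥ nullE p = nullE p := by
    rw [nullE, Matrix.mulVec_sub, hfix 0 (by omega) (by omega), hfix 1 (by omega) (by omega)]
  have hsub : ∀ g ∈ stdGens p (.multi n (b ∘ σ)) l m, g ∈ std p (.multi n (b ∘ σ)) l m :=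
    fun g => mem_std_of_gens hp'
  rw [forall_stdGens, multi_gens (by omega), forall_nullGens] at hsub
  refine conj_of_gens hp (std_le_eAlg hp') (std_abelian hp') (H := grp G 0)
    (mem_eGroup_iff.mpr ⟨_, _, hG, rfl⟩) (forall_stdGens.mpr ⟨?_, fun i => ?_, fun i => ?_⟩)
  · rw [multi_gens (by omega), forall_nullGens]
    refine ⟨?_, fun j => ?_⟩
    · rw [conj_translation hG, hGe]
      exact hsub.1.1
    · rw [conj_aff_wedge hG, hGe, Matrix.mulVec_smul, hGev' _ (by omega), hπ1, Matrix.mulVec_zero,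
        sub_zero]
      have := hsub.1.2 (σ.symm j)
      rwa [Function.comp_apply, Equiv.apply_symm_apply] at this
  · simp only [Block.k] at hsub ⊢
    rw [conj_aff_wedge hG, hfix _ (by omega) (by omega), hfix _ (by omega) (by omega)]
    simpa using hsub.2.1 i
  · simp only [Block.k] at hsub ⊢
    rw [conj_translation hG, hfix _ (by omega) (by omega)]
    exact hsub.2.2 i

theorem Block.Same.conj_std (h : B.Same B') (hp : p = B.k + 2 * l + m) :
    Conj (eGroup p) (std p B l m) (std p B' l m) := by
  rcases h with _ | _ | κ | ⟨n, b, σ⟩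
  · exact Conj.refl _
  · exact Conj.refl _
  · exact Conj.refl _
  · exact conj_std_perm b σ hp

end Equivalence

theorem Block.exists_normalized (p : ℕ) : ∃ B : Block, B.Normalized ∧ B.k = p := by
  match p with
  | 0 => exact ⟨.time, trivial, rfl⟩
  | 1 => exact ⟨.boost, trivial, rfl⟩
  | 2 => exact ⟨.null 0, trivial, rfl⟩
  | n + 3 => exact ⟨.multi n 0, Or.inr fun _ => rfl, rfl⟩

end MinkMASA
-- Assembly of the classification
theorem theorem4p3 (p : ℕ) :
    -- (1) indecomposable MASAs exist, and up to `E(p,1)` they are exactly the listed ones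
    ((∃ A, IsMASA p A ∧ ¬ OrthDecomposable p A) ∧
      (∀ B : Block, B.Normalized → B.k = p →
        IsMASA p (std p B 0 0) ∧ ¬ OrthDecomposable p (std p B 0 0)) ∧
      (∀ A, IsMASA p A → ¬ OrthDecomposable p A →
        ∃ B : Block, B.Normalized ∧ B.k = p ∧ Conj (eGroup p) (std p B 0 0) A) ∧
      -- inequivalence under the connected component of `E(p,1)`
      (∀ B B' : Block, B.Normalized → B'.Normalized → B.k = p → B'.k = p →
        Conj (eGroup₀ p) (std p B 0 0) (std p B' 0 0) → B.Same B') ∧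
      -- `κ = 1` and `κ = -1` are equivalent under the whole group
      (p = 2 → Conj (eGroup p) (std p (Block.null 1) 0 0) (std p (Block.null (-1)) 0 0))) ∧
    -- (2) the MASAs of `e(p,1)` are those given by the orthogonal decompositions
    (∀ A, IsMASA p A ↔ ∃ (B : Block) (l m : ℕ), B.Normalized ∧ p = B.k + 2 * l + m ∧
      Conj (eGroup p) (std p B l m) A) ∧
    -- (3) equivalence under `E(p,1)`, and inequivalence under its connected component
    (∀ (B B' : Block) (l l' m m' : ℕ), B.Normalized → B'.Normalized →
      p = B.k + 2 * l + m → p = B'.k + 2 * l' + m' →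
      (Conj (eGroup p) (std p B l m) (std p B' l' m') ↔
        l = l' ∧ m = m' ∧ (B.Same B' ∨ B.neg.Same B')) ∧
      (Conj (eGroup₀ p) (std p B l m) (std p B' l' m') →
        l = l' ∧ m = m' ∧ (B.Same B' ∨ (B.k = 2 ∧ 0 < l + m ∧ B.neg.Same B')))) := by
  have key : ∀ (B B' : Block) (l l' m m' : ℕ), B.Normalized → B'.Normalized →
      p = B.k + 2 * l + m → p = B'.k + 2 * l' + m' →
      Conj (eGroup₀ p) (std p B l m) (std p B' l' m') →
        l = l' ∧ m = m' ∧ (B.Same B' ∨ (B.k = 2 ∧ 0 < l + m ∧ B.neg.Same B')) := by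
    intro B B' l l' m m' hN hN' hp hp' h
    obtain ⟨G, a, hH, hG⟩ := h.exists_conjBy (eGroup₀_subset p)
    obtain ⟨h1, h2, h3⟩ := hG.same hN hN' hp hp'
    have h0 := time_pos_of_mem_eGroup₀ hH
    refine ⟨(hG.dims hp hp').1, (hG.dims hp hp').2, ?_⟩
    by_cases hk : B.k = 2
    · by_cases hlm : 0 < l + m
      · exact h1.imp_right fun h => ⟨hk, hlm, h⟩
      -- For l = m = 0 the dimension is p = 2, so the determinant equals the sign on the transverse
      -- direction and positivity rules out κ' = -κ ≠ κ.
      · exact Or.inl (h3 h0 (det_pos_of_mem_eGroup₀ hH) (by omega))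
    · exact Or.inl (h2 h0 hk)
  have indec : ∀ B : Block, B.k = p →
      IsMASA p (std p B 0 0) ∧ ¬ OrthDecomposable p (std p B 0 0) := fun B hk =>
    ⟨isMASA_std (by omega), not_orthDecomposable_std hk⟩
  refine ⟨⟨?_, fun B _ hk => indec B hk, fun A hA hA' => ?_, fun B B' hN hN' hk hk' h => ?_, ?_⟩,
    fun A => ⟨fun hA => hA.exists_conj_std, ?_⟩, fun B B' l l' m m' hN hN' hp hp' =>
      ⟨⟨fun h => ?_, ?_⟩, key B B' l l' m m' hN hN' hp hp'⟩⟩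
  · obtain ⟨B, -, hk⟩ := Block.exists_normalized p
    exact ⟨_, indec B hk⟩
  · obtain ⟨B, l, m, hN, hp, h⟩ := hA.exists_conj_std
    obtain ⟨G, a, -, hG⟩ := h.exists_conjBy subset_rfl
    -- A plane or line in the normal form would split off orthogonally, and decomposability is
    -- invariant under conjugation.
    have hlm : ¬ 0 < l + m := fun hlm =>
      hA' (hG.orthDecomposable hA.1 (orthDecomposable_std hp hlm))
    obtain ⟨rfl, rfl⟩ : l = 0 ∧ m = 0 := by omega
    exact ⟨B, hN, by omega, h⟩
  · obtain ⟨-, -, h1 | ⟨-, h1, -⟩⟩ := key B B' 0 0 0 0 hN hN' (by omega) (by omega) h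
    · exact h1
    · omega
  · rintro rfl
    exact conj_std_neg (B := .null 1) rfl
  · rintro ⟨B, l, m, -, hp, h⟩
    exact isMASA_of_conj (isMASA_std hp) h
  · obtain ⟨G, a, -, hG⟩ := h.exists_conjBy subset_rfl
    exact ⟨(hG.dims hp hp').1, (hG.dims hp hp').2, (hG.same hN hN' hp hp').1⟩
  · rintro ⟨rfl, rfl, h | h⟩
    · exact h.conj_std hp
    · exact (conj_std_neg hp).trans (h.conj_std (by rw [B.neg_k, ← hp]))
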